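/- Let $(M,g_{ab})$ be a connected oriented Riemannian 4-manifold that is hyper-Kähler in the sense that its Riemann tensor is anti-self-dual, $*R_{abcd}=-R_{abcd}$ (equivalently, $R_{ab}=0$ and the self-dual Weyl spinor $\tilde\Psi_{A'B'C'D'}$ vanishes); $\nabla$ is the Levi-Civita connection. Spinor indices are used in the Penrose–Rindler conventions: $a=AA'$, $g_{ab}=\epsilon_{AB}\epsilon_{A'B'}$, $(\nabla_a\nabla_b-\nabla_b\nabla_a)V^d=R_{abc}{}^dV^c$, and the orientation is such that 2-forms $\sigma_{AB}\epsilon_{A'B'}$ with $\sigma_{AB}$ symmetric are anti-self-dual (ASD) and 2-forms $\chi_{A'B'}\epsilon_{AB}$ with $\chi_{A'B'}$ symmetric are self-dual. Suppose that there is an oppositely oriented conformal Kähler structure, i.e. a real symmetric unprimed Killing spinor $\sigma_{AB}$, $$\nabla_{AA'}\sigma_{BC}=2\epsilon_{A(B}\xi_{C)A'},$$ for some vector field $\xi^a$, with $\sigma_{AB}\sigma^{AB}\neq0$ everywhere, and let $\Omega_-$ be a nowhere-vanishing smooth real function with $\Omega_-^{-2}=\tfrac12\sigma_{AB}\sigma^{AB}$.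 Let $\Psi_{ABCD}$ be the ASD Weyl spinor. Assume that $g$ is not flat and that $\sigma_{AB}$ (by a constant rescaling) and the sign of $\Omega_-$ are normalised so that $\Psi_{ABCD}=6\Omega_-^3\,o_{(A}o_Bo^\dagger_Co^\dagger_{D)}$ with $\sigma_{AB}=2{\rm i}\,\Omega_-^{-1}o_{(A}o^\dagger_{B)}$ and $o_Ao^{\dagger A}=1$; it is enough to require the contraction $\Psi_{ABCD}\sigma^{AB}\sigma^{CD}=-4\Omega_-$ of this at one point. Put $$\chi_{A'B'}=\tfrac12\nabla_{AA'}\xi^{A}{}_{B'},\qquad \mathcal E_+=\Omega_-+\xi_b\xi^b,$$ so that $\chi_{A'B'}$ is the self-dual part of $\nabla_a\xi_b$, and suppose that the Killing field $\xi$ is not ASD, i.e. $\chi_{A'B'}\not\equiv0$. Define $$H_{ab}=\sigma_{AB}\chi_{A'B'}-\tfrac12\mathcal E_+\,g_{ab},\qquad t_a=H_{ab}\xi^b .$$ Then $H_{ab}$ is a smooth symmetric real tensor field, $t^a$ is a smooth vector field, and $$\nabla_{(a}H_{bc)}=0,\qquad \nabla_{(a}t_{b)}=0,\qquad \nabla_{AA'}t^{A}{}_{B'}=0,\qquad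 [t,\xi]=0;$$ that is, $H_{ab}$ is a Killing tensor and $t^a$ is an ASD Killing vector commuting with $\xi^a$. -/

import Mathlib

open Bundle
open scoped Manifold ContDiff

noncomputable section

namespace HKSpinor

/-- The model space of a 4-manifold. -/
abbrev E4 : Type := EuclideanSpace ℝ (Fin 4)

/-! ### Two-component spinor algebra in a spin frame

The components of a tensor in a positively oriented orthonormal frame `e₀, …, e₃` are converted
into spinor components (an index `a` becomes a pair `AA'`) with the Infeld-van der Waerden symbols
`ivdw`, which satisfy `∑ₖ ivdw k A A' * ivdw k B B' = ε_AB ε_A'B'`, that is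
`g_ab = ε_AB ε_A'B'`. They are chosen so that the volume form of the frame is
`ε_abcd = ε_AC ε_BD ε_A'D' ε_B'C' - ε_AD ε_BC ε_A'C' ε_B'D'`; with this choice the 2-forms
`σ_AB ε_A'B'` are anti-self-dual and the 2-forms `χ_A'B' ε_AB` are self-dual. Real tensors
correspond to spinors that are invariant under Euclidean spinor conjugation. Indices are raised by
`κ^A = ε^AB κ_B`. -/

/-- The Levi-Civita spinor; `ε_AB` and `ε^AB` have the same components. -/
def eps : Matrix (Fin 2) (Fin 2) ℂ := !![0, 1; -1, 0]

/-- Infeld-van der Waerden symbols of an oriented orthonormal frame. -/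
def ivdw (k : Fin 4) : Matrix (Fin 2) (Fin 2) ℂ :=
  ((Real.sqrt 2 : ℝ) : ℂ)⁻¹ •
    (![!![1, 0; 0, 1], !![0, Complex.I; Complex.I, 0], !![0, 1; -1, 0],
      !![Complex.I, 0; 0, -Complex.I]] k)

/-- `V_AA'`. -/
def spin1 (V : Fin 4 → ℝ) (A A' : Fin 2) : ℂ := ∑ i, (V i : ℂ) * ivdw i A A'

/-- `T_AA'BB'`. -/
def spin2 (T : Fin 4 → Fin 4 → ℝ) (A A' B B' : Fin 2) : ℂ :=
  ∑ i, ∑ j, (T i j : ℂ) * ivdw i A A' * ivdw j B B'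

/-- `T_AA'BB'CC'`. -/
def spin3 (T : Fin 4 → Fin 4 → Fin 4 → ℝ) (A A' B B' C C' : Fin 2) : ℂ :=
  ∑ i, ∑ j, ∑ k, (T i j k : ℂ) * ivdw i A A' * ivdw j B B' * ivdw k C C'

/-- `T_AA'BB'CC'DD'`. -/
def spin4 (T : Fin 4 → Fin 4 → Fin 4 → Fin 4 → ℝ) (A A' B B' C C' D D' : Fin 2) : ℂ :=
  ∑ i, ∑ j, ∑ k, ∑ l,
    (T i j k l : ℂ) * ivdw i A A' * ivdw j B B' * ivdw k C C' * ivdw l D D'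

/-- `½ T_{AA'B}^{A'}`; it is `σ_AB` if `T_ab = σ_AB ε_A'B' + χ_A'B' ε_AB` with symmetric `σ`, `χ`. -/
def unprimedPart (T : Fin 4 → Fin 4 → ℝ) (A B : Fin 2) : ℂ :=
  (1 / 2) * ∑ A', ∑ B', eps A' B' * spin2 T A A' B B'

/-- `½ T_{AA'}^A_{B'}`; it is `χ_A'B'` if `T_ab = σ_AB ε_A'B' + χ_A'B' ε_AB` with symmetric `σ`,
`χ`. -/
def primedPart (T : Fin 4 → Fin 4 → ℝ) (A' B' : Fin 2) : ℂ :=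
  (1 / 2) * ∑ A, ∑ B, eps A B * spin2 T A A' B B'

/-- `s^AB = ε^AC ε^BD s_CD`. -/
def raise2 (s : Fin 2 → Fin 2 → ℂ) (A B : Fin 2) : ℂ :=
  ∑ C, ∑ D, eps A C * eps B D * s C D

/-- The curvature spinor `X_ABCD = ¼ R_{AA'B}^{A'}_{CC'D}^{C'}`. -/
def curvSpinor (R : Fin 4 → Fin 4 → Fin 4 → Fin 4 → ℝ) (A B C D : Fin 2) : ℂ :=
  (1 / 4) * ∑ A', ∑ B', ∑ C', ∑ D', eps A' B' * eps C' D' * spin4 R A A' B B' C C' D D'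

/-- The anti-self-dual Weyl spinor `Ψ_ABCD = X_(ABCD)`. -/
def weylSpinor (R : Fin 4 → Fin 4 → Fin 4 → Fin 4 → ℝ) (A B C D : Fin 2) : ℂ :=
  (1 / 24) * ∑ p : Equiv.Perm (Fin 4),
    curvSpinor R (![A, B, C, D] (p 0)) (![A, B, C, D] (p 1)) (![A, B, C, D] (p 2))
      (![A, B, C, D] (p 3))

/-! ### Riemannian geometry -/

section Geometry

variable {M : Type*} [TopologicalSpace M] [ChartedSpace E4 M]

/-- A (not necessarily smooth) field of covariant 2-tensors. -/
abbrev Tensor2 (M : Type*) [TopologicalSpace M] [ChartedSpace E4 M] : Type _ :=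
  ∀ x : M, TangentSpace 𝓘(ℝ, E4) x →ₗ[ℝ] TangentSpace 𝓘(ℝ, E4) x →ₗ[ℝ] ℝ

/-- A (not necessarily smooth) vector field. -/
abbrev VField (M : Type*) [TopologicalSpace M] [ChartedSpace E4 M] : Type _ :=
  ∀ x : M, TangentSpace 𝓘(ℝ, E4) x

/-- An affine connection: a covariant derivative on the tangent bundle. In Mathlib's argument order
`nab Y x u` is `(∇_u Y)(x)`. -/
abbrev Connection (M : Type*) [TopologicalSpace M] [ChartedSpace E4 M]
    [IsManifold 𝓘(ℝ, E4) ∞ M] : Type _ :=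
  CovariantDerivative 𝓘(ℝ, E4) E4 (fun x : M ↦ TangentSpace 𝓘(ℝ, E4) x)

variable [IsManifold 𝓘(ℝ, E4) ∞ M]

/-- Smoothness of a vector field at a point. -/
def SmoothVAt (X : VField M) (x : M) : Prop :=
  ContMDiffAt 𝓘(ℝ, E4) (𝓘(ℝ, E4).prod 𝓘(ℝ, E4)) ∞
    (fun y ↦ (TotalSpace.mk' E4 y (X y) : TangentBundle 𝓘(ℝ, E4) M)) x

/-- Smoothness of a 2-tensor field: it maps smooth vector fields to smooth functions. -/
def SmoothT (T : Tensor2 M) : Prop :=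
  ∀ (x : M) (X Y : VField M), SmoothVAt X x → SmoothVAt Y x →
    ContMDiffAt 𝓘(ℝ, E4) 𝓘(ℝ, ℝ) ∞ (fun y ↦ T y (X y) (Y y)) x

/-- A vector field extending a tangent vector `v` at `x`, smooth near `x`. -/
abbrev ext {x : M} (v : TangentSpace 𝓘(ℝ, E4) x) : VField M :=
  FiberBundle.extend E4 (E := fun x : M ↦ TangentSpace 𝓘(ℝ, E4) x) v

/-- The covariant derivative `u^a v^b w^c ∇_a T_bc` of a 2-tensor field. -/
def covT (nab : Connection M) (T : Tensor2 M) (x : M) (u v w : TangentSpace 𝓘(ℝ, E4) x) : ℝ :=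
  mvfderiv 𝓘(ℝ, E4) (fun y ↦ T y (ext v y) (ext w y)) x u
    - T x (nab (ext v) x u) w - T x v (nab (ext w) x u)

/-- The curvature operator `∇_u ∇_v w - ∇_v ∇_u w - ∇_[u,v] w`. -/
def curv (nab : Connection M) (x : M) (u v w : TangentSpace 𝓘(ℝ, E4) x) :
    TangentSpace 𝓘(ℝ, E4) x :=
  nab (fun y ↦ nab (ext w) y (ext v y)) x u - nab (fun y ↦ nab (ext w) y (ext u y)) x v
    - nab (ext w) x (VectorField.mlieBracket 𝓘(ℝ, E4) (ext u) (ext v) x)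

instance instFactFinrank (x : M) : Fact (Module.finrank ℝ (TangentSpace 𝓘(ℝ, E4) x) = 4) :=
  ⟨by
    change Module.finrank ℝ E4 = 4
    simp⟩

variable [RiemannianBundle (fun x : M ↦ TangentSpace 𝓘(ℝ, E4) x)]

/-- `u^a v^b ∇_a V_b`. -/
def covV (nab : Connection M) (V : VField M) (x : M) (u v : TangentSpace 𝓘(ℝ, E4) x) : ℝ :=
  inner ℝ (nab V x u) v

/-- The Riemann tensor `R_abcd u^a v^b w^c z^d`, with the sign convention
`(∇_a ∇_b - ∇_b ∇_a) V^d = R_abc^d V^c`. -/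
def riem (nab : Connection M) (x : M) (u v w z : TangentSpace 𝓘(ℝ, E4) x) : ℝ :=
  inner ℝ (curv nab x u v w) z

instance instRiemannianOne [IsContMDiffRiemannianBundle 𝓘(ℝ, E4) ∞ E4
    (fun x : M ↦ TangentSpace 𝓘(ℝ, E4) x)] :
    IsContMDiffRiemannianBundle 𝓘(ℝ, E4) 1 E4 (fun x : M ↦ TangentSpace 𝓘(ℝ, E4) x) :=
  IsContMDiffRiemannianBundle.of_le (n := ∞) (by norm_cast)

/-- The smooth, metric, torsion-free connection. -/
structure IsLeviCivita [IsContMDiffRiemannianBundle 𝓘(ℝ, E4) ∞ E4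
    (fun x : M ↦ TangentSpace 𝓘(ℝ, E4) x)] (nab : Connection M) : Prop where
  metric : nab.IsMetricCompatible
  torsion : nab.torsion = 0
  smooth : ∀ (x : M) (X Y : VField M), SmoothVAt X x → SmoothVAt Y x →
    SmoothVAt (fun y ↦ nab Y y (X y)) x

/-- An orientation of the manifold: orientations of the tangent spaces whose Riemannian volume form
is continuous. -/
def IsOrientation (o : ∀ x : M, Orientation ℝ (TangentSpace 𝓘(ℝ, E4) x) (Fin 4)) : Prop :=
  ∀ (x : M) (X : Fin 4 → VField M), (∀ i, SmoothVAt (X i) x) →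
    ContinuousAt (fun y ↦ (o y).volumeForm (fun i ↦ X i y)) x

/-- Positively oriented orthonormal bases of the tangent space at `x`. -/
structure OFrame (o : ∀ x : M, Orientation ℝ (TangentSpace 𝓘(ℝ, E4) x) (Fin 4)) (x : M) where
  basis : OrthonormalBasis (Fin 4) ℝ (TangentSpace 𝓘(ℝ, E4) x)
  oriented : basis.toBasis.orientation = o x

variable {o : ∀ x : M, Orientation ℝ (TangentSpace 𝓘(ℝ, E4) x) (Fin 4)}

namespace OFrame

variable {x : M} (e : OFrame o x)

/-- Frame components of a vector (equivalently of the dual covector). -/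
def comp1 (v : TangentSpace 𝓘(ℝ, E4) x) (i : Fin 4) : ℝ := inner ℝ v (e.basis i)

/-- Frame components of a function of two vectors. -/
def comp2 (T : TangentSpace 𝓘(ℝ, E4) x → TangentSpace 𝓘(ℝ, E4) x → ℝ) (i j : Fin 4) : ℝ :=
  T (e.basis i) (e.basis j)

/-- Frame components of a function of three vectors. -/
def comp3 (T : TangentSpace 𝓘(ℝ, E4) x → TangentSpace 𝓘(ℝ, E4) x → TangentSpace 𝓘(ℝ, E4) x → ℝ)
    (i j k : Fin 4) : ℝ :=
  T (e.basis i) (e.basis j) (e.basis k)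

/-- Frame components of a function of four vectors. -/
def comp4 (T : TangentSpace 𝓘(ℝ, E4) x → TangentSpace 𝓘(ℝ, E4) x → TangentSpace 𝓘(ℝ, E4) x →
    TangentSpace 𝓘(ℝ, E4) x → ℝ) (i j k l : Fin 4) : ℝ :=
  T (e.basis i) (e.basis j) (e.basis k) (e.basis l)

/-- The spinor components `σ_AB` of the field that is stored as the 2-form
`Z_ab = σ_AB ε_A'B'`. -/
def sigma (Z : Tensor2 M) : Fin 2 → Fin 2 → ℂ :=
  unprimedPart (e.comp2 (fun u v ↦ Z x u v))

/-- The spinor components `∇_AA' σ_BC`: since `ε_B'C'` is parallel,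
`∇_a Z_bc = (∇_AA' σ_BC) ε_B'C'`. -/
def nablaSigma (nab : Connection M) (Z : Tensor2 M) (A A' B C : Fin 2) : ℂ :=
  (1 / 2) * ∑ B', ∑ C', eps B' C' * spin3 (e.comp3 (covT nab Z x)) A A' B B' C C'

/-- The spinor components `V_AA'` of a vector field. -/
def vec (V : VField M) (A A' : Fin 2) : ℂ := spin1 (e.comp1 (V x)) A A'

/-- `½ ∇_AA' V^A_B'`. For a Killing field `V` this is the self-dual part of `∇_a V_b`. -/
def chi (nab : Connection M) (V : VField M) (A' B' : Fin 2) : ℂ :=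
  primedPart (e.comp2 (covV nab V x)) A' B'

/-- The components `Ψ_ABCD` of the anti-self-dual Weyl spinor. -/
def Psi (nab : Connection M) (A B C D : Fin 2) : ℂ :=
  weylSpinor (e.comp4 (riem nab x)) A B C D

end OFrame

/-- Half-flatness `*R_abcd = -R_abcd`, where
`*R_abcd = ½ ε_ab^ef R_efcd`. This is the (local) hyper-Kähler condition: the metric is Ricci-flat
and its self-dual Weyl spinor vanishes. -/
def IsHyperKahler (nab : Connection M)
    (o : ∀ x : M, Orientation ℝ (TangentSpace 𝓘(ℝ, E4) x) (Fin 4)) : Prop :=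
  ∀ (x : M) (e : OFrame o x) (i j k l : Fin 4),
    (1 / 2 : ℝ) * ∑ m, ∑ n,
        (o x).volumeForm ![e.basis i, e.basis j, e.basis m, e.basis n]
          * riem nab x (e.basis m) (e.basis n) (e.basis k) (e.basis l)
      = - riem nab x (e.basis i) (e.basis j) (e.basis k) (e.basis l)

/-- `Z` is a smooth 2-form `σ_AB ε_A'B'` with `σ_AB = σ_BA`; as `Z` is real, this encodes a smooth
real symmetric unprimed spinor field `σ_AB`. -/
structure IsSymSpinor (o : ∀ x : M, Orientation ℝ (TangentSpace 𝓘(ℝ, E4) x) (Fin 4))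
    (Z : Tensor2 M) : Prop where
  smooth : SmoothT Z
  symm : ∀ (x : M) (e : OFrame o x) (A B : Fin 2), e.sigma Z A B = e.sigma Z B A
  form : ∀ (x : M) (e : OFrame o x) (A A' B B' : Fin 2),
    spin2 (e.comp2 (fun u v ↦ Z x u v)) A A' B B' = e.sigma Z A B * eps A' B'

/-- The Killing spinor equation `∇_AA' σ_BC = 2 ε_A(B ξ_C)A'`. -/
def IsKillingSpinor (nab : Connection M)
    (o : ∀ x : M, Orientation ℝ (TangentSpace 𝓘(ℝ, E4) x) (Fin 4))
    (Z : Tensor2 M) (ξ : VField M) : Prop :=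
  ∀ (x : M) (e : OFrame o x) (A A' B C : Fin 2),
    e.nablaSigma nab Z A A' B C = eps A B * e.vec ξ C A' + eps A C * e.vec ξ B A'

/-- `Ω` is a nowhere-vanishing smooth function with `Ω⁻² = ½ σ_AB σ^AB`. -/
structure IsConformalFactor (o : ∀ x : M, Orientation ℝ (TangentSpace 𝓘(ℝ, E4) x) (Fin 4))
    (Z : Tensor2 M) (Ω : M → ℝ) : Prop where
  smooth : ContMDiff 𝓘(ℝ, E4) 𝓘(ℝ, ℝ) ∞ Ω
  ne_zero : ∀ x, Ω x ≠ 0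
  eq : ∀ (x : M) (e : OFrame o x),
    (((Ω x)⁻¹ ^ 2 : ℝ) : ℂ)
      = (1 / 2) * ∑ A, ∑ B, e.sigma Z A B * raise2 (e.sigma Z) A B

/-- The Ernst potential `E₊ = Ω + ξ_a ξ^a`. -/
def ernstPlus (Ω : M → ℝ) (ξ : VField M) (x : M) : ℝ := Ω x + inner ℝ (ξ x) (ξ x)

/-- `∇_(a V_b) = 0`. -/
def IsKillingVector (nab : Connection M) (V : VField M) : Prop :=
  ∀ (x : M) (u v : TangentSpace 𝓘(ℝ, E4) x), covV nab V x u v + covV nab V x v u = 0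

/-- A symmetric tensor with `∇_(a H_bc) = 0`. -/
structure IsKillingTensor (nab : Connection M) (H : Tensor2 M) : Prop where
  smooth : SmoothT H
  symm : ∀ (x : M) (u v : TangentSpace 𝓘(ℝ, E4) x), H x u v = H x v u
  killing : ∀ (x : M) (u v w : TangentSpace 𝓘(ℝ, E4) x),
    covT nab H x u v w + covT nab H x v w u + covT nab H x w u v = 0

end Geometry

end HKSpinor

end

/-! In an oriented orthonormal frame the real 2-forms split into two commuting copies of the
imaginary quaternions, `asdForm` and `sdForm`. The spinor σ becomes a vector z = (a, b, c) of
anti-self-dual components, and χ becomes a vector (α, β, γ) of self-dual ones. Half-flatness reduces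
the curvature to a symmetric traceless 3×3 matrix W acting on anti-self-dual forms
(`riem_eq_weylForm`).

The Killing spinor equation says that ∇_k σ is minus twice the anti-self-dual part of e_k ∧ ξ
(`ksForm`). Its integrability condition (`killing_spinor_ricci`, `ricci_algebra`) says three things:
ξ is Killing, W commutes with the infinitesimal rotation about z, and the anti-self-dual part of ∇ξ
is Wz/2. Hence Wz = 2h z and ∇ξ = hσ + χ. The Killing identity ∇∇ξ = R·ξ then gives the derivative
of ⟨∇ξ, σ⟩ = 4h|z|². Comparison with dΩ = Ω³ σ(·, ξ) shows that ⟨∇ξ, σ⟩/Ω is constant, and the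
normalisation at one point fixes h = -Ω³/2 everywhere (`FrameData.anti_self_dual_part`).

With this value of h the tensor -σ(u, ∇_v ξ) - (Ω + ½|ξ|²)⟨u, v⟩ is σ_AB χ_A'B' - ½ E₊ g_ab. In its
covariant derivative all terms containing h cancel; what is left, `killingForm`, is bilinear in ξ
and χ and has zero cyclic sum. For t = H(·, ξ) one has ∇t = (∇H)(·, ξ) + H·∇ξ. The self-dual parts
of the two terms are ½|ξ|²χ and -½|ξ|²χ, so ∇t is an anti-self-dual 2-form: t is Killing and ∇_AA'
t^A_B' = 0. The bracket [t, ξ] vanishes because (∇_ξ H)(·, ξ) = 0 and H·∇ξ is antisymmetric. -/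

noncomputable section

namespace HKSpinor

open Filter Topology VectorField

set_option linter.unusedSectionVars false

/-! ### The Lie bracket as a commutator of derivations -/

section Calculus

variable {M : Type*} [TopologicalSpace M] [ChartedSpace E4 M] [IsManifold 𝓘(ℝ, E4) ∞ M]

/-- The pullback applies the inverse of the derivative of the inverse chart, and the chain rule
undoes it. -/
theorem fderiv_comp_extChartAt_symm_mpullbackWithin {f : M → ℝ} {x : M} {z : E4}
    (hz : z ∈ (extChartAt 𝓘(ℝ, E4) x).target)
    (hf : MDifferentiableAt 𝓘(ℝ, E4) 𝓘(ℝ, ℝ) f ((extChartAt 𝓘(ℝ, E4) x).symm z))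
    (V : VField M) :
    fderiv ℝ (f ∘ (extChartAt 𝓘(ℝ, E4) x).symm) z
        (mpullbackWithin 𝓘(ℝ, E4) 𝓘(ℝ, E4) (extChartAt 𝓘(ℝ, E4) x).symm V
          (Set.range 𝓘(ℝ, E4)) z)
      = mvfderiv 𝓘(ℝ, E4) f ((extChartAt 𝓘(ℝ, E4) x).symm z)
        (V ((extChartAt 𝓘(ℝ, E4) x).symm z)) := by
  set φ := extChartAt 𝓘(ℝ, E4) x with hφ
  have hs := mdifferentiableWithinAt_extChartAt_symm (I := 𝓘(ℝ, E4)) hz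
  have hinv := isInvertible_mfderivWithin_extChartAt_symm (I := 𝓘(ℝ, E4)) hz
  rw [modelWithCornersSelf_coe, Set.range_id] at *
  rw [mdifferentiableWithinAt_univ] at hs
  have hi : ∀ w, (mfderivWithin 𝓘(ℝ, E4) 𝓘(ℝ, E4) φ.symm Set.univ z)
      ((mfderivWithin 𝓘(ℝ, E4) 𝓘(ℝ, E4) φ.symm Set.univ z).inverse w) = w := by
    intro w
    obtain ⟨L, hL⟩ := hinv
    rw [← hL, ContinuousLinearMap.inverse_equiv]
    exact L.apply_symm_apply w
  rw [← mfderiv_eq_fderiv, mfderiv_comp z hf hs]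
  have := hi (V (φ.symm z))
  rw [mfderivWithin_univ] at this
  rw [mpullbackWithin_univ]
  exact congrArg (mfderiv 𝓘(ℝ, E4) 𝓘(ℝ, ℝ) f (φ.symm z)) this

/-- In the chart, X(Yf) is D²F(X, Y) + DF(DY·X). The symmetry of D²F leaves only DF applied to the
coordinate bracket DY·X - DX·Y. -/
theorem mvfderiv_mlieBracket {f : M → ℝ} {X Y : VField M} {x : M}
    (hf : ContMDiffAt 𝓘(ℝ, E4) 𝓘(ℝ, ℝ) ∞ f x) (hX : SmoothVAt X x) (hY : SmoothVAt Y x) :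
    mvfderiv 𝓘(ℝ, E4) f x (mlieBracket 𝓘(ℝ, E4) X Y x)
      = mvfderiv 𝓘(ℝ, E4) (fun y ↦ mvfderiv 𝓘(ℝ, E4) f y (Y y)) x (X x)
        - mvfderiv 𝓘(ℝ, E4) (fun y ↦ mvfderiv 𝓘(ℝ, E4) f y (X y)) x (Y x) := by
  set φ := extChartAt 𝓘(ℝ, E4) x with hφ
  set F : E4 → ℝ := f ∘ φ.symm with hF
  have hxs : x ∈ φ.source := mem_extChartAt_source x
  have hzt : φ x ∈ φ.target := mem_extChartAt_target x
  have hxx : φ.symm (φ x) = x := φ.left_inv hxs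
  have hf2 : ContMDiffAt 𝓘(ℝ, E4) 𝓘(ℝ, ℝ) 2 f x := hf.of_le (by norm_cast)
  have hfd : ∀ᶠ y in 𝓝 x, MDifferentiableAt 𝓘(ℝ, E4) 𝓘(ℝ, ℝ) f y := by
    obtain ⟨u, hu, hfu⟩ := (contMDiffAt_iff_contMDiffOn_nhds (by simp)).1 hf2
    obtain ⟨w, hwu, hwo, hxw⟩ := mem_nhds_iff.1 hu
    filter_upwards [hwo.mem_nhds hxw] with y hy
    exact ((hfu.mono hwu).contMDiffAt (hwo.mem_nhds hy)).mdifferentiableAt (by simp)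
  have hF2 : ContDiffAt ℝ 2 F (φ x) := by
    have h := (contMDiffAt_iff.1 hf2).2
    rw [modelWithCornersSelf_coe, Set.range_id, contDiffWithinAt_univ] at h
    exact h
  let P : VField M → E4 → E4 := fun V z ↦
    mpullbackWithin 𝓘(ℝ, E4) 𝓘(ℝ, E4) φ.symm V (Set.range 𝓘(ℝ, E4)) z
  -- The chart at `x` has identity derivative at `x` itself, so at the base point the pulled-back
  -- field and the field agree literally.
  have hPx : ∀ V : VField M, P V (φ x) = V x := by
    intro V
    have h := mfderivWithin_extChartAt_symm_inverse_apply (I := 𝓘(ℝ, E4)) (x := x)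
    have h2 := h (V (φ.symm (φ x)))
    refine Eq.trans h2 ?_
    rw [hxx]
  have hPd : ∀ V : VField M, SmoothVAt V x → DifferentiableAt ℝ (P V) (φ x) := by
    intro V hV
    have h := MDifferentiableWithinAt.differentiableWithinAt_mpullbackWithin_vectorField
      (I := 𝓘(ℝ, E4)) (V := V) (s := Set.univ) (x := x)
      (ContMDiffAt.mdifferentiableAt hV (by simp)).mdifferentiableWithinAt
    have h' : DifferentiableWithinAt ℝ (P V)
        (φ.symm ⁻¹' Set.univ ∩ Set.range 𝓘(ℝ, E4)) (φ x) := h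
    rwa [Set.preimage_univ, Set.univ_inter, modelWithCornersSelf_coe, Set.range_id,
      differentiableWithinAt_univ] at h'
  have key : ∀ V W : VField M, SmoothVAt V x →
      mvfderiv 𝓘(ℝ, E4) (fun y ↦ mvfderiv 𝓘(ℝ, E4) f y (V y)) x (W x)
        = fderiv ℝ (fderiv ℝ F) (φ x) (W x) (V x)
          + fderiv ℝ F (φ x) (fderiv ℝ (P V) (φ x) (W x)) := by
    intro V W hV
    have hev : (fun y ↦ mvfderiv 𝓘(ℝ, E4) f y (V y))
        =ᶠ[𝓝 x] (fun z ↦ fderiv ℝ F z (P V z)) ∘ φ := by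
      filter_upwards [hfd, extChartAt_source_mem_nhds (I := 𝓘(ℝ, E4)) x] with y hy hys
      have hzy : φ y ∈ φ.target := φ.map_source hys
      have := fderiv_comp_extChartAt_symm_mpullbackWithin (f := f) hzy
        (by rw [φ.left_inv hys]; exact hy) V
      rw [← hφ, φ.left_inv hys] at this
      exact this.symm
    have hdF : DifferentiableAt ℝ (fderiv ℝ F) (φ x) :=
      (hF2.fderiv_right (m := 1) (by norm_num)).differentiableAt (by simp)
    have hG := hdF.hasFDerivAt.clm_apply (hPd V hV).hasFDerivAt
    have hGm : MDifferentiableAt 𝓘(ℝ, E4) 𝓘(ℝ, ℝ) (fun z ↦ fderiv ℝ F z (P V z)) (φ x) :=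
      hG.differentiableAt.mdifferentiableAt
    have hφm : MDifferentiableAt 𝓘(ℝ, E4) 𝓘(ℝ, E4) φ x :=
      mdifferentiableAt_extChartAt (mem_chart_source _ x)
    have : mvfderiv 𝓘(ℝ, E4) (fun y ↦ mvfderiv 𝓘(ℝ, E4) f y (V y)) x (W x)
        = fderiv ℝ (fun z ↦ fderiv ℝ F z (P V z)) (φ x) (W x) := by
      have h1 : mfderiv 𝓘(ℝ, E4) 𝓘(ℝ, ℝ) (fun y ↦ mvfderiv 𝓘(ℝ, E4) f y (V y)) x (W x)
          = mfderiv 𝓘(ℝ, E4) 𝓘(ℝ, ℝ) ((fun z ↦ fderiv ℝ F z (P V z)) ∘ φ) x (W x) := by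
        rw [hev.mfderiv_eq]
        rfl
      have h2 := congrArg (fun A ↦ A (W x)) (mfderiv_comp x hGm hφm)
      have h3 : mfderiv 𝓘(ℝ, E4) 𝓘(ℝ, E4) φ x (W x) = W x := by
        rw [mfderiv_extChartAt_self]
        rfl
      refine h1.trans (h2.trans ?_)
      refine Eq.trans (b := mfderiv 𝓘(ℝ, E4) 𝓘(ℝ, ℝ) (fun z ↦ fderiv ℝ F z (P V z)) (φ x) (W x))
        (congrArg (mfderiv 𝓘(ℝ, E4) 𝓘(ℝ, ℝ) (fun z ↦ fderiv ℝ F z (P V z)) (φ x)) h3) ?_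
      rw [mfderiv_eq_fderiv]
      rfl
    rw [this, hG.fderiv, hPx, add_comm]
    rfl
  have hbr : mvfderiv 𝓘(ℝ, E4) f x (mlieBracket 𝓘(ℝ, E4) X Y x)
      = fderiv ℝ F (φ x) (fderiv ℝ (P Y) (φ x) (X x) - fderiv ℝ (P X) (φ x) (Y x)) := by
    have h1 : mlieBracket 𝓘(ℝ, E4) X Y x
        = fderiv ℝ (P Y) (φ x) (X x) - fderiv ℝ (P X) (φ x) (Y x) := by
      rw [← mlieBracketWithin_univ, mlieBracketWithin_apply]
      have h2 : lieBracketWithin ℝ (P X) (P Y) (φ.symm ⁻¹' Set.univ ∩ Set.range 𝓘(ℝ, E4)) (φ x)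
          = fderiv ℝ (P Y) (φ x) (X x) - fderiv ℝ (P X) (φ x) (Y x) := by
        rw [Set.preimage_univ, Set.univ_inter, modelWithCornersSelf_coe, Set.range_id,
          lieBracketWithin_univ, lieBracket, hPx, hPx]
      have h3 : ∀ w : TangentSpace 𝓘(ℝ, E4) (φ x),
          (mfderiv 𝓘(ℝ, E4) 𝓘(ℝ, E4) φ x).inverse w = w := by
        intro w
        rw [mfderiv_extChartAt_self]
        change (ContinuousLinearMap.id ℝ E4).inverse w = w
        rw [ContinuousLinearMap.inverse_id]
        rfl
      exact (h3 _).trans h2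
    have h4 := fderiv_comp_extChartAt_symm_mpullbackWithin (f := f) hzt
      (by rw [hxx]; exact hfd.self_of_nhds) (mlieBracket 𝓘(ℝ, E4) X Y)
    have h5 := hPx (mlieBracket 𝓘(ℝ, E4) X Y)
    simp only [P] at h5
    have h6 : fderiv ℝ F (φ x) (mlieBracket 𝓘(ℝ, E4) X Y x)
        = mvfderiv 𝓘(ℝ, E4) f x (mlieBracket 𝓘(ℝ, E4) X Y x) := by
      have h7 : ∀ y, y = x → mvfderiv 𝓘(ℝ, E4) f y (mlieBracket 𝓘(ℝ, E4) X Y y)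
          = mvfderiv 𝓘(ℝ, E4) f x (mlieBracket 𝓘(ℝ, E4) X Y x) := by
        rintro y rfl
        rfl
      exact (congrArg (fderiv ℝ F (φ x)) h5).symm.trans (h4.trans (h7 _ hxx))
    rw [← h6]
    exact congrArg (fderiv ℝ F (φ x)) h1
  rw [hbr, key Y X hY, key X Y hX, map_sub]
  have hsymm : IsSymmSndFDerivAt ℝ F (φ x) := hF2.isSymmSndFDerivAt (by simp)
  have := hsymm.eq (X x) (Y x)
  linarith

end Calculus

/-! ### Smooth fields and tensoriality over smooth functions -/

section Calculus

variable {M : Type*} [TopologicalSpace M] [ChartedSpace E4 M] [IsManifold 𝓘(ℝ, E4) ∞ M]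

/-- Smoothness of a real function at a point. -/
abbrev SmoothFAt (f : M → ℝ) (x : M) : Prop := ContMDiffAt 𝓘(ℝ, E4) 𝓘(ℝ, ℝ) ∞ f x

theorem SmoothFAt.mdiff {f : M → ℝ} {x : M} (hf : SmoothFAt f x) :
    MDifferentiableAt 𝓘(ℝ, E4) 𝓘(ℝ, ℝ) f x :=
  ContMDiffAt.mdifferentiableAt hf (by simp)

theorem SmoothVAt.mdiff {X : VField M} {x : M} (hX : SmoothVAt X x) :
    MDifferentiableAt 𝓘(ℝ, E4) (𝓘(ℝ, E4).prod 𝓘(ℝ, E4))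
      (fun y ↦ (TotalSpace.mk' E4 y (X y) : TangentBundle 𝓘(ℝ, E4) M)) x :=
  ContMDiffAt.mdifferentiableAt hX (by simp)

theorem SmoothVAt.add {X Y : VField M} {x : M} (hX : SmoothVAt X x) (hY : SmoothVAt Y x) :
    SmoothVAt (X + Y) x :=
  ContMDiffAt.add_section hX hY

theorem SmoothVAt.sub {X Y : VField M} {x : M} (hX : SmoothVAt X x) (hY : SmoothVAt Y x) :
    SmoothVAt (X - Y) x :=
  ContMDiffAt.sub_section hX hY

theorem SmoothVAt.smul {f : M → ℝ} {X : VField M} {x : M} (hf : SmoothFAt f x)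
    (hX : SmoothVAt X x) : SmoothVAt (f • X) x :=
  ContMDiffAt.smul_section hf hX

theorem SmoothVAt.sum {ι : Type*} {s : Finset ι} {X : ι → VField M} {x : M}
    (hX : ∀ i ∈ s, SmoothVAt (X i) x) : SmoothVAt (fun y ↦ ∑ i ∈ s, X i y) x :=
  ContMDiffAt.sum_section hX

theorem SmoothVAt.congr {X Y : VField M} {x : M} (hX : SmoothVAt X x)
    (h : ∀ᶠ y in 𝓝 x, Y y = X y) : SmoothVAt Y x :=
  ContMDiffAt.congr_of_eventuallyEq hX (h.mono fun y hy ↦ by simp only [hy])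

theorem eventually_smoothVAt_ext {x : M} (v : TangentSpace 𝓘(ℝ, E4) x) :
    ∀ᶠ y in 𝓝 x, SmoothVAt (ext v) y := by
  obtain ⟨s, hs, h⟩ := FiberBundle.exists_contMDiffOn_extend (k := ∞) 𝓘(ℝ, E4) E4 v
  obtain ⟨w, hws, hwo, hxw⟩ := mem_nhds_iff.1 hs
  filter_upwards [hwo.mem_nhds hxw] with y hy
  exact (h.mono hws).contMDiffAt (hwo.mem_nhds hy)

theorem smoothVAt_ext {x : M} (v : TangentSpace 𝓘(ℝ, E4) x) : SmoothVAt (ext v) x :=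
  (eventually_smoothVAt_ext v).self_of_nhds

@[simp]
theorem ext_self {x : M} (v : TangentSpace 𝓘(ℝ, E4) x) : ext v x = v := by
  simp [ext]

theorem SmoothFAt.mvfderiv_apply {f : M → ℝ} {X : VField M} {x : M} (hf : SmoothFAt f x)
    (hX : SmoothVAt X x) : SmoothFAt (fun y ↦ mvfderiv 𝓘(ℝ, E4) f y (X y)) x := by
  have h1 := ContMDiffAt.mfderiv_const (m := ∞) hf (by simp)
  have h2 := ContMDiffAt.clm_apply_of_inCoordinates (IM := 𝓘(ℝ, E4)) (b₁ := id) (b₂ := f)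
    (F₁ := E4) (F₂ := ℝ)
    (E₁ := fun x : M ↦ TangentSpace 𝓘(ℝ, E4) x) (E₂ := fun x : ℝ ↦ TangentSpace 𝓘(ℝ, ℝ) x)
    (ϕ := fun y ↦ mfderiv 𝓘(ℝ, E4) 𝓘(ℝ, ℝ) f y) h1 hX hf
  exact (contMDiff_snd_tangentBundle_modelSpace ℝ 𝓘(ℝ, ℝ)).contMDiffAt.comp x h2

/-- A map from vector fields that is linear over smooth functions near `x` depends only on the
value at `x`. -/
structure SmoothTensorialAt {A : Type*} [AddCommGroup A] [Module ℝ A] (Φ : VField M → A)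
    (x : M) : Prop where
  smul : ∀ {f : M → ℝ} {X : VField M}, SmoothFAt f x → SmoothVAt X x → Φ (f • X) = f x • Φ X
  add : ∀ {X Y : VField M}, SmoothVAt X x → SmoothVAt Y x → Φ (X + Y) = Φ X + Φ Y

namespace SmoothTensorialAt

variable {A : Type*} [AddCommGroup A] [Module ℝ A] {Φ : VField M → A} {x : M}

/-- No bump function is needed: the indicator of the set where the fields agree equals 1 near `x`,
hence is smooth at `x`, and it makes the two fields equal everywhere after multiplication. -/
theorem congr_nhds (hΦ : SmoothTensorialAt Φ x) {X Y : VField M} (hX : SmoothVAt X x)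
    (hY : SmoothVAt Y x) (h : ∀ᶠ y in 𝓝 x, X y = Y y) : Φ X = Φ Y := by
  classical
  let ψ (y : M) : ℝ := if X y = Y y then 1 else 0
  have hψx : ψ x = 1 := by simp [ψ, h.self_of_nhds]
  have e : ψ • X = ψ • Y := by
    funext y
    by_cases hy : X y = Y y <;> simp [ψ, hy]
  have hψ : SmoothFAt ψ x := by
    have : SmoothFAt (fun _ : M ↦ (1 : ℝ)) x := contMDiffAt_const
    exact this.congr_of_eventuallyEq (h.mono fun y hy ↦ by simp [ψ, hy])
  have h1 := hΦ.smul hψ hX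
  have h2 := hΦ.smul hψ hY
  rw [hψx, one_smul] at h1 h2
  rw [← h1, ← h2, e]

theorem zero (hΦ : SmoothTensorialAt Φ x) : Φ 0 = 0 := by
  have h0 : SmoothVAt (0 : VField M) x := contMDiffAt_zeroSection ℝ _
  have h := hΦ.smul (f := 0) (X := 0) contMDiffAt_const h0
  simpa using h

theorem sum (hΦ : SmoothTensorialAt Φ x) {ι : Type*} {s : Finset ι} {X : ι → VField M}
    (hX : ∀ i ∈ s, SmoothVAt (X i) x) : Φ (fun y ↦ ∑ i ∈ s, X i y) = ∑ i ∈ s, Φ (X i) := by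
  classical
  induction s using Finset.induction_on with
  | empty =>
    simp only [Finset.sum_empty]
    exact hΦ.zero
  | insert a s ha ih =>
    simp only [Finset.mem_insert, forall_eq_or_imp] at hX
    simp only [Finset.sum_insert ha, ← ih hX.2]
    exact hΦ.add hX.1 (SmoothVAt.sum hX.2)

/-- Near `x` a smooth field is a combination of a local frame with smooth coefficients, so its image
is determined by the coefficients at `x`. -/
theorem pointwise (hΦ : SmoothTensorialAt Φ x) {X Y : VField M} (hX : SmoothVAt X x)
    (hY : SmoothVAt Y x) (h : X x = Y x) : Φ X = Φ Y := by
  let t := trivializationAt E4 (fun x : M ↦ TangentSpace 𝓘(ℝ, E4) x) x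
  have x_mem : x ∈ t.baseSet := FiberBundle.mem_baseSet_trivializationAt' x
  let b := Module.Basis.ofVectorSpace ℝ E4
  let s := t.localFrame b
  let c := t.localFrameCoeff 𝓘(ℝ, E4) b
  have hs (i) : SmoothVAt (s i) x := contMDiffAt_localFrame_of_mem ∞ _ b i x_mem
  have hc {Z : VField M} (hZ : SmoothVAt Z x) (i) : SmoothFAt (LinearMap.piApply (c i) Z) x :=
    contMDiffAt_localFrameCoeff b x_mem hZ i
  have hex {Z : VField M} (hZ : SmoothVAt Z x) : Φ Z = ∑ i, c i x (Z x) • Φ (s i) := by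
    have h1 : Φ Z = Φ (fun y ↦ ∑ i, (LinearMap.piApply (c i) Z • s i) y) :=
      hΦ.congr_nhds hZ (SmoothVAt.sum fun i _ ↦ (SmoothVAt.smul (hc hZ i) (hs i)))
        (t.eventually_eq_localFrame_sum_coeff_smul b x_mem)
    rw [h1, hΦ.sum fun i _ ↦ (SmoothVAt.smul (hc hZ i) (hs i))]
    exact Finset.sum_congr rfl fun i _ ↦ hΦ.smul (hc hZ i) (hs i)
  rw [hex hX, hex hY, h]

end SmoothTensorialAt

end Calculus

/-! ### Smooth oriented orthonormal frames -/

section Frames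

variable {M : Type*} [TopologicalSpace M] [ChartedSpace E4 M] [IsManifold 𝓘(ℝ, E4) ∞ M]
  [RiemannianBundle (fun x : M ↦ TangentSpace 𝓘(ℝ, E4) x)]
  [IsContMDiffRiemannianBundle 𝓘(ℝ, E4) ∞ E4 (fun x : M ↦ TangentSpace 𝓘(ℝ, E4) x)]

theorem SmoothVAt.inner {X Y : VField M} {x : M} (hX : SmoothVAt X x) (hY : SmoothVAt Y x) :
    SmoothFAt (fun y ↦ inner ℝ (X y) (Y y)) x :=
  ContMDiffAt.inner_bundle hX hY

open InnerProductSpace in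
-- Induction on the index: each projection divides by the squared norm of an earlier Gram-Schmidt
-- vector, which is nonzero at `x` by linear independence.
theorem smoothVAt_gramSchmidt {B : Fin 4 → VField M} {x : M} (hB : ∀ i, SmoothVAt (B i) x)
    (hli : LinearIndependent ℝ (fun i ↦ B i x)) (n : Fin 4) :
    SmoothVAt (fun y ↦ gramSchmidt ℝ (fun i ↦ B i y) n) x := by
  induction n using WellFoundedLT.induction with
  | ind n ih =>
    have e : (fun y ↦ gramSchmidt ℝ (fun i ↦ B i y) n)
        = B n - fun y ↦ ∑ i ∈ Finset.Iio n,
          ((fun y ↦ inner ℝ (gramSchmidt ℝ (fun i ↦ B i y) i) (B n y)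
            * (inner ℝ (gramSchmidt ℝ (fun i ↦ B i y) i)
              (gramSchmidt ℝ (fun i ↦ B i y) i))⁻¹) •
            (fun y ↦ gramSchmidt ℝ (fun i ↦ B i y) i) : VField M) y := by
      funext y
      have h := gramSchmidt_def'' ℝ (fun i ↦ B i y) n
      rw [Pi.sub_apply, eq_sub_iff_add_eq]
      refine Eq.trans ?_ h.symm
      congr 1
      refine Finset.sum_congr rfl fun i _ ↦ ?_
      simp [div_eq_mul_inv]
    rw [e]
    refine (hB n).sub (SmoothVAt.sum fun i hi ↦ ?_)
    have hi' := ih i (Finset.mem_Iio.1 hi)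
    refine SmoothVAt.smul ?_ hi'
    refine ContMDiffAt.mul (hi'.inner (hB n)) ?_
    refine ContMDiffAt.inv₀ (hi'.inner hi') ?_
    exact inner_self_ne_zero.2 (gramSchmidt_ne_zero _ hli)

open InnerProductSpace in
theorem smoothVAt_gramSchmidtNormed {B : Fin 4 → VField M} {x : M}
    (hB : ∀ i, SmoothVAt (B i) x) (hli : LinearIndependent ℝ (fun i ↦ B i x)) (n : Fin 4) :
    SmoothVAt (fun y ↦ gramSchmidtNormed ℝ (fun i ↦ B i y) n) x := by
  have h := smoothVAt_gramSchmidt hB hli n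
  have e : (fun y ↦ gramSchmidtNormed ℝ (fun i ↦ B i y) n)
      = ((fun y ↦ (√(inner ℝ (gramSchmidt ℝ (fun i ↦ B i y) n)
          (gramSchmidt ℝ (fun i ↦ B i y) n)))⁻¹) •
          (fun y ↦ gramSchmidt ℝ (fun i ↦ B i y) n) : VField M) := by
    funext y
    simp only [gramSchmidtNormed, Pi.smul_apply']
    rw [norm_eq_sqrt_real_inner]
    rfl
  rw [e]
  have hne : inner ℝ (gramSchmidt ℝ (fun i ↦ B i x) n) (gramSchmidt ℝ (fun i ↦ B i x) n) ≠ 0 :=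
    inner_self_ne_zero.2 (gramSchmidt_ne_zero _ hli)
  refine SmoothVAt.smul ?_ h
  refine ContMDiffAt.inv₀ ?_ ?_
  · exact (Real.contDiffAt_sqrt hne).contMDiffAt.comp x (h.inner h)
  · exact Real.sqrt_ne_zero'.2 (lt_of_le_of_ne real_inner_self_nonneg hne.symm)

variable {o : ∀ x : M, Orientation ℝ (TangentSpace 𝓘(ℝ, E4) x) (Fin 4)}

theorem OFrame.volumeForm_basis {x : M} (e : OFrame o x) :
    (o x).volumeForm e.basis = 1 := by
  rw [(o x).volumeForm_robust e.basis e.oriented]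
  exact e.basis.toBasis.det_self

theorem exists_oFrame_of_orthonormal {x : M} {v : Fin 4 → TangentSpace 𝓘(ℝ, E4) x}
    (hv : Orthonormal ℝ v) (hpos : 0 < (o x).volumeForm v) :
    ∃ e : OFrame o x, ∀ i, e.basis i = v i := by
  have hcard : Fintype.card (Fin 4) = Module.finrank ℝ (TangentSpace 𝓘(ℝ, E4) x) := by
    rw [(instFactFinrank x).out]
    simp
  let b := basisOfOrthonormalOfCardEqFinrank hv hcard
  have hb : (b : Fin 4 → _) = v := coe_basisOfOrthonormalOfCardEqFinrank hv hcard
  let b' : OrthonormalBasis (Fin 4) ℝ (TangentSpace 𝓘(ℝ, E4) x) :=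
    b.toOrthonormalBasis (by rw [hb]; exact hv)
  have hb' : (b' : Fin 4 → _) = v := by
    rw [Module.Basis.coe_toOrthonormalBasis, hb]
  refine ⟨⟨b', ?_⟩, fun i ↦ congrFun hb' i⟩
  by_contra hne
  have h := (o x).volumeForm_robust_neg b' hne
  have h1 : (b'.toBasis.det : (Fin 4 → TangentSpace 𝓘(ℝ, E4) x) → ℝ) v = 1 := by
    rw [← hb', ← b'.coe_toBasis]
    exact b'.toBasis.det_self
  rw [h] at hpos
  simp only [AlternatingMap.neg_apply, h1] at hpos
  linarith

open InnerProductSpace in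
-- Gram-Schmidt is applied to extensions of the given basis. Continuity of the volume form is used
-- twice: nonvanishing keeps the extensions independent near `x`, and positivity keeps the
-- orthonormalised frame oriented. At `x` the extensions are already orthonormal, so nothing changes
-- there.
theorem exists_smooth_oFrame (ho : IsOrientation o) {x : M} (e : OFrame o x) :
    ∃ E : Fin 4 → VField M, (∀ i, E i x = e.basis i) ∧
      ∀ᶠ y in 𝓝 x, (∀ i, SmoothVAt (E i) y) ∧ ∃ e' : OFrame o y, ∀ i, e'.basis i = E i y := by
  let B : Fin 4 → VField M := fun i ↦ ext (e.basis i)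
  have hBx : (fun i ↦ B i x) = e.basis := by
    funext i
    simp [B]
  have hBs : ∀ᶠ y in 𝓝 x, ∀ i, SmoothVAt (B i) y :=
    eventually_all.2 fun i ↦ eventually_smoothVAt_ext _
  have hvB : ∀ᶠ y in 𝓝 x, (o y).volumeForm (fun i ↦ B i y) ≠ 0 := by
    refine (ho x B hBs.self_of_nhds).eventually_ne ?_
    rw [hBx, e.volumeForm_basis]
    exact one_ne_zero
  have hli : ∀ᶠ y in 𝓝 x, LinearIndependent ℝ (fun i ↦ B i y) := by
    filter_upwards [hvB] with y hy
    by_contra h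
    exact hy ((o y).volumeForm.map_linearDependent _ h)
  let E : Fin 4 → VField M := fun i y ↦ gramSchmidtNormed ℝ (fun i ↦ B i y) i
  have hEs : ∀ᶠ y in 𝓝 x, ∀ i, SmoothVAt (E i) y := by
    filter_upwards [hBs, hli] with y hy hy' i
    exact smoothVAt_gramSchmidtNormed hy hy' i
  have hEx : ∀ i, E i x = e.basis i := by
    intro i
    have h1 : gramSchmidt ℝ (fun i ↦ B i x) = fun i ↦ B i x := by
      refine gramSchmidt_of_orthogonal ℝ ?_
      intro i j hij
      change inner ℝ (B i x) (B j x) = 0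
      rw [show B i x = e.basis i from congrFun hBx i, show B j x = e.basis j from congrFun hBx j]
      exact e.basis.orthonormal.2 hij
    simp only [E, gramSchmidtNormed, h1]
    simp [B]
  have hvE : ∀ᶠ y in 𝓝 x, 0 < (o y).volumeForm (fun i ↦ E i y) := by
    refine (ho x E hEs.self_of_nhds).eventually (lt_mem_nhds ?_)
    change 0 < (o x).volumeForm (fun i ↦ E i x)
    have : (fun i ↦ E i x) = e.basis := funext hEx
    rw [this, e.volumeForm_basis]
    exact one_pos
  refine ⟨E, hEx, ?_⟩
  filter_upwards [hEs, hvE, hli] with y h1 h2 h3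
  exact ⟨h1, exists_oFrame_of_orthonormal (gramSchmidtNormed_orthonormal h3) h2⟩

theorem exists_oFrame (o : ∀ x : M, Orientation ℝ (TangentSpace 𝓘(ℝ, E4) x) (Fin 4)) (x : M) :
    Nonempty (OFrame o x) :=
  ⟨⟨(o x).finOrthonormalBasis (by norm_num) (instFactFinrank x).out,
    (o x).finOrthonormalBasis_orientation _ _⟩⟩

end Frames

/-! ### Derivatives of functions and covariant derivatives of 2-tensors -/

section Derivations

variable {M : Type*} [TopologicalSpace M] [ChartedSpace E4 M] [IsManifold 𝓘(ℝ, E4) ∞ M]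

/-- The derivative of a function along a tangent vector. -/
abbrev der (f : M → ℝ) (x : M) (u : TangentSpace 𝓘(ℝ, E4) x) : ℝ := mvfderiv 𝓘(ℝ, E4) f x u

variable {f g : M → ℝ} {x : M} (u : TangentSpace 𝓘(ℝ, E4) x)

theorem der_congr (h : ∀ᶠ y in 𝓝 x, f y = g y) : der f x u = der g x u := by
  have h0 : f x = g x := h.self_of_nhds
  have h1 : mfderiv 𝓘(ℝ, E4) 𝓘(ℝ, ℝ) f x = mfderiv 𝓘(ℝ, E4) 𝓘(ℝ, ℝ) g x :=
    Filter.EventuallyEq.mfderiv_eq h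
  exact congrArg (fun A : E4 →L[ℝ] ℝ ↦ A u) h1

theorem der_add (hf : SmoothFAt f x) (hg : SmoothFAt g x) :
    der (fun y ↦ f y + g y) x u = der f x u + der g x u := by
  rw [der, mvfderiv_fun_add hf.mdiff hg.mdiff]
  rfl

theorem der_sub (hf : SmoothFAt f x) (hg : SmoothFAt g x) :
    der (fun y ↦ f y - g y) x u = der f x u - der g x u := by
  rw [der, mvfderiv_fun_sub hf.mdiff hg.mdiff]
  rfl

theorem der_mul (hf : SmoothFAt f x) (hg : SmoothFAt g x) :
    der (fun y ↦ f y * g y) x u = der f x u * g x + f x * der g x u := by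
  rw [der, mvfderiv_fun_mul hf.mdiff hg.mdiff]
  simp only [add_apply, smul_apply, smul_eq_mul]
  ring

theorem der_const (c : ℝ) : der (fun _ : M ↦ c) x u = 0 := by
  rw [der, mvfderiv_const]
  rfl

theorem der_const_mul (c : ℝ) (hf : SmoothFAt f x) :
    der (fun y ↦ c * f y) x u = c * der f x u := by
  rw [der_mul u contMDiffAt_const hf, der_const]
  ring

theorem SmoothFAt.add (hf : SmoothFAt f x) (hg : SmoothFAt g x) :
    SmoothFAt (fun y ↦ f y + g y) x := ContMDiffAt.add hf hg

theorem SmoothFAt.sub (hf : SmoothFAt f x) (hg : SmoothFAt g x) :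
    SmoothFAt (fun y ↦ f y - g y) x := ContMDiffAt.sub hf hg

theorem SmoothFAt.mul (hf : SmoothFAt f x) (hg : SmoothFAt g x) :
    SmoothFAt (fun y ↦ f y * g y) x := ContMDiffAt.mul hf hg

theorem SmoothFAt.congr (hf : SmoothFAt f x) (h : ∀ᶠ y in 𝓝 x, g y = f y) : SmoothFAt g x :=
  ContMDiffAt.congr_of_eventuallyEq hf h

theorem SmoothFAt.sum {ι : Type*} {s : Finset ι} {F : ι → M → ℝ}
    (hF : ∀ i ∈ s, SmoothFAt (F i) x) : SmoothFAt (fun y ↦ ∑ i ∈ s, F i y) x :=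
  contMDiffAt_finsetSum hF

theorem der_sum {ι : Type*} {s : Finset ι} {F : ι → M → ℝ}
    (hF : ∀ i ∈ s, SmoothFAt (F i) x) :
    der (fun y ↦ ∑ i ∈ s, F i y) x u = ∑ i ∈ s, der (F i) x u := by
  classical
  induction s using Finset.induction_on with
  | empty => simpa using der_const (x := x) u 0
  | insert a s ha ih =>
    simp only [Finset.mem_insert, forall_eq_or_imp] at hF
    simp only [Finset.sum_insert ha, ← ih hF.2]
    exact der_add u hF.1 (SmoothFAt.sum hF.2)

theorem SmoothVAt.eventually_mdiff {X : VField M} (hX : SmoothVAt X x) :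
    ∀ᶠ y in 𝓝 x, MDifferentiableAt 𝓘(ℝ, E4) (𝓘(ℝ, E4).prod 𝓘(ℝ, E4))
      (fun y ↦ (TotalSpace.mk' E4 y (X y) : TangentBundle 𝓘(ℝ, E4) M)) y := by
  have h1 := ContMDiffAt.of_le hX (m := 1) (by norm_cast)
  obtain ⟨w, hw, h⟩ := (contMDiffAt_iff_contMDiffOn_nhds (by simp)).1 h1
  obtain ⟨w', hww, hwo, hxw⟩ := mem_nhds_iff.1 hw
  filter_upwards [hwo.mem_nhds hxw] with y hy
  exact ((h.mono hww).contMDiffAt (hwo.mem_nhds hy)).mdifferentiableAt (by simp)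

theorem SmoothFAt.eventually_mdiff (hf : SmoothFAt f x) :
    ∀ᶠ y in 𝓝 x, MDifferentiableAt 𝓘(ℝ, E4) 𝓘(ℝ, ℝ) f y := by
  have h1 := ContMDiffAt.of_le hf (m := 1) (by norm_cast)
  obtain ⟨w, hw, h⟩ := (contMDiffAt_iff_contMDiffOn_nhds (by simp)).1 h1
  obtain ⟨w', hww, hwo, hxw⟩ := mem_nhds_iff.1 hw
  filter_upwards [hwo.mem_nhds hxw] with y hy
  exact ((h.mono hww).contMDiffAt (hwo.mem_nhds hy)).mdifferentiableAt (by simp)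

/-! ### Covariant derivatives -/

variable (nab : Connection M) {X Y V W : VField M}

theorem nab_add (hX : SmoothVAt X x) (hY : SmoothVAt Y x) :
    nab (X + Y) x u = nab X x u + nab Y x u := by
  rw [nab.isCovariantDerivativeOnUniv.add hX.mdiff hY.mdiff]
  rfl

theorem nab_smul_of_mdiff
    (hX : MDifferentiableAt 𝓘(ℝ, E4) (𝓘(ℝ, E4).prod 𝓘(ℝ, E4))
      (fun y ↦ (TotalSpace.mk' E4 y (X y) : TangentBundle 𝓘(ℝ, E4) M)) x)
    (hf : MDifferentiableAt 𝓘(ℝ, E4) 𝓘(ℝ, ℝ) f x) :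
    nab (f • X) x u = f x • nab X x u + der f x u • X x := by
  rw [nab.isCovariantDerivativeOnUniv.leibniz hX hf]
  rfl

theorem nab_smul (hf : SmoothFAt f x) (hX : SmoothVAt X x) :
    nab (f • X) x u = f x • nab X x u + der f x u • X x :=
  nab_smul_of_mdiff u nab hX.mdiff hf.mdiff

theorem nab_congr (hX : SmoothVAt X x) (h : ∀ᶠ y in 𝓝 x, Y y = X y) :
    nab Y x u = nab X x u := by
  have hY : SmoothVAt Y x := hX.congr h
  rw [nab.isCovariantDerivativeOnUniv.congr_of_eventuallyEq hY.mdiff hX.mdiff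
    Filter.univ_mem h]

/-- The expression defining the covariant derivative of a tensor field, for vector fields. -/
def covField (T : Tensor2 M) (V W : VField M) (x : M) (u : TangentSpace 𝓘(ℝ, E4) x) : ℝ :=
  der (fun y ↦ T y (V y) (W y)) x u - T x (nab V x u) (W x) - T x (V x) (nab W x u)

variable {T : Tensor2 M} (hT : SmoothT T)
include hT

theorem covField_tensorial_left (hW : SmoothVAt W x) :
    SmoothTensorialAt (fun V ↦ covField nab T V W x u) x where
  smul := by
    intro f V hf hV
    have h1 : der (fun y ↦ T y ((f • V) y) (W y)) x u
        = der f x u * T x (V x) (W x) + f x * der (fun y ↦ T y (V y) (W y)) x u := by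
      rw [← der_mul u hf (hT x V W hV hW)]
      simp
    simp only [covField]
    rw [h1]
    simp only [nab_smul u nab hf hV, Pi.smul_apply', map_add, map_smul,
      LinearMap.add_apply, LinearMap.smul_apply, smul_eq_mul]
    ring
  add := by
    intro V V' hV hV'
    have h1 : der (fun y ↦ T y ((V + V') y) (W y)) x u
        = der (fun y ↦ T y (V y) (W y)) x u + der (fun y ↦ T y (V' y) (W y)) x u := by
      rw [← der_add u (hT x V W hV hW) (hT x V' W hV' hW)]
      simp
    simp only [covField]
    rw [h1]
    simp only [nab_add u nab hV hV', Pi.add_apply, map_add, LinearMap.add_apply]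
    ring

theorem covField_tensorial_right (hV : SmoothVAt V x) :
    SmoothTensorialAt (fun W ↦ covField nab T V W x u) x where
  smul := by
    intro f W hf hW
    have h1 : der (fun y ↦ T y (V y) ((f • W) y)) x u
        = der f x u * T x (V x) (W x) + f x * der (fun y ↦ T y (V y) (W y)) x u := by
      rw [← der_mul u hf (hT x V W hV hW)]
      simp
    simp only [covField]
    rw [h1]
    simp only [nab_smul u nab hf hW, Pi.smul_apply', map_add, map_smul,
      smul_eq_mul]
    ring
  add := by
    intro W W' hW hW'
    have h1 : der (fun y ↦ T y (V y) ((W + W') y)) x u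
        = der (fun y ↦ T y (V y) (W y)) x u + der (fun y ↦ T y (V y) (W' y)) x u := by
      rw [← der_add u (hT x V W hV hW) (hT x V W' hV hW')]
      simp
    simp only [covField]
    rw [h1]
    simp only [nab_add u nab hW hW', Pi.add_apply, map_add]
    ring

/-- `covT` is defined through particular extensions of vectors. Tensoriality in each slot separately
allows them to be replaced by arbitrary smooth fields, one slot at a time. -/
theorem covT_apply (hV : SmoothVAt V x) (hW : SmoothVAt W x) :
    covT nab T x u (V x) (W x) = covField nab T V W x u := by
  have h0 : covT nab T x u (V x) (W x) = covField nab T (ext (V x)) (ext (W x)) x u := by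
    simp only [covT, covField, ext_self]
  rw [h0, (covField_tensorial_left u nab hT (smoothVAt_ext (W x))).pointwise
    (smoothVAt_ext (V x)) hV (ext_self _)]
  exact (covField_tensorial_right u nab hT hV).pointwise (smoothVAt_ext (W x)) hW (ext_self _)

theorem der_apply_eq_covT (hV : SmoothVAt V x) (hW : SmoothVAt W x) :
    der (fun y ↦ T y (V y) (W y)) x u = covT nab T x u (V x) (W x) + T x (nab V x u) (W x)
      + T x (V x) (nab W x u) := by
  rw [covT_apply u nab hT hV hW, covField]
  ring

theorem covT_add_left (v v' w : TangentSpace 𝓘(ℝ, E4) x) :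
    covT nab T x u (v + v') w = covT nab T x u v w + covT nab T x u v' w := by
  have h1 := covT_apply u nab hT ((smoothVAt_ext v).add (smoothVAt_ext v')) (smoothVAt_ext w)
  have h2 := (covField_tensorial_left u nab hT (smoothVAt_ext w)).add (smoothVAt_ext v)
    (smoothVAt_ext v')
  simp only [Pi.add_apply, ext_self] at h1
  rw [h1, h2, ← covT_apply u nab hT (smoothVAt_ext v) (smoothVAt_ext w),
    ← covT_apply u nab hT (smoothVAt_ext v') (smoothVAt_ext w)]
  simp only [ext_self]

theorem covT_smul_left (c : ℝ) (v w : TangentSpace 𝓘(ℝ, E4) x) :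
    covT nab T x u (c • v) w = c * covT nab T x u v w := by
  have hc : SmoothFAt (fun _ : M ↦ c) x := contMDiffAt_const
  have h1 := covT_apply u nab hT (SmoothVAt.smul hc (smoothVAt_ext v)) (smoothVAt_ext w)
  have h2 := (covField_tensorial_left u nab hT (smoothVAt_ext w)).smul hc (smoothVAt_ext v)
  simp only [Pi.smul_apply', ext_self] at h1
  rw [h1, h2, ← covT_apply u nab hT (smoothVAt_ext v) (smoothVAt_ext w)]
  simp only [ext_self, smul_eq_mul]

theorem covT_add_right (v w w' : TangentSpace 𝓘(ℝ, E4) x) :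
    covT nab T x u v (w + w') = covT nab T x u v w + covT nab T x u v w' := by
  have h1 := covT_apply u nab hT (smoothVAt_ext v) ((smoothVAt_ext w).add (smoothVAt_ext w'))
  have h2 := (covField_tensorial_right u nab hT (smoothVAt_ext v)).add (smoothVAt_ext w)
    (smoothVAt_ext w')
  simp only [Pi.add_apply, ext_self] at h1
  rw [h1, h2, ← covT_apply u nab hT (smoothVAt_ext v) (smoothVAt_ext w),
    ← covT_apply u nab hT (smoothVAt_ext v) (smoothVAt_ext w')]
  simp only [ext_self]

theorem covT_smul_right (c : ℝ) (v w : TangentSpace 𝓘(ℝ, E4) x) :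
    covT nab T x u v (c • w) = c * covT nab T x u v w := by
  have hc : SmoothFAt (fun _ : M ↦ c) x := contMDiffAt_const
  have h1 := covT_apply u nab hT (smoothVAt_ext v) (SmoothVAt.smul hc (smoothVAt_ext w))
  have h2 := (covField_tensorial_right u nab hT (smoothVAt_ext v)).smul hc (smoothVAt_ext w)
  simp only [Pi.smul_apply', ext_self] at h1
  rw [h1, h2, ← covT_apply u nab hT (smoothVAt_ext v) (smoothVAt_ext w)]
  simp only [ext_self, smul_eq_mul]

omit hT

theorem covT_add_dir (u' v w : TangentSpace 𝓘(ℝ, E4) x) :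
    covT nab T x (u + u') v w = covT nab T x u v w + covT nab T x u' v w := by
  simp only [covT, map_add, LinearMap.add_apply]
  ring

theorem covT_smul_dir (c : ℝ) (v w : TangentSpace 𝓘(ℝ, E4) x) :
    covT nab T x (c • u) v w = c * covT nab T x u v w := by
  simp only [covT, map_smul, LinearMap.smul_apply, smul_eq_mul]
  ring

/-- `covT` as a linear map in each argument. -/
def covL (hT : SmoothT T) (x : M) : TangentSpace 𝓘(ℝ, E4) x →ₗ[ℝ] TangentSpace 𝓘(ℝ, E4) x →ₗ[ℝ]
    TangentSpace 𝓘(ℝ, E4) x →ₗ[ℝ] ℝ :=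
  LinearMap.mk₂ ℝ (fun u v ↦
      { toFun := fun w ↦ covT nab T x u v w
        map_add' := fun w w' ↦ covT_add_right u nab hT v w w'
        map_smul' := fun c w ↦ covT_smul_right u nab hT c v w })
    (fun u u' v ↦ LinearMap.ext fun w ↦ covT_add_dir u nab u' v w)
    (fun c u v ↦ LinearMap.ext fun w ↦ covT_smul_dir u nab c v w)
    (fun u v v' ↦ LinearMap.ext fun w ↦ covT_add_left u nab hT v v' w)
    (fun c u v ↦ LinearMap.ext fun w ↦ covT_smul_left u nab hT c v w)

@[simp]
theorem covL_apply (hT : SmoothT T) (v w : TangentSpace 𝓘(ℝ, E4) x) :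
    covL nab hT x u v w = covT nab T x u v w := rfl

end Derivations

/-! ### Curvature: tensoriality, symmetries, Ricci identity -/

section Curvature

variable {M : Type*} [TopologicalSpace M] [ChartedSpace E4 M] [IsManifold 𝓘(ℝ, E4) ∞ M]
  [RiemannianBundle (fun x : M ↦ TangentSpace 𝓘(ℝ, E4) x)]
  [IsContMDiffRiemannianBundle 𝓘(ℝ, E4) ∞ E4 (fun x : M ↦ TangentSpace 𝓘(ℝ, E4) x)]
  {nab : Connection M} (hnab : IsLeviCivita nab) {x : M} {X Y V W ξ : VField M}
include hnab

theorem mlieBracket_eq_nab (hX : SmoothVAt X x) (hY : SmoothVAt Y x) :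
    mlieBracket 𝓘(ℝ, E4) X Y x = nab Y x (X x) - nab X x (Y x) :=
  ((CovariantDerivative.torsion_eq_zero_iff nab).1 hnab.torsion hX.mdiff hY.mdiff).symm

theorem der_inner (hX : SmoothVAt X x) (hY : SmoothVAt Y x) (u : TangentSpace 𝓘(ℝ, E4) x) :
    der (fun y ↦ inner ℝ (X y) (Y y)) x u
      = inner ℝ (nab X x u) (Y x) + inner ℝ (X x) (nab Y x u) := by
  have h := hnab.metric.mvfderiv_inner_eq (ext u) hX.mdiff hY.mdiff
  simpa only [ext_self] using h

omit hnab in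
/-- The expression defining the curvature, for vector fields. -/
def curvField (nab : Connection M) (X Y V : VField M) (x : M) : TangentSpace 𝓘(ℝ, E4) x :=
  nab (fun y ↦ nab V y (Y y)) x (X x) - nab (fun y ↦ nab V y (X y)) x (Y x)
    - nab V x (mlieBracket 𝓘(ℝ, E4) X Y x)

omit hnab in
theorem curvField_swap (nab : Connection M) (X Y V : VField M) (x : M) :
    curvField nab X Y V x = - curvField nab Y X V x := by
  rw [curvField, curvField, mlieBracket_swap_apply, map_neg]
  abel

theorem curvField_tensorial_first (hV : SmoothVAt V x) :
    SmoothTensorialAt (fun X ↦ curvField nab X Y V x) x where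
  smul := by
    intro f X hf hX
    have e : (fun y ↦ nab V y ((f • X) y)) = f • fun y ↦ nab V y (X y) := by
      funext y
      simp
    simp only [curvField]
    rw [e]
    simp only [nab_smul _ nab hf (hnab.smooth x X V hX hV),
      mlieBracket_smul_left hf.mdiff hX.mdiff, Pi.smul_apply', map_smul, map_add, neg_smul,
      map_neg]
    module
  add := by
    intro X X' hX hX'
    have e : (fun y ↦ nab V y ((X + X') y))
        = (fun y ↦ nab V y (X y)) + fun y ↦ nab V y (X' y) := by
      funext y
      simp
    simp only [curvField]
    rw [e]
    simp only [nab_add _ nab (hnab.smooth x X V hX hV) (hnab.smooth x X' V hX' hV),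
      mlieBracket_add_left hX.mdiff hX'.mdiff, Pi.add_apply, map_add]
    module

/-- First derivatives of `f` enter the iterated derivatives symmetrically in the two directions and
cancel. The second derivatives combine to [X, Y]f, which the bracket term removes. -/
theorem curvField_tensorial_third (hX : SmoothVAt X x) (hY : SmoothVAt Y x) :
    SmoothTensorialAt (fun V ↦ curvField nab X Y V x) x where
  smul := by
    intro f V hf hV
    have key : ∀ A B : VField M, SmoothVAt A x → SmoothVAt B x →
        nab (fun y ↦ nab (f • V) y (A y)) x (B x)
          = f x • nab (fun y ↦ nab V y (A y)) x (B x) + der f x (B x) • nab V x (A x)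
            + (der f x (A x) • nab V x (B x) + der (fun y ↦ der f y (A y)) x (B x) • V x) := by
      intro A B hA hB
      have hnV := hnab.smooth x A V hA hV
      have hfA := SmoothFAt.mvfderiv_apply hf hA
      have h1 : ∀ᶠ y in 𝓝 x, nab (f • V) y (A y)
          = (f • (fun y ↦ nab V y (A y)) + (fun y ↦ der f y (A y)) • V : VField M) y := by
        filter_upwards [hV.eventually_mdiff, hf.eventually_mdiff] with y hy hy'
        exact nab_smul_of_mdiff _ nab hy hy'
      rw [nab_congr _ nab ((SmoothVAt.smul hf hnV).add (SmoothVAt.smul hfA hV)) h1,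
        nab_add _ nab (SmoothVAt.smul hf hnV) (SmoothVAt.smul hfA hV), nab_smul _ nab hf hnV,
        nab_smul _ nab hfA hV]
    have hbr := mvfderiv_mlieBracket hf hX hY
    simp only [curvField, key Y X hY hX, key X Y hX hY, nab_smul _ nab hf hV]
    rw [show der f x (mlieBracket 𝓘(ℝ, E4) X Y x) = _ from hbr]
    module
  add := by
    intro V V' hV hV'
    have key : ∀ A B : VField M, SmoothVAt A x → SmoothVAt B x →
        nab (fun y ↦ nab (V + V') y (A y)) x (B x)
          = nab (fun y ↦ nab V y (A y)) x (B x) + nab (fun y ↦ nab V' y (A y)) x (B x) := by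
      intro A B hA hB
      have h1 : ∀ᶠ y in 𝓝 x, nab (V + V') y (A y)
          = ((fun y ↦ nab V y (A y)) + fun y ↦ nab V' y (A y) : VField M) y := by
        filter_upwards [hV.eventually_mdiff, hV'.eventually_mdiff] with y hy hy'
        rw [nab.isCovariantDerivativeOnUniv.add hy hy']
        rfl
      rw [nab_congr _ nab ((hnab.smooth x A V hA hV).add (hnab.smooth x A V' hA hV')) h1,
        nab_add _ nab (hnab.smooth x A V hA hV) (hnab.smooth x A V' hA hV')]
    simp only [curvField, key Y X hY hX, key X Y hX hY, nab_add _ nab hV hV']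
    module

theorem curv_apply (hX : SmoothVAt X x) (hY : SmoothVAt Y x) (hV : SmoothVAt V x) :
    curv nab x (X x) (Y x) (V x) = curvField nab X Y V x := by
  have h0 : curv nab x (X x) (Y x) (V x)
      = curvField nab (ext (X x)) (ext (Y x)) (ext (V x)) x := by
    simp only [curv, curvField, ext_self]
  rw [h0, (curvField_tensorial_first hnab (smoothVAt_ext _)).pointwise
    (smoothVAt_ext (X x)) hX (ext_self _), curvField_swap,
    (curvField_tensorial_first hnab (smoothVAt_ext _)).pointwise
    (smoothVAt_ext (Y x)) hY (ext_self _), ← curvField_swap]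
  exact (curvField_tensorial_third hnab hX hY).pointwise (smoothVAt_ext (V x)) hV (ext_self _)

omit hnab in
theorem curv_swap (u v w : TangentSpace 𝓘(ℝ, E4) x) :
    curv nab x u v w = - curv nab x v u w := by
  have := curvField_swap nab (ext u) (ext v) (ext w) x
  simpa only [curv, curvField, ext_self] using this

omit hnab in
theorem riem_swap_left (u v w z : TangentSpace 𝓘(ℝ, E4) x) :
    riem nab x u v w z = - riem nab x v u w z := by
  rw [riem, riem, curv_swap, inner_neg_left]

/-- For a torsion-free connection the cyclic sum of curvatures regroups into iterated brackets, and
the first Bianchi identity becomes the Jacobi identity. -/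
theorem curv_cyclic (u v w : TangentSpace 𝓘(ℝ, E4) x) :
    curv nab x u v w + curv nab x v w u + curv nab x w u v = 0 := by
  have hs := fun v : TangentSpace 𝓘(ℝ, E4) x ↦ smoothVAt_ext v
  have key : ∀ a b c : TangentSpace 𝓘(ℝ, E4) x,
      nab (fun y ↦ nab (ext c) y (ext b y)) x a - nab (fun y ↦ nab (ext b) y (ext c y)) x a
        - nab (ext a) x (mlieBracket 𝓘(ℝ, E4) (ext b) (ext c) x)
        = mlieBracket 𝓘(ℝ, E4) (ext a) (mlieBracket 𝓘(ℝ, E4) (ext b) (ext c)) x := by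
    intro a b c
    have hev : ∀ᶠ y in 𝓝 x, mlieBracket 𝓘(ℝ, E4) (ext b) (ext c) y
        = ((fun y ↦ nab (ext c) y (ext b y)) - fun y ↦ nab (ext b) y (ext c y) : VField M) y := by
      filter_upwards [eventually_smoothVAt_ext b, eventually_smoothVAt_ext c] with y hb hc
      exact mlieBracket_eq_nab hnab hb hc
    have h1 := hnab.smooth x _ _ (hs b) (hs c)
    have h2 := hnab.smooth x _ _ (hs c) (hs b)
    have h3 := (h1.sub h2).congr hev
    have h4 : nab (mlieBracket 𝓘(ℝ, E4) (ext b) (ext c)) x a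
        = nab (fun y ↦ nab (ext c) y (ext b y)) x a
          - nab (fun y ↦ nab (ext b) y (ext c y)) x a := by
      rw [eq_sub_iff_add_eq, ← nab_add a nab h3 h2]
      refine nab_congr a nab h1 ?_
      filter_upwards [hev] with y hy
      simp only [Pi.add_apply, hy, Pi.sub_apply, sub_add_cancel]
    rw [mlieBracket_eq_nab hnab (hs a) h3, ext_self, h4]
  have hinst : IsManifold 𝓘(ℝ, E4) (minSmoothness ℝ 3) M :=
    IsManifold.of_le (n := ∞) (by simp; norm_cast)
  have hsm : ∀ v : TangentSpace 𝓘(ℝ, E4) x, ContMDiffAt 𝓘(ℝ, E4) (𝓘(ℝ, E4).prod 𝓘(ℝ, E4))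
      (minSmoothness ℝ 2)
      (fun y ↦ (TotalSpace.mk' E4 y (ext v y) : TangentBundle 𝓘(ℝ, E4) M)) x :=
    fun v ↦ ContMDiffAt.of_le (hs v) (by simp; norm_cast)
  have hJ := leibniz_identity_mlieBracket_apply (hsm u) (hsm v) (hsm w)
  have k1 := key u v w
  have k2 := key v w u
  have k3 := key w u v
  have s1 : mlieBracket 𝓘(ℝ, E4) (ext v) (mlieBracket 𝓘(ℝ, E4) (ext u) (ext w)) x
      = - mlieBracket 𝓘(ℝ, E4) (ext v) (mlieBracket 𝓘(ℝ, E4) (ext w) (ext u)) x := by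
    have h5 : SmoothVAt (mlieBracket 𝓘(ℝ, E4) (ext w) (ext u)) x := by
      have hev : ∀ᶠ y in 𝓝 x, mlieBracket 𝓘(ℝ, E4) (ext w) (ext u) y
          = ((fun y ↦ nab (ext u) y (ext w y)) - fun y ↦ nab (ext w) y (ext u y) : VField M) y := by
        filter_upwards [eventually_smoothVAt_ext w, eventually_smoothVAt_ext u] with y hb hc
        exact mlieBracket_eq_nab hnab hb hc
      exact ((hnab.smooth x _ _ (hs w) (hs u)).sub (hnab.smooth x _ _ (hs u) (hs w))).congr hev
    rw [mlieBracket_swap (V := ext u), ← neg_one_smul ℝ (mlieBracket 𝓘(ℝ, E4) (ext w) (ext u)),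
      mlieBracket_const_smul_right h5.mdiff, neg_one_smul]
  have s2 := mlieBracket_swap_apply (I := 𝓘(ℝ, E4)) (V := mlieBracket 𝓘(ℝ, E4) (ext u) (ext v))
    (W := ext w) (x := x)
  rw [s1, s2, ← k1, ← k2, ← k3] at hJ
  simp only [curv]
  rw [← sub_eq_zero] at hJ
  rw [← hJ]
  abel

/-- The two bracketed expressions on the left are the second covariant derivatives of `T`, written
out along vector fields by the Leibniz rule. -/
theorem ricci_identity {T : Tensor2 M} (hT : SmoothT T)
    (hX : ∀ᶠ y in 𝓝 x, SmoothVAt X y) (hY : ∀ᶠ y in 𝓝 x, SmoothVAt Y y)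
    (hV : ∀ᶠ y in 𝓝 x, SmoothVAt V y) (hW : ∀ᶠ y in 𝓝 x, SmoothVAt W y) :
    (der (fun y ↦ covT nab T y (Y y) (V y) (W y)) x (X x)
        - covT nab T x (nab Y x (X x)) (V x) (W x) - covT nab T x (Y x) (nab V x (X x)) (W x)
        - covT nab T x (Y x) (V x) (nab W x (X x)))
      - (der (fun y ↦ covT nab T y (X y) (V y) (W y)) x (Y x)
        - covT nab T x (nab X x (Y x)) (V x) (W x) - covT nab T x (X x) (nab V x (Y x)) (W x)
        - covT nab T x (X x) (V x) (nab W x (Y x)))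
      = - T x (curv nab x (X x) (Y x) (V x)) (W x) - T x (V x) (curv nab x (X x) (Y x) (W x)) := by
  have hX0 := hX.self_of_nhds
  have hY0 := hY.self_of_nhds
  have hV0 := hV.self_of_nhds
  have hW0 := hW.self_of_nhds
  have hf : SmoothFAt (fun y ↦ T y (V y) (W y)) x := hT x V W hV0 hW0
  -- Apart from the iterated derivatives, the terms produced here are first-order products. After
  -- exchange of the two directions they either cancel or match the correction terms in the
  -- statement.
  have key : ∀ A B : VField M, SmoothVAt A x → SmoothVAt B x →
      der (fun y ↦ covT nab T y (A y) (V y) (W y)) x (B x)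
        = der (fun y ↦ der (fun z ↦ T z (V z) (W z)) y (A y)) x (B x)
          - (covT nab T x (B x) (nab V x (A x)) (W x)
            + T x (nab (fun y ↦ nab V y (A y)) x (B x)) (W x)
            + T x (nab V x (A x)) (nab W x (B x)))
          - (covT nab T x (B x) (V x) (nab W x (A x)) + T x (nab V x (B x)) (nab W x (A x))
            + T x (V x) (nab (fun y ↦ nab W y (A y)) x (B x))) := by
    intro A B hA hB
    have hAV := hnab.smooth x A V hA hV0
    have hAW := hnab.smooth x A W hA hW0
    have h1 : ∀ᶠ y in 𝓝 x, covT nab T y (A y) (V y) (W y)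
        = der (fun z ↦ T z (V z) (W z)) y (A y) - T y (nab V y (A y)) (W y)
          - T y (V y) (nab W y (A y)) := by
      filter_upwards [hV, hW] with y hVy hWy
      exact covT_apply _ nab hT hVy hWy
    have hd := SmoothFAt.mvfderiv_apply hf hA
    rw [der_congr _ h1, der_sub _ (hd.sub (hT x _ _ hAV hW0)) (hT x _ _ hV0 hAW),
      der_sub _ hd (hT x _ _ hAV hW0), der_apply_eq_covT _ nab hT hAV hW0,
      der_apply_eq_covT _ nab hT hV0 hAW]
  have hbr := mvfderiv_mlieBracket hf hX0 hY0
  have hbr' := der_apply_eq_covT (mlieBracket 𝓘(ℝ, E4) X Y x) nab hT hV0 hW0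
  have hcb : covT nab T x (mlieBracket 𝓘(ℝ, E4) X Y x) (V x) (W x)
      = covT nab T x (nab Y x (X x)) (V x) (W x) - covT nab T x (nab X x (Y x)) (V x) (W x) := by
    rw [mlieBracket_eq_nab hnab hX0 hY0, ← covL_apply _ nab hT, map_sub]
    rfl
  rw [key Y X hY0 hX0, key X Y hX0 hY0, curv_apply hnab hX0 hY0 hV0, curv_apply hnab hX0 hY0 hW0]
  simp only [curvField, map_sub, LinearMap.sub_apply]
  linear_combination -hbr + hbr' + hcb

omit hnab in
variable (M) in
/-- The metric as a tensor field. -/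
def metricT : Tensor2 M := fun x ↦ innerₗ (TangentSpace 𝓘(ℝ, E4) x)

omit hnab in
theorem smoothT_metricT : SmoothT (metricT M) := fun _ _ _ hX hY ↦ hX.inner hY

theorem covT_metricT (u v w : TangentSpace 𝓘(ℝ, E4) x) : covT nab (metricT M) x u v w = 0 := by
  have h := der_inner hnab (smoothVAt_ext v) (smoothVAt_ext w) u
  simp only [ext_self] at h
  have h' : covT nab (metricT M) x u v w
      = der (fun y ↦ inner ℝ (ext v y) (ext w y)) x u - inner ℝ (nab (ext v) x u) w
        - inner ℝ v (nab (ext w) x u) := rfl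
  rw [h', h]
  ring

/-- This is the Ricci identity for the metric, whose left-hand side vanishes because the metric is
parallel. -/
theorem riem_swap_right (u v w z : TangentSpace 𝓘(ℝ, E4) x) :
    riem nab x u v w z = - riem nab x u v z w := by
  have h := ricci_identity hnab (T := metricT M) smoothT_metricT (eventually_smoothVAt_ext u)
    (eventually_smoothVAt_ext v) (eventually_smoothVAt_ext w) (eventually_smoothVAt_ext z)
  simp only [covT_metricT hnab, der_const, ext_self] at h
  have h1 : riem nab x u v w z = metricT M x (curv nab x u v w) z := rfl
  have h2 : riem nab x u v z w = metricT M x w (curv nab x u v z) := real_inner_comm _ _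
  rw [h1, h2]
  linarith

theorem riem_cyclic (u v w z : TangentSpace 𝓘(ℝ, E4) x) :
    riem nab x u v w z + riem nab x v w u z + riem nab x w u v z = 0 := by
  rw [riem, riem, riem, ← inner_add_left, ← inner_add_left, curv_cyclic hnab, inner_zero_left]

omit hnab in
/-- The tensor field `∇_a ξ_b`. -/
def gradT (nab : Connection M) (ξ : VField M) : Tensor2 M := fun x ↦
  LinearMap.mk₂ ℝ (fun u v ↦ inner ℝ (nab ξ x u) v)
    (fun u u' v ↦ by rw [map_add, inner_add_left])
    (fun c u v ↦ by rw [map_smul, real_inner_smul_left]; rfl)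
    (fun u v v' ↦ inner_add_right _ _ _)
    (fun c u v ↦ real_inner_smul_right _ _ _)

omit hnab in
@[simp]
theorem gradT_apply (u v : TangentSpace 𝓘(ℝ, E4) x) :
    gradT nab ξ x u v = inner ℝ (nab ξ x u) v := rfl

theorem smoothT_gradT (hξ : ∀ x, SmoothVAt ξ x) : SmoothT (gradT nab ξ) :=
  fun x _ _ hX hY ↦ (hnab.smooth x _ _ hX (hξ x)).inner hY

theorem covT_gradT (hξ : ∀ x, SmoothVAt ξ x) (hX : SmoothVAt X x) (u w : TangentSpace 𝓘(ℝ, E4) x) :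
    covT nab (gradT nab ξ) x u (X x) w
      = inner ℝ (nab (fun y ↦ nab ξ y (X y)) x u - nab ξ x (nab X x u)) w := by
  have hw := smoothVAt_ext w
  have h := covT_apply u nab (smoothT_gradT hnab hξ) hX hw
  have h1 := der_inner hnab (hnab.smooth x X ξ hX (hξ x)) hw u
  simp only [ext_self] at h h1
  rw [h, covField]
  simp only [gradT_apply, ext_self]
  rw [h1, inner_sub_left]
  ring

/-- The Ricci identity for a vector field: vanishing torsion turns the difference of first-order
corrections into the derivative along the bracket. -/
theorem covT_gradT_sub (hξ : ∀ x, SmoothVAt ξ x) (u v w : TangentSpace 𝓘(ℝ, E4) x) :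
    covT nab (gradT nab ξ) x u v w - covT nab (gradT nab ξ) x v u w
      = riem nab x u v (ξ x) w := by
  have hu := smoothVAt_ext u
  have hv := smoothVAt_ext v
  have h1 := covT_gradT hnab hξ hv u w
  have h2 := covT_gradT hnab hξ hu v w
  have h3 := curv_apply hnab hu hv (hξ x)
  have h4 := mlieBracket_eq_nab hnab hu hv
  simp only [ext_self] at h1 h2 h3 h4
  rw [riem, h3, h1, h2, ← inner_sub_left, curvField, h4]
  congr 1
  simp only [ext_self, map_sub]
  abel

end Curvature

/-! ### From spinor components to real anti-self-dual and self-dual forms -/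

section SpinorAlgebra

/-- The components of an anti-self-dual 2-form. -/
def asdForm (a b c : ℝ) : Fin 4 → Fin 4 → ℝ :=
  ![![0, a, b, c], ![-a, 0, -c, b], ![-b, c, 0, -a], ![-c, -b, a, 0]]

/-- The components of a self-dual 2-form. -/
def sdForm (a b c : ℝ) : Fin 4 → Fin 4 → ℝ :=
  ![![0, a, b, c], ![-a, 0, c, -b], ![-b, -c, 0, a], ![-c, b, -a, 0]]

/-- The Infeld-van der Waerden symbols without their normalising factor. -/
def pauli (k : Fin 4) : Matrix (Fin 2) (Fin 2) ℂ :=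
  ![!![1, 0; 0, 1], !![0, Complex.I; Complex.I, 0], !![0, 1; -1, 0],
      !![Complex.I, 0; 0, -Complex.I]] k

theorem ivdw_apply (k : Fin 4) (A A' : Fin 2) :
    ivdw k A A' = ((Real.sqrt 2 : ℝ) : ℂ)⁻¹ * pauli k A A' := rfl

theorem inv_sqrt_two_mul_self :
    ((Real.sqrt 2 : ℝ) : ℂ)⁻¹ * ((Real.sqrt 2 : ℝ) : ℂ)⁻¹ = 1 / 2 := by
  rw [← mul_inv, ← Complex.ofReal_mul, Real.mul_self_sqrt (by norm_num)]
  norm_num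

theorem inv_sqrt_two_ne_zero : ((Real.sqrt 2 : ℝ) : ℂ)⁻¹ ≠ 0 := by
  intro h
  have := inv_sqrt_two_mul_self
  rw [h] at this
  norm_num at this

theorem spin2_eq (T : Fin 4 → Fin 4 → ℝ) (A A' B B' : Fin 2) :
    spin2 T A A' B B' = (1 / 2) * ∑ i, ∑ j, (T i j : ℂ) * pauli i A A' * pauli j B B' := by
  rw [← inv_sqrt_two_mul_self, spin2, Finset.mul_sum]
  refine Finset.sum_congr rfl fun i _ ↦ ?_
  rw [Finset.mul_sum]
  refine Finset.sum_congr rfl fun j _ ↦ ?_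
  rw [ivdw_apply, ivdw_apply]
  ring

/-- The sixteen spinor components, split into real and imaginary parts, form a linear system that
determines the real matrix. -/
theorem exists_asdForm_of_spin2 {T : Fin 4 → Fin 4 → ℝ} {s : Fin 2 → Fin 2 → ℂ}
    (hs : s 0 1 = s 1 0) (h : ∀ A A' B B', spin2 T A A' B B' = s A B * eps A' B') :
    T = asdForm (T 0 1) (T 0 2) (T 0 3) := by
  have key := fun A A' B B' ↦ (spin2_eq T A A' B B').symm.trans (h A A' B B')
  have h1 := key 0 0 0 0
  have h2 := key 0 0 0 1
  have h3 := key 0 0 1 0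
  have h4 := key 0 0 1 1
  have h5 := key 0 1 0 0
  have h6 := key 0 1 0 1
  have h7 := key 0 1 1 0
  have h8 := key 0 1 1 1
  have h9 := key 1 0 0 0
  have h10 := key 1 0 0 1
  have h11 := key 1 0 1 0
  have h12 := key 1 0 1 1
  have h13 := key 1 1 0 0
  have h14 := key 1 1 0 1
  have h15 := key 1 1 1 0
  have h16 := key 1 1 1 1
  rw [hs] at h4 h8
  clear key h hs
  simp [Fin.sum_univ_four, pauli, eps, Complex.ext_iff] at h1 h2 h3 h4 h5 h6 h7 h8 h9 h10 h11 h12 h13 h14 h15 h16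
  ext i j
  fin_cases i <;> fin_cases j <;> simp [asdForm] <;> linarith

/-- The spinor components of `asdForm a b c`. -/
def asdSpinor (a b c : ℝ) : Fin 2 → Fin 2 → ℂ :=
  ![![b + a * Complex.I, -(c * Complex.I)], ![-(c * Complex.I), b - a * Complex.I]]

/-- The spinor components of `sdForm a b c`. -/
def sdSpinor (a b c : ℝ) : Fin 2 → Fin 2 → ℂ :=
  ![![-b + a * Complex.I, -(c * Complex.I)], ![-(c * Complex.I), -b - a * Complex.I]]

theorem unprimedPart_asdForm (a b c : ℝ) : unprimedPart (asdForm a b c) = asdSpinor a b c := by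
  funext A B
  fin_cases A <;> fin_cases B <;>
    simp [unprimedPart, spin2_eq, Fin.sum_univ_four, pauli, eps, asdForm, asdSpinor] <;>
    (try ring_nf) <;> simp [Complex.ext_iff] <;> ring

theorem primedPart_add (S T : Fin 4 → Fin 4 → ℝ) (A' B' : Fin 2) :
    primedPart (fun i j ↦ S i j + T i j) A' B' = primedPart S A' B' + primedPart T A' B' := by
  simp only [primedPart, spin2_eq, Finset.mul_sum, ← Finset.sum_add_distrib, Complex.ofReal_add]
  simp only [add_mul, mul_add]

theorem primedPart_asdForm (a b c : ℝ) (A' B' : Fin 2) : primedPart (asdForm a b c) A' B' = 0 := by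
  fin_cases A' <;> fin_cases B' <;>
    simp [primedPart, spin2_eq, Fin.sum_univ_four, pauli, eps, asdForm] <;>
    (try ring_nf) <;> simp

theorem primedPart_sdForm (a b c : ℝ) : primedPart (sdForm a b c) = sdSpinor a b c := by
  funext A B
  fin_cases A <;> fin_cases B <;>
    simp [primedPart, spin2_eq, Fin.sum_univ_four, pauli, eps, sdForm, sdSpinor] <;>
    (try ring_nf) <;> simp [Complex.ext_iff] <;> ring

theorem half_sum_mul_raise2_asdSpinor (a b c : ℝ) :
    (1 / 2) * ∑ A, ∑ B, asdSpinor a b c A B * raise2 (asdSpinor a b c) A B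
      = ((a ^ 2 + b ^ 2 + c ^ 2 : ℝ) : ℂ) := by
  simp [raise2, eps, asdSpinor]
  linear_combination (-(a : ℂ) ^ 2 - c ^ 2) * Complex.I_sq

/-- Contracting σ_AB ε_A'B' and χ_A'B' ε_AB over their second indices gives -σ_AB χ_A'B'; this is
the origin of the minus sign in the Killing tensor. -/
theorem spin2_eq_of_scalar_product (a b c α β γ φ : ℝ) {T : Fin 4 → Fin 4 → ℝ}
    (hT : ∀ i j, T i j = -(∑ m, asdForm a b c i m * sdForm α β γ j m) - φ / 2 * (if i = j then 1 else 0))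
    (A A' B B' : Fin 2) :
    spin2 T A A' B B' = asdSpinor a b c A B * sdSpinor α β γ A' B'
      - (1 / 2) * (φ : ℂ) * (eps A B * eps A' B') := by
  rw [spin2_eq]
  fin_cases A <;> fin_cases A' <;> fin_cases B <;> fin_cases B' <;>
    simp [hT, Fin.sum_univ_four, pauli, eps, asdForm, sdForm, asdSpinor, sdSpinor] <;>
    (try ring_nf) <;> simp [Complex.ext_iff] <;> ring_nf

/-- The covariant derivative of a Killing spinor in terms of its vector field. -/
def ksForm (v : Fin 4 → ℝ) (k : Fin 4) : Fin 4 → Fin 4 → ℝ :=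
  asdForm (![-v 1, v 0, v 3, -v 2] k) (![-v 2, -v 3, v 0, v 1] k) (![-v 3, v 2, -v 1, v 0] k)

theorem spin3_contraction (T : Fin 4 → Fin 4 → Fin 4 → ℝ) (A A' B C : Fin 2) :
    (1 / 2) * ∑ B', ∑ C', eps B' C' * spin3 T A A' B B' C C'
      = ((Real.sqrt 2 : ℝ) : ℂ)⁻¹ * ∑ k, pauli k A A' * unprimedPart (T k) B C := by
  have h : ∀ B' C', spin3 T A A' B B' C C'
      = ∑ k, ((Real.sqrt 2 : ℝ) : ℂ)⁻¹ * pauli k A A' * spin2 (T k) B B' C C' := by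
    intro B' C'
    simp only [spin3, spin2, Finset.mul_sum, ← ivdw_apply]
    refine Finset.sum_congr rfl fun k _ ↦ Finset.sum_congr rfl fun i _ ↦
      Finset.sum_congr rfl fun j _ ↦ ?_
    ring
  simp only [h, unprimedPart, Fin.sum_univ_two, Fin.sum_univ_four]
  ring

/-- The Killing spinor equation solved in real components. The solution `ksForm v k` is minus twice
the anti-self-dual part of e_k ∧ v. -/
theorem eq_ksForm {T : Fin 4 → Fin 4 → Fin 4 → ℝ} {p q r v : Fin 4 → ℝ}
    (hT : ∀ k, T k = asdForm (p k) (q k) (r k))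
    (h : ∀ A A' B C, (1 / 2) * ∑ B', ∑ C', eps B' C' * spin3 T A A' B B' C C'
      = eps A B * spin1 v C A' + eps A C * spin1 v B A') : T = ksForm v := by
  have h1 : ∀ A A' B C, ∑ k, pauli k A A' * asdSpinor (p k) (q k) (r k) B C
      = eps A B * (∑ k, v k * pauli k C A') + eps A C * ∑ k, v k * pauli k B A' := by
    intro A A' B C
    apply mul_left_cancel₀ inv_sqrt_two_ne_zero
    have h2 := h A A' B C
    simp only [spin3_contraction, hT, unprimedPart_asdForm, spin1] at h2
    rw [h2]
    simp only [ivdw_apply, Fin.sum_univ_four]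
    ring
  have k1 := h1 0 0 0 0
  have k2 := h1 0 0 0 1
  have k3 := h1 0 0 1 1
  have k4 := h1 0 1 0 0
  have k5 := h1 0 1 0 1
  have k6 := h1 0 1 1 1
  have k7 := h1 1 0 0 0
  have k8 := h1 1 0 0 1
  have k9 := h1 1 0 1 1
  have k10 := h1 1 1 0 0
  have k11 := h1 1 1 0 1
  have k12 := h1 1 1 1 1
  clear h h1
  simp [Fin.sum_univ_four, pauli, eps, asdSpinor, Complex.ext_iff] at k1 k2 k3 k4 k5 k6 k7 k8 k9 k10 k11 k12
  funext k
  rw [hT, ksForm]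
  fin_cases k <;> simp <;> congr 1 <;> linarith

theorem eq_asdForm {f : Fin 4 → Fin 4 → ℝ} (h : ∀ i j, f i j = - f j i) (h1 : f 2 3 = - f 0 1)
    (h2 : f 1 3 = f 0 2) (h3 : f 1 2 = - f 0 3) : f = asdForm (f 0 1) (f 0 2) (f 0 3) := by
  have e0 := h 0 0
  have e1 := h 1 1
  have e2 := h 2 2
  have e3 := h 3 3
  have e4 := h 1 0
  have e5 := h 2 0
  have e6 := h 3 0
  have e7 := h 2 1
  have e8 := h 3 1
  have e9 := h 3 2
  ext i j
  fin_cases i <;> fin_cases j <;> simp [asdForm] <;> linarith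

/-- The Riemann tensor with anti-self-dual Weyl curvature given by a symmetric traceless matrix. -/
def weylForm (p q r s t : ℝ) (i j k l : Fin 4) : ℝ :=
  asdForm (asdForm p q r k l) (asdForm q s t k l) (asdForm r t (-p - s) k l) i j

/-- Pair symmetry carries anti-self-duality from the first index pair to the second, leaving a
symmetric 3×3 matrix. The Bianchi identity on the indices 0, 1, 2, 3 makes it traceless. -/
theorem exists_weylForm {R : Fin 4 → Fin 4 → Fin 4 → Fin 4 → ℝ}
    (hl : ∀ i j k l, R i j k l = - R j i k l) (hr : ∀ i j k l, R i j k l = - R i j l k)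
    (hc : ∀ i j k l, R i j k l + R j k i l + R k i j l = 0)
    (h1 : ∀ k l, R 2 3 k l = - R 0 1 k l) (h2 : ∀ k l, R 1 3 k l = R 0 2 k l)
    (h3 : ∀ k l, R 1 2 k l = - R 0 3 k l) : ∃ p q r s t, R = weylForm p q r s t := by
  -- Pair symmetry is the usual consequence of four cyclic identities and the antisymmetries.
  have hp : ∀ i j k l, R i j k l = R k l i j := by
    intro i j k l
    linarith [hc i j k l, hc j k l i, hc k l i j, hc l i j k, hl i j k l, hr i j k l, hl j k i l,
      hl j k l i, hr j k l i, hr k l i j, hl k l i j, hl l i j k, hr l i j k, hl k i j l,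
      hr k i j l, hl j l k i, hr j l k i, hl l j i k, hr l j i k, hl j l i k, hr j l i k,
      hl k i l j, hr k i l j, hl i k j l, hr i k j l, hl l i k j, hr k l j i]
  have key : ∀ i j k l, R i j k l = asdForm (R 0 1 k l) (R 0 2 k l) (R 0 3 k l) i j := by
    intro i j k l
    have := eq_asdForm (f := fun i j ↦ R i j k l) (fun i j ↦ hl i j k l) (h1 k l) (h2 k l) (h3 k l)
    exact congrFun (congrFun this i) j
  have tr := hc 0 1 2 3
  have tr1 := hl 2 0 1 3
  have tr2 := hp 0 1 2 3
  have tr3 := hp 0 2 1 3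
  have tr4 := hp 0 3 1 2
  have tr5 := hp 1 2 0 3
  refine ⟨R 0 1 0 1, R 0 1 0 2, R 0 1 0 3, R 0 2 0 2, R 0 2 0 3, ?_⟩
  funext i j k l
  rw [key i j k l, weylForm, hp 0 1 k l, hp 0 2 k l, hp 0 3 k l, key k l 0 1, key k l 0 2,
    key k l 0 3, hp 0 2 0 1, hp 0 3 0 1, hp 0 3 0 2]
  congr 2
  rw [h1] at tr2
  rw [h2] at tr3
  linarith [h1 0 1, h2 0 2, h3 0 3]

/-- Components that depend only on how many indices equal 1 are already totally symmetric, so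
averaging over the 24 permutations changes nothing. -/
theorem weylSpinor_eq_of_sum_dependent {R : Fin 4 → Fin 4 → Fin 4 → Fin 4 → ℝ} {f : ℕ → ℂ}
    (h : ∀ A B C D : Fin 2, curvSpinor R A B C D = f (A.val + B.val + C.val + D.val))
    (A B C D : Fin 2) : weylSpinor R A B C D = f (A.val + B.val + C.val + D.val) := by
  have key : ∀ p : Equiv.Perm (Fin 4),
      curvSpinor R (![A, B, C, D] (p 0)) (![A, B, C, D] (p 1)) (![A, B, C, D] (p 2))
        (![A, B, C, D] (p 3)) = f (A.val + B.val + C.val + D.val) := by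
    intro p
    rw [h]
    congr 1
    have h1 := Equiv.sum_comp p (fun i ↦ (![A, B, C, D] i).val)
    simpa [Fin.sum_univ_four] using h1
  rw [weylSpinor, Finset.sum_congr rfl fun p _ ↦ key p]
  simp [Fintype.card_perm, Nat.factorial]

theorem spin4_mul (F G : Fin 4 → Fin 4 → ℝ) (A A' B B' C C' D D' : Fin 2) :
    spin4 (fun i j k l ↦ F i j * G k l) A A' B B' C C' D D'
      = spin2 F A A' B B' * spin2 G C C' D D' := by
  simp only [spin4, spin2, Finset.sum_mul]
  refine Finset.sum_congr rfl fun i _ ↦ Finset.sum_congr rfl fun j _ ↦ ?_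
  simp only [Finset.mul_sum]
  refine Finset.sum_congr rfl fun k _ ↦ Finset.sum_congr rfl fun l _ ↦ ?_
  push_cast
  ring

theorem curvSpinor_mul (F G : Fin 4 → Fin 4 → ℝ) (A B C D : Fin 2) :
    curvSpinor (fun i j k l ↦ F i j * G k l) A B C D
      = unprimedPart F A B * unprimedPart G C D := by
  simp only [curvSpinor, spin4_mul, unprimedPart, Fin.sum_univ_two]
  ring

theorem curvSpinor_add (R S : Fin 4 → Fin 4 → Fin 4 → Fin 4 → ℝ) (A B C D : Fin 2) :
    curvSpinor (fun i j k l ↦ R i j k l + S i j k l) A B C D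
      = curvSpinor R A B C D + curvSpinor S A B C D := by
  have h : ∀ A' B' C' D', spin4 (fun i j k l ↦ R i j k l + S i j k l) A A' B B' C C' D D'
      = spin4 R A A' B B' C C' D D' + spin4 S A A' B B' C C' D D' := by
    intro A' B' C' D'
    simp only [spin4, ← Finset.sum_add_distrib]
    refine Finset.sum_congr rfl fun i _ ↦ Finset.sum_congr rfl fun j _ ↦
      Finset.sum_congr rfl fun k _ ↦ Finset.sum_congr rfl fun l _ ↦ ?_
    push_cast
    ring
  simp only [curvSpinor, h, mul_add, Finset.sum_add_distrib]

theorem asdForm_eq (a b c : ℝ) (i j : Fin 4) :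
    asdForm a b c i j = asdForm 1 0 0 i j * a + asdForm 0 1 0 i j * b + asdForm 0 0 1 i j * c := by
  fin_cases i <;> fin_cases j <;> simp [asdForm]

theorem curvSpinor_weylForm (p q r s t : ℝ) (A B C D : Fin 2) :
    curvSpinor (weylForm p q r s t) A B C D
      = asdSpinor 1 0 0 A B * asdSpinor p q r C D + asdSpinor 0 1 0 A B * asdSpinor q s t C D
        + asdSpinor 0 0 1 A B * asdSpinor r t (-p - s) C D := by
  have h : weylForm p q r s t = fun i j k l ↦ asdForm 1 0 0 i j * asdForm p q r k l
      + asdForm 0 1 0 i j * asdForm q s t k l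
      + asdForm 0 0 1 i j * asdForm r t (-p - s) k l := by
    funext i j k l
    exact asdForm_eq _ _ _ i j
  rw [h, curvSpinor_add (fun i j k l ↦ asdForm 1 0 0 i j * asdForm p q r k l
      + asdForm 0 1 0 i j * asdForm q s t k l), curvSpinor_add]
  simp only [curvSpinor_mul, unprimedPart_asdForm]

/-- The contraction is four times the quadratic form ⟨z, Wz⟩. It translates the spinor normalisation
of Ψ into a condition on the matrix W. -/
theorem weyl_contraction (p q r s t a b c : ℝ) :
    ∑ A, ∑ B, ∑ C, ∑ D, weylSpinor (weylForm p q r s t) A B C D * raise2 (asdSpinor a b c) A B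
        * raise2 (asdSpinor a b c) C D
      = ((4 * (p * a ^ 2 + s * b ^ 2 + (-p - s) * c ^ 2 + 2 * q * a * b + 2 * r * a * c
        + 2 * t * b * c) : ℝ) : ℂ) := by
  -- The values of `f` are the five independent components Ψ₀, …, Ψ₄. Tracelessness of W is what
  -- makes the curvature spinor depend only on the index sum.
  obtain ⟨f, hf⟩ : ∃ f : ℕ → ℂ, f = fun n : ℕ ↦ if n = 0 then (s - p + 2 * q * Complex.I : ℂ) else if n = 1 then
        (r - t * Complex.I : ℂ) else if n = 2 then (p + s : ℂ) else if n = 3 then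
        (- r - t * Complex.I : ℂ) else (s - p - 2 * q * Complex.I : ℂ) := ⟨_, rfl⟩
  have h : ∀ A B C D : Fin 2, curvSpinor (weylForm p q r s t) A B C D
      = f (A.val + B.val + C.val + D.val) := by
    intro A B C D
    rw [curvSpinor_weylForm, hf]
    fin_cases A <;> fin_cases B <;> fin_cases C <;> fin_cases D <;>
      simp [asdSpinor] <;> (try ring_nf) <;> simp <;> (try ring_nf)
  simp only [weylSpinor_eq_of_sum_dependent h]
  simp [raise2, eps, asdSpinor, hf]
  ring_nf
  simp
  ring_nf

end SpinorAlgebra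

/-! ### Connection forms, half-flat curvature and ∇σ in a frame -/

section Frames

variable {M : Type*} [TopologicalSpace M] [ChartedSpace E4 M] [IsManifold 𝓘(ℝ, E4) ∞ M]
  [RiemannianBundle (fun x : M ↦ TangentSpace 𝓘(ℝ, E4) x)]
  [IsContMDiffRiemannianBundle 𝓘(ℝ, E4) ∞ E4 (fun x : M ↦ TangentSpace 𝓘(ℝ, E4) x)]
  {o : ∀ x : M, Orientation ℝ (TangentSpace 𝓘(ℝ, E4) x) (Fin 4)} {nab : Connection M} {x : M}

/-- Vector fields that form a smooth oriented orthonormal frame near `x`. -/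
def IsLocalFrame (o : ∀ x : M, Orientation ℝ (TangentSpace 𝓘(ℝ, E4) x) (Fin 4))
    (E : Fin 4 → VField M) (x : M) : Prop :=
  ∀ᶠ y in 𝓝 x, (∀ i, SmoothVAt (E i) y) ∧ ∃ e : OFrame o y, ∀ i, e.basis i = E i y

/-- The connection form of a frame. -/
def connForm (nab : Connection M) (E : Fin 4 → VField M) (x : M) (u : TangentSpace 𝓘(ℝ, E4) x)
    (i j : Fin 4) : ℝ := inner ℝ (nab (E i) x u) (E j x)

theorem OFrame.sum_inner_smul (e : OFrame o x) (v : TangentSpace 𝓘(ℝ, E4) x) :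
    ∑ m, (inner ℝ v (e.basis m) : ℝ) • e.basis m = v := by
  have h := e.basis.sum_repr' v
  simpa only [real_inner_comm] using h

theorem OFrame.inner_basis (e : OFrame o x) (i j : Fin 4) :
    (inner ℝ (e.basis i) (e.basis j) : ℝ) = if i = j then 1 else 0 :=
  orthonormal_iff_ite.1 e.basis.orthonormal i j

namespace IsLocalFrame

variable {E : Fin 4 → VField M} (hE : IsLocalFrame o E x)
include hE

theorem smoothVAt (i : Fin 4) : SmoothVAt (E i) x := hE.self_of_nhds.1 i

theorem eventually_smoothVAt (i : Fin 4) : ∀ᶠ y in 𝓝 x, SmoothVAt (E i) y :=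
  hE.mono fun _ h ↦ h.1 i

theorem nab_eq_sum (i : Fin 4) (u : TangentSpace 𝓘(ℝ, E4) x) :
    nab (E i) x u = ∑ m, connForm nab E x u i m • E m x := by
  obtain ⟨e, he⟩ := hE.self_of_nhds.2
  simp only [connForm, ← he]
  exact (e.sum_inner_smul _).symm

theorem connForm_antisymm (hnab : IsLeviCivita nab) (u : TangentSpace 𝓘(ℝ, E4) x) (i j : Fin 4) :
    connForm nab E x u i j = - connForm nab E x u j i := by
  have h := der_inner hnab (hE.smoothVAt i) (hE.smoothVAt j) u
  have h1 : ∀ᶠ y in 𝓝 x, (inner ℝ (E i y) (E j y) : ℝ) = if i = j then 1 else 0 := by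
    filter_upwards [hE] with y hy
    obtain ⟨-, e, he⟩ := hy
    rw [← he, ← he, e.inner_basis]
  rw [der_congr u h1, der_const, real_inner_comm] at h
  have h2 : (inner ℝ (E i x) (nab (E j) x u) : ℝ) = connForm nab E x u j i := real_inner_comm _ _
  have h3 : (inner ℝ (nab (E i) x u) (E j x) : ℝ) = connForm nab E x u i j := rfl
  rw [real_inner_comm, h2, h3] at h
  linarith

theorem der_apply {T : Tensor2 M} (hT : SmoothT T) (u : TangentSpace 𝓘(ℝ, E4) x) (i j : Fin 4) :
    der (fun y ↦ T y (E i y) (E j y)) x u = covT nab T x u (E i x) (E j x)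
      + ∑ m, connForm nab E x u i m * T x (E m x) (E j x)
      + ∑ m, connForm nab E x u j m * T x (E i x) (E m x) := by
  rw [der_apply_eq_covT u nab hT (hE.smoothVAt i) (hE.smoothVAt j), hE.nab_eq_sum, hE.nab_eq_sum]
  simp only [map_sum, map_smul, LinearMap.sum_apply, LinearMap.smul_apply, smul_eq_mul]

end IsLocalFrame

theorem OFrame.volumeForm_apply (e : OFrame o x) (f : Fin 4 → Fin 4) :
    (o x).volumeForm (fun i ↦ e.basis (f i))
      = (Matrix.of fun i j ↦ if i = f j then (1 : ℝ) else 0).det := by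
  rw [(o x).volumeForm_robust e.basis e.oriented, Module.Basis.det_apply]
  congr 1
  ext i j
  simp [Module.Basis.toMatrix_apply]

/-- The Levi-Civita symbol with first index zero. -/
def leviCivitaZero (j m n : Fin 4) : ℤ :=
  if (j, m, n) ∈ [((1, 2, 3) : Fin 4 × Fin 4 × Fin 4), (2, 3, 1), (3, 1, 2)] then 1
  else if (j, m, n) ∈ [((1, 3, 2) : Fin 4 × Fin 4 × Fin 4), (2, 1, 3), (3, 2, 1)] then -1 else 0

theorem det_eq_leviCivitaZero : ∀ j m n : Fin 4,
    (Matrix.of fun a b ↦ if a = ![0, j, m, n] b then (1 : ℤ) else 0).det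
      = leviCivitaZero j m n := by
  decide +kernel

theorem OFrame.volumeForm_zero (e : OFrame o x) (j m n : Fin 4) :
    (o x).volumeForm ![e.basis 0, e.basis j, e.basis m, e.basis n] = leviCivitaZero j m n := by
  have h : ![e.basis 0, e.basis j, e.basis m, e.basis n] = fun a ↦ e.basis (![0, j, m, n] a) := by
    funext a
    fin_cases a <;> rfl
  rw [h, e.volumeForm_apply, ← det_eq_leviCivitaZero, Int.cast_det]
  congr 1
  ext a b
  simp

/-- The duality equations with first index 0 already contain the three linear relations of
anti-self-duality, so only ε_0jmn has to be evaluated. -/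
theorem riem_eq_weylForm (hnab : IsLeviCivita nab) (hHK : IsHyperKahler nab o) (e : OFrame o x) :
    ∃ p q r s t, e.comp4 (riem nab x) = weylForm p q r s t := by
  have hl : ∀ i j k l, e.comp4 (riem nab x) i j k l = - e.comp4 (riem nab x) j i k l :=
    fun i j k l ↦ riem_swap_left _ _ _ _
  have h : ∀ j k l, (1 / 2 : ℝ) * ∑ m, ∑ n, (leviCivitaZero j m n : ℝ)
        * e.comp4 (riem nab x) m n k l = - e.comp4 (riem nab x) 0 j k l := by
    intro j k l
    rw [OFrame.comp4, ← hHK x e 0 j k l]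
    simp only [e.volumeForm_zero, OFrame.comp4]
  refine exists_weylForm hl (fun i j k l ↦ riem_swap_right hnab _ _ _ _)
    (fun i j k l ↦ riem_cyclic hnab _ _ _ _) (fun k l ↦ ?_) (fun k l ↦ ?_) fun k l ↦ ?_
  · have h1 := h 1 k l
    have h2 := hl 3 2 k l
    simp [Fin.sum_univ_four, leviCivitaZero] at h1
    linarith
  · have h1 := h 2 k l
    have h2 := hl 3 1 k l
    simp [Fin.sum_univ_four, leviCivitaZero] at h1
    linarith
  · have h1 := h 3 k l
    have h2 := hl 2 1 k l
    simp [Fin.sum_univ_four, leviCivitaZero] at h1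
    linarith

theorem IsSymSpinor.comp2_eq {σ : Tensor2 M} (hσ : IsSymSpinor o σ) (e : OFrame o x) :
    e.comp2 (fun u v ↦ σ x u v) = asdForm (σ x (e.basis 0) (e.basis 1))
      (σ x (e.basis 0) (e.basis 2)) (σ x (e.basis 0) (e.basis 3)) :=
  exists_asdForm_of_spin2 (hσ.symm x e 0 1) (hσ.form x e)

/-- Infinitesimal rotations preserve anti-self-dual forms, so subtracting the connection terms from
the derivative of such a form stays in that space. -/
theorem eq_asdForm_of_covariant_derivative {θ f : Fin 4 → Fin 4 → ℝ} {a b c a' b' c' : ℝ}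
    (hθ : ∀ i j, θ i j = - θ j i)
    (hf : ∀ i j, asdForm a' b' c' i j = f i j + ∑ m, θ i m * asdForm a b c m j
      + ∑ m, θ j m * asdForm a b c i m) : f = asdForm (f 0 1) (f 0 2) (f 0 3) := by
  have hf' : ∀ i j, f i j = asdForm a' b' c' i j - ∑ m, θ i m * asdForm a b c m j
      - ∑ m, θ j m * asdForm a b c i m := fun i j ↦ by linarith [hf i j]
  have e0 := hθ 0 0
  have e1 := hθ 1 1
  have e2 := hθ 2 2
  have e3 := hθ 3 3
  have e4 := hθ 1 0
  have e5 := hθ 2 0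
  have e6 := hθ 3 0
  have e7 := hθ 2 1
  have e8 := hθ 3 1
  have e9 := hθ 3 2
  have z0 : θ 0 0 = 0 := by linarith
  have z1 : θ 1 1 = 0 := by linarith
  have z2 : θ 2 2 = 0 := by linarith
  have z3 : θ 3 3 = 0 := by linarith
  refine eq_asdForm (fun i j ↦ ?_) ?_ ?_ ?_
  · fin_cases i <;> fin_cases j <;>
      simp [hf', Fin.sum_univ_four, asdForm, e4, e5, e6, e7, e8, e9, z0, z1, z2, z3] <;> ring
  all_goals
    simp [hf', Fin.sum_univ_four, asdForm, e4, e5, e6, e7, e8, e9, z0, z1, z2, z3]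
    ring

/-- The Killing spinor equation constrains only the unprimed part of ∇σ. That there is no other part
follows because the connection preserves anti-self-duality. -/
theorem IsSymSpinor.comp3_covT_eq {σ : Tensor2 M} (hσ : IsSymSpinor o σ) (ho : IsOrientation o)
    (hnab : IsLeviCivita nab) {ξ : VField M} (hKS : IsKillingSpinor nab o σ ξ) (e : OFrame o x) :
    e.comp3 (covT nab σ x) = ksForm (e.comp1 (ξ x)) := by
  obtain ⟨E, hEx, hE⟩ := exists_smooth_oFrame ho e
  have hE : IsLocalFrame o E x := hE
  refine eq_ksForm (p := fun k ↦ e.comp3 (covT nab σ x) k 0 1)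
    (q := fun k ↦ e.comp3 (covT nab σ x) k 0 2) (r := fun k ↦ e.comp3 (covT nab σ x) k 0 3)
    (fun k ↦ ?_) (hKS x e)
  have hs : ∀ i j, SmoothFAt (fun y ↦ σ y (E i y) (E j y)) x :=
    fun i j ↦ hσ.smooth x _ _ (hE.smoothVAt i) (hE.smoothVAt j)
  have hev : ∀ i j, ∀ᶠ y in 𝓝 x, σ y (E i y) (E j y)
      = asdForm 1 0 0 i j * σ y (E 0 y) (E 1 y) + asdForm 0 1 0 i j * σ y (E 0 y) (E 2 y)
        + asdForm 0 0 1 i j * σ y (E 0 y) (E 3 y) := by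
    intro i j
    filter_upwards [hE] with y hy
    obtain ⟨-, e', he'⟩ := hy
    have h := congrFun (congrFun (hσ.comp2_eq e') i) j
    rw [asdForm_eq] at h
    simpa only [OFrame.comp2, he'] using h
  have hc : ∀ c : ℝ, SmoothFAt (fun _ : M ↦ c) x := fun c ↦ contMDiffAt_const
  refine eq_asdForm_of_covariant_derivative
    (hE.connForm_antisymm hnab (e.basis k)) (a := σ x (e.basis 0) (e.basis 1))
    (b := σ x (e.basis 0) (e.basis 2)) (c := σ x (e.basis 0) (e.basis 3))
    (a' := der (fun y ↦ σ y (E 0 y) (E 1 y)) x (e.basis k))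
    (b' := der (fun y ↦ σ y (E 0 y) (E 2 y)) x (e.basis k))
    (c' := der (fun y ↦ σ y (E 0 y) (E 3 y)) x (e.basis k)) fun i j ↦ ?_
  have h := hE.der_apply (nab := nab) hσ.smooth (e.basis k) i j
  rw [der_congr _ (hev i j), der_add _ (((hc _).mul (hs 0 1)).add ((hc _).mul (hs 0 2)))
    ((hc _).mul (hs 0 3)), der_add _ ((hc _).mul (hs 0 1)) ((hc _).mul (hs 0 2)),
    der_const_mul _ _ (hs 0 1), der_const_mul _ _ (hs 0 2), der_const_mul _ _ (hs 0 3),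
    ← asdForm_eq] at h
  rw [h, ← hσ.comp2_eq e]
  simp only [OFrame.comp2, OFrame.comp3, hEx]

end Frames

/-! ### Integrability condition of the Killing spinor equation -/

theorem ksForm_eq_sum (v : Fin 4 → ℝ) (k i j : Fin 4) :
    ksForm v k i j = ∑ l, ksForm (Pi.single l 1) k i j * v l := by
  fin_cases k <;> simp [ksForm, Fin.sum_univ_four] <;> fin_cases i <;> fin_cases j <;>
    simp [asdForm]

theorem ksForm_add (v w : Fin 4 → ℝ) (k i j : Fin 4) :
    ksForm (fun l ↦ v l + w l) k i j = ksForm v k i j + ksForm w k i j := by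
  rw [ksForm_eq_sum, ksForm_eq_sum v, ksForm_eq_sum w, ← Finset.sum_add_distrib]
  exact Finset.sum_congr rfl fun l _ ↦ mul_add _ _ _

set_option maxHeartbeats 2000000 in
-- Infinitesimal SO(4)-equivariance of v ↦ (e_k ∧ v)⁻. It makes the connection terms cancel, so that
-- differentiating ∇σ = `ksForm` ξ covariantly only replaces ξ by ∇ξ.
theorem ksForm_invariant {θ : Fin 4 → Fin 4 → ℝ} (hθ : ∀ i j, θ i j = - θ j i) (v : Fin 4 → ℝ)
    (k i j : Fin 4) :
    ksForm (fun l ↦ ∑ m, θ l m * v m) k i j = ∑ m, θ k m * ksForm v m i j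
      + ∑ m, θ i m * ksForm v k m j + ∑ m, θ j m * ksForm v k i m := by
  have e0 := hθ 0 0
  have e1 := hθ 1 1
  have e2 := hθ 2 2
  have e3 := hθ 3 3
  have e4 := hθ 1 0
  have e5 := hθ 2 0
  have e6 := hθ 3 0
  have e7 := hθ 2 1
  have e8 := hθ 3 1
  have e9 := hθ 3 2
  have z0 : θ 0 0 = 0 := by linarith
  have z1 : θ 1 1 = 0 := by linarith
  have z2 : θ 2 2 = 0 := by linarith
  have z3 : θ 3 3 = 0 := by linarith
  fin_cases k <;> fin_cases i <;> fin_cases j <;>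
    simp [ksForm, asdForm, Fin.sum_univ_four, z0, z1, z2, z3, e4, e5, e6, e7, e8, e9] <;> ring

/-- Here `n` stands for ∇ξ and z = (a, b, c) for σ. The conclusions are: ξ is Killing, twice the
anti-self-dual part of ∇ξ is Wz, and z × Wz = 0. -/
theorem ricci_algebra {n : Fin 4 → Fin 4 → ℝ} {a b c p q r s t : ℝ}
    (h : ∀ P k i j, ksForm (n P) k i j - ksForm (n k) P i j
      = - ∑ m, (weylForm p q r s t P k i m * asdForm a b c m j
        + weylForm p q r s t P k j m * asdForm a b c i m)) :
    (∀ i j, n i j = - n j i) ∧ n 0 1 - n 2 3 = p * a + q * b + r * c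
      ∧ n 0 2 + n 1 3 = q * a + s * b + t * c ∧ n 0 3 - n 1 2 = r * a + t * b + (-p - s) * c
      ∧ b * (r * a + t * b + (-p - s) * c) = c * (q * a + s * b + t * c)
      ∧ c * (p * a + q * b + r * c) = a * (r * a + t * b + (-p - s) * c)
      ∧ a * (q * a + s * b + t * c) = b * (p * a + q * b + r * c) := by
  have h1 := h 0 1 0 1
  have h2 := h 0 1 0 2
  have h3 := h 0 1 0 3
  have h4 := h 0 2 0 1
  have h5 := h 0 2 0 2
  have h6 := h 0 2 0 3
  have h7 := h 0 3 0 1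
  have h8 := h 0 3 0 2
  have h9 := h 0 3 0 3
  have h10 := h 1 2 0 1
  have h11 := h 1 2 0 2
  have h12 := h 1 2 0 3
  have h13 := h 1 3 0 1
  have h14 := h 1 3 0 2
  have h15 := h 1 3 0 3
  have h16 := h 2 3 0 1
  have h17 := h 2 3 0 2
  have h18 := h 2 3 0 3
  clear h
  simp [ksForm, asdForm, weylForm, Fin.sum_univ_four] at h1 h2 h3 h4 h5 h6 h7 h8 h9 h10 h11 h12 h13 h14 h15 h16 h17 h18
  -- The five relations `c1`, …, `c5` say that W commutes with the infinitesimal rotation about z,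
  -- the real form of Ψ_E(ABC σ_D)^E = 0. Applied to z, this yields z × Wz = 0.
  have c1 : r * a - p * c - t * b + s * c = 0 := by linarith
  have c2 : q * a - 2 * (p * b) - t * c - s * b = 0 := by linarith
  have c3 : r * b = q * c := by linarith
  have c4 : r * b = t * a := by linarith
  have c5 : q * b - r * c - p * a - 2 * (s * a) = 0 := by linarith
  refine ⟨fun i j ↦ ?_, by linarith, by linarith, by linarith, ?_, ?_, ?_⟩
  · fin_cases i <;> fin_cases j <;> simp <;> linarith
  · linear_combination 2 * a * c3 - b * c1 + c * c2
  · linear_combination -c * c5 - a * c1 + 2 * b * c4 - 2 * b * c3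
  · linear_combination a * c2 - b * c5 - 2 * c * c4

section KillingSpinor

variable {M : Type*} [TopologicalSpace M] [ChartedSpace E4 M] [IsManifold 𝓘(ℝ, E4) ∞ M]
  [RiemannianBundle (fun x : M ↦ TangentSpace 𝓘(ℝ, E4) x)]
  [IsContMDiffRiemannianBundle 𝓘(ℝ, E4) ∞ E4 (fun x : M ↦ TangentSpace 𝓘(ℝ, E4) x)]
  {o : ∀ x : M, Orientation ℝ (TangentSpace 𝓘(ℝ, E4) x) (Fin 4)} {nab : Connection M} {x : M}

/-- This is the Ricci identity for σ with ∇σ = `ksForm` ξ inserted on the left. -/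
theorem killing_spinor_ricci (ho : IsOrientation o) (hnab : IsLeviCivita nab)
    {σ : Tensor2 M} (hσ : IsSymSpinor o σ) {ξ : VField M} (hξ : ∀ x, SmoothVAt ξ x)
    (hKS : IsKillingSpinor nab o σ ξ) (e : OFrame o x) (p k i j : Fin 4) :
    ksForm (e.comp2 (covV nab ξ x) p) k i j - ksForm (e.comp2 (covV nab ξ x) k) p i j
      = - ∑ m, (e.comp4 (riem nab x) p k i m * e.comp2 (fun u v ↦ σ x u v) m j
        + e.comp4 (riem nab x) p k j m * e.comp2 (fun u v ↦ σ x u v) i m) := by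
  obtain ⟨E, hEx, hE⟩ := exists_smooth_oFrame ho e
  have hE : IsLocalFrame o E x := hE
  have hs : ∀ l, SmoothFAt (fun y ↦ (inner ℝ (ξ y) (E l y) : ℝ)) x :=
    fun l ↦ (hξ x).inner (hE.smoothVAt l)
  have hc : ∀ c : ℝ, SmoothFAt (fun _ : M ↦ c) x := fun c ↦ contMDiffAt_const
  have hcov : ∀ k i j, covT nab σ x (E k x) (E i x) (E j x)
      = ksForm (fun l ↦ inner ℝ (ξ x) (E l x)) k i j := by
    intro k i j
    have h := congrFun (congrFun (congrFun (hσ.comp3_covT_eq ho hnab hKS e) k) i) j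
    have h1 : e.comp1 (ξ x) = fun l ↦ inner ℝ (ξ x) (E l x) := by
      funext l
      rw [OFrame.comp1, hEx]
    rw [h1] at h
    simpa only [OFrame.comp3, ← hEx] using h
  have hder : ∀ u l, der (fun y ↦ (inner ℝ (ξ y) (E l y) : ℝ)) x u
      = inner ℝ (nab ξ x u) (E l x)
        + ∑ m, connForm nab E x u l m * inner ℝ (ξ x) (E m x) := by
    intro u l
    rw [der_inner hnab (hξ x) (hE.smoothVAt l), hE.nab_eq_sum, inner_sum]
    simp only [real_inner_smul_right]
  have key : ∀ p k, der (fun y ↦ covT nab σ y (E k y) (E i y) (E j y)) x (E p x)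
        - covT nab σ x (nab (E k) x (E p x)) (E i x) (E j x)
        - covT nab σ x (E k x) (nab (E i) x (E p x)) (E j x)
        - covT nab σ x (E k x) (E i x) (nab (E j) x (E p x))
      = ksForm (fun l ↦ inner ℝ (nab ξ x (E p x)) (E l x)) k i j := by
    intro p k
    -- With constant coefficients in front of the components of ξ, only those components have to be
    -- differentiated.
    have hev : ∀ᶠ y in 𝓝 x, covT nab σ y (E k y) (E i y) (E j y)
        = ∑ l, ksForm (Pi.single l 1) k i j * inner ℝ (ξ y) (E l y) := by
      filter_upwards [hE] with y hy
      obtain ⟨-, e', he'⟩ := hy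
      have h := congrFun (congrFun (congrFun (hσ.comp3_covT_eq ho hnab hKS e') k) i) j
      rw [ksForm_eq_sum] at h
      simpa only [OFrame.comp3, OFrame.comp1, he'] using h
    have hinv := ksForm_invariant (hE.connForm_antisymm hnab (E p x))
      (fun l ↦ inner ℝ (ξ x) (E l x)) k i j
    have hl := covL_apply (E p x) nab hσ.smooth
    rw [der_congr _ hev, der_sum _ fun l _ ↦ (hc _).mul (hs l)]
    simp only [der_const_mul _ _ (hs _)]
    rw [← ksForm_eq_sum (fun l ↦ der (fun y ↦ (inner ℝ (ξ y) (E l y) : ℝ)) x (E p x))]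
    simp only [hder]
    rw [ksForm_add, hinv]
    simp only [← covL_apply _ nab hσ.smooth, hE.nab_eq_sum, map_sum, map_smul,
      LinearMap.sum_apply, LinearMap.smul_apply, smul_eq_mul]
    simp only [covL_apply, hcov]
    ring
  have h := ricci_identity hnab hσ.smooth (hE.eventually_smoothVAt p) (hE.eventually_smoothVAt k)
    (hE.eventually_smoothVAt i) (hE.eventually_smoothVAt j)
  rw [key p k, key k p] at h
  simp only [hEx] at h
  have hR : ∀ i, curv nab x (e.basis p) (e.basis k) (e.basis i)
      = ∑ m, e.comp4 (riem nab x) p k i m • e.basis m := fun i ↦ (e.sum_inner_smul _).symm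
  rw [hR, hR] at h
  simp only [map_sum, map_smul, LinearMap.sum_apply, LinearMap.smul_apply, smul_eq_mul] at h
  have h' : ksForm (e.comp2 (covV nab ξ x) p) k i j - ksForm (e.comp2 (covV nab ξ x) k) p i j
      = -∑ m, e.comp4 (riem nab x) p k i m * σ x (e.basis m) (e.basis j)
        - ∑ m, e.comp4 (riem nab x) p k j m * σ x (e.basis i) (e.basis m) := h
  rw [h', Finset.sum_add_distrib]
  simp only [OFrame.comp2]
  ring

end KillingSpinor

/-- The quaternion relation: the symmetrised product of two anti-self-dual forms is a multiple of
the metric. -/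
theorem asdForm_mul_symm (a b c a' b' c' : ℝ) (i j : Fin 4) :
    ∑ m, (asdForm a b c i m * asdForm a' b' c' j m + asdForm a b c j m * asdForm a' b' c' i m)
      = if i = j then 2 * (a * a' + b * b' + c * c') else 0 := by
  fin_cases i <;> fin_cases j <;> simp [asdForm, Fin.sum_univ_four] <;> ring

/-! ### The 1-jet of σ and ξ in a frame -/

section FrameData

variable {M : Type*} [TopologicalSpace M] [ChartedSpace E4 M] [IsManifold 𝓘(ℝ, E4) ∞ M]
  [RiemannianBundle (fun x : M ↦ TangentSpace 𝓘(ℝ, E4) x)]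
  [IsContMDiffRiemannianBundle 𝓘(ℝ, E4) ∞ E4 (fun x : M ↦ TangentSpace 𝓘(ℝ, E4) x)]
  {o : ∀ x : M, Orientation ℝ (TangentSpace 𝓘(ℝ, E4) x) (Fin 4)} {nab : Connection M} {x : M}
  {σ : Tensor2 M} {ξ : VField M} {Ω : M → ℝ}

theorem OFrame.eq_of_basis (e : OFrame o x)
    {S T : TangentSpace 𝓘(ℝ, E4) x →ₗ[ℝ] TangentSpace 𝓘(ℝ, E4) x →ₗ[ℝ] ℝ}
    (h : ∀ i j, S (e.basis i) (e.basis j) = T (e.basis i) (e.basis j)) : S = T := by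
  refine e.basis.toBasis.ext fun i ↦ e.basis.toBasis.ext fun j ↦ ?_
  simpa using h i j

theorem killing_spinor_ricci_frame (ho : IsOrientation o) (hnab : IsLeviCivita nab)
    (hσ : IsSymSpinor o σ) (hξ : ∀ x, SmoothVAt ξ x) (hKS : IsKillingSpinor nab o σ ξ)
    (e : OFrame o x) {a b c p q r s t : ℝ} (hz : e.comp2 (fun u v ↦ σ x u v) = asdForm a b c)
    (hR : e.comp4 (riem nab x) = weylForm p q r s t) :
    (∀ i j, e.comp2 (covV nab ξ x) i j = - e.comp2 (covV nab ξ x) j i)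
      ∧ e.comp2 (covV nab ξ x) 0 1 - e.comp2 (covV nab ξ x) 2 3 = p * a + q * b + r * c
      ∧ e.comp2 (covV nab ξ x) 0 2 + e.comp2 (covV nab ξ x) 1 3 = q * a + s * b + t * c
      ∧ e.comp2 (covV nab ξ x) 0 3 - e.comp2 (covV nab ξ x) 1 2 = r * a + t * b + (-p - s) * c
      ∧ b * (r * a + t * b + (-p - s) * c) = c * (q * a + s * b + t * c)
      ∧ c * (p * a + q * b + r * c) = a * (r * a + t * b + (-p - s) * c)
      ∧ a * (q * a + s * b + t * c) = b * (p * a + q * b + r * c) := by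
  refine ricci_algebra fun P k i j ↦ ?_
  rw [killing_spinor_ricci ho hnab hσ hξ hKS e, hz, hR]

theorem isKillingVector_of_isKillingSpinor (ho : IsOrientation o) (hnab : IsLeviCivita nab)
    (hHK : IsHyperKahler nab o) (hσ : IsSymSpinor o σ) (hξ : ∀ x, SmoothVAt ξ x)
    (hKS : IsKillingSpinor nab o σ ξ) : IsKillingVector nab ξ := by
  intro x u v
  obtain ⟨e⟩ := exists_oFrame o x
  obtain ⟨p, q, r, s, t, hR⟩ := riem_eq_weylForm hnab hHK e
  have h := (killing_spinor_ricci_frame ho hnab hσ hξ hKS e (hσ.comp2_eq e) hR).1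
  have h1 : gradT nab ξ x = - (gradT nab ξ x).flip := e.eq_of_basis h
  have h2 := congrArg (fun B ↦ B u v) h1
  have h3 : covV nab ξ x u v = - covV nab ξ x v u := h2
  rw [h3, neg_add_cancel]

/-- The Killing identity. The three cyclic instances of the Ricci identity for ξ, antisymmetry of ∇ξ
and the first Bianchi identity determine ∇∇ξ. -/
theorem covT_gradT_of_isKillingVector (hnab : IsLeviCivita nab) (hξ : ∀ x, SmoothVAt ξ x)
    (hK : IsKillingVector nab ξ) (u v w : TangentSpace 𝓘(ℝ, E4) x) :
    covT nab (gradT nab ξ) x u v w = riem nab x v w u (ξ x) := by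
  have ha : ∀ u v w : TangentSpace 𝓘(ℝ, E4) x,
      covT nab (gradT nab ξ) x u v w = - covT nab (gradT nab ξ) x u w v := by
    intro u v w
    have hN : ∀ (y : M) (v w : TangentSpace 𝓘(ℝ, E4) y),
        gradT nab ξ y v w = -1 * gradT nab ξ y w v := by
      intro y v w
      have := hK y v w
      simp only [covV] at this
      simp only [gradT_apply]
      linarith
    have hs := smoothT_gradT hnab hξ x _ _ (smoothVAt_ext w) (smoothVAt_ext v)
    rw [covT, covT, hN x _ w, hN x v]
    simp only [hN _ (ext v _) (ext w _)]
    have h := der_const_mul u (-1) hs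
    rw [show mvfderiv 𝓘(ℝ, E4) (fun y ↦ -1 * gradT nab ξ y (ext w y) (ext v y)) x u = _ from h]
    simp only [der]
    ring
  have h1 := covT_gradT_sub hnab hξ u v w
  have h2 := covT_gradT_sub hnab hξ v w u
  have h3 := covT_gradT_sub hnab hξ w u v
  have hc := riem_cyclic hnab u v w (ξ x)
  have s1 := riem_swap_right hnab u v (ξ x) w
  have s2 := riem_swap_right hnab v w (ξ x) u
  have s3 := riem_swap_right hnab w u (ξ x) v
  linarith [ha u v w, ha v u w, ha v w u, ha w u v, ha w v u, ha u w v]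

/-- The 1-jet of a Killing spinor and of its vector field in an orthonormal frame. -/
structure FrameData (nab : Connection M) (σ : Tensor2 M) (ξ : VField M) (Ω : M → ℝ)
    (e : OFrame o x) (a b c α β γ h : ℝ) : Prop where
  norm : Ω x ^ 2 * (a ^ 2 + b ^ 2 + c ^ 2) = 1
  sigma : e.comp2 (fun u v ↦ σ x u v) = asdForm a b c
  grad : ∀ i j, e.comp2 (covV nab ξ x) i j = h * asdForm a b c i j + sdForm α β γ i j
  covSigma : e.comp3 (covT nab σ x) = ksForm (e.comp1 (ξ x))
  covGrad : ∀ k i j, ∑ m, (asdForm a b c i m * e.comp3 (covT nab (gradT nab ξ) x) k j m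
      + asdForm a b c j m * e.comp3 (covT nab (gradT nab ξ) x) k i m)
    = if i = j then 4 * h * ∑ m, asdForm a b c k m * e.comp1 (ξ x) m else 0
  weyl : ∑ A, ∑ B, ∑ C, ∑ D, e.Psi nab A B C D * raise2 (e.sigma σ) A B
      * raise2 (e.sigma σ) C D = ((8 * h * (a ^ 2 + b ^ 2 + c ^ 2) : ℝ) : ℂ)

theorem exists_frameData (ho : IsOrientation o) (hnab : IsLeviCivita nab)
    (hHK : IsHyperKahler nab o) (hσ : IsSymSpinor o σ) (hξ : ∀ x, SmoothVAt ξ x)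
    (hKS : IsKillingSpinor nab o σ ξ) (hΩ : IsConformalFactor o σ Ω) (e : OFrame o x) :
    ∃ a b c α β γ h, FrameData nab σ ξ Ω e a b c α β γ h := by
  obtain ⟨a, b, c, hz⟩ : ∃ a b c, e.comp2 (fun u v ↦ σ x u v) = asdForm a b c :=
    ⟨_, _, _, hσ.comp2_eq e⟩
  obtain ⟨p, q, r, s, t, hR⟩ := riem_eq_weylForm hnab hHK e
  obtain ⟨h0, h1, h2, h3, h4, h5, h6⟩ := killing_spinor_ricci_frame ho hnab hσ hξ hKS e hz hR
  have hsig : e.sigma σ = asdSpinor a b c := by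
    rw [OFrame.sigma, hz, unprimedPart_asdForm]
  have hn : Ω x ^ 2 * (a ^ 2 + b ^ 2 + c ^ 2) = 1 := by
    have h := hΩ.eq x e
    rw [hsig, half_sum_mul_raise2_asdSpinor] at h
    have h' := Complex.ofReal_injective h
    rw [← h']
    have := hΩ.ne_zero x
    field_simp
  have hz0 : a ^ 2 + b ^ 2 + c ^ 2 ≠ 0 := right_ne_zero_of_mul_eq_one hn
  -- Since z × Wz = 0 and z ≠ 0, z is an eigenvector of W. Its eigenvalue is called 2h, because the
  -- anti-self-dual part of ∇ξ is Wz/2; so h is half the Rayleigh quotient.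
  set h := (a * (p * a + q * b + r * c) + b * (q * a + s * b + t * c)
    + c * (r * a + t * b + (-p - s) * c)) / (2 * (a ^ 2 + b ^ 2 + c ^ 2)) with hh
  have w1 : p * a + q * b + r * c = 2 * h * a := by
    rw [hh]
    field_simp
    linear_combination -b * h6 + c * h5
  have w2 : q * a + s * b + t * c = 2 * h * b := by
    rw [hh]
    field_simp
    linear_combination a * h6 - c * h4
  have w3 : r * a + t * b + (-p - s) * c = 2 * h * c := by
    rw [hh]
    field_simp
    linear_combination b * h4 - a * h5
  refine ⟨a, b, c, (e.comp2 (covV nab ξ x) 0 1 + e.comp2 (covV nab ξ x) 2 3) / 2,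
    (e.comp2 (covV nab ξ x) 0 2 - e.comp2 (covV nab ξ x) 1 3) / 2,
    (e.comp2 (covV nab ξ x) 0 3 + e.comp2 (covV nab ξ x) 1 2) / 2, h, hn, hz, ?_,
    hσ.comp3_covT_eq ho hnab hKS e, ?_, ?_⟩
  · have e0 := h0 0 0
    have e1 := h0 1 1
    have e2 := h0 2 2
    have e3 := h0 3 3
    have e4 := h0 1 0
    have e5 := h0 2 0
    have e6 := h0 3 0
    have e7 := h0 2 1
    have e8 := h0 3 1
    have e9 := h0 3 2
    intro i j
    fin_cases i <;> fin_cases j <;> simp [asdForm, sdForm] <;> linarith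
  -- By the Killing identity ∇_k∇ξ is the anti-self-dual form obtained by applying W to the
  -- curvature slot. Symmetrised multiplication by z leaves only an inner product with z, where Wz =
  -- 2h z applies.
  · have hM : ∀ k i j, e.comp3 (covT nab (gradT nab ξ) x) k i j
        = asdForm (∑ l, asdForm p q r k l * e.comp1 (ξ x) l)
          (∑ l, asdForm q s t k l * e.comp1 (ξ x) l)
          (∑ l, asdForm r t (-p - s) k l * e.comp1 (ξ x) l) i j := by
      intro k i j
      have hK := isKillingVector_of_isKillingSpinor ho hnab hHK hσ hξ hKS
      have h7 : e.comp3 (covT nab (gradT nab ξ) x) k i j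
          = ∑ l, e.comp4 (riem nab x) i j k l * e.comp1 (ξ x) l := by
        rw [OFrame.comp3, covT_gradT_of_isKillingVector hnab hξ hK, riem,
          ← e.sum_inner_smul (ξ x), inner_sum]
        refine Finset.sum_congr rfl fun l _ ↦ ?_
        rw [real_inner_smul_right, e.sum_inner_smul]
        exact mul_comm _ _
      rw [h7, hR, asdForm_eq, Finset.mul_sum, Finset.mul_sum, Finset.mul_sum,
        ← Finset.sum_add_distrib, ← Finset.sum_add_distrib]
      refine Finset.sum_congr rfl fun l _ ↦ ?_
      rw [weylForm, asdForm_eq]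
      ring
    intro k i j
    simp only [hM]
    rw [asdForm_mul_symm]
    congr 1
    rw [Finset.mul_sum, Finset.mul_sum, Finset.mul_sum, ← Finset.sum_add_distrib,
      ← Finset.sum_add_distrib, Finset.mul_sum, Finset.mul_sum]
    refine Finset.sum_congr rfl fun l _ ↦ ?_
    rw [asdForm_eq p, asdForm_eq q, asdForm_eq r, asdForm_eq a]
    linear_combination 2 * e.comp1 (ξ x) l * (asdForm 1 0 0 k l * w1 + asdForm 0 1 0 k l * w2
      + asdForm 0 0 1 k l * w3)
  · rw [hsig]
    simp only [OFrame.Psi, hR]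
    rw [weyl_contraction]
    congr 1
    linear_combination 4 * a * w1 + 4 * b * w2 + 4 * c * w3

end FrameData

/-! ### Contractions, their derivatives, and the value of h -/

section Global

variable {M : Type*} [TopologicalSpace M] [ChartedSpace E4 M] [IsManifold 𝓘(ℝ, E4) ∞ M]

/-- In a chart, the level set through `x` of a function with zero derivative is open; no convexity
of the chart target is required. -/
theorem isLocallyConstant_of_der_eq_zero {f : M → ℝ} (hf : ∀ x, SmoothFAt f x)
    (h : ∀ (x : M) (u : TangentSpace 𝓘(ℝ, E4) x), der f x u = 0) : IsLocallyConstant f := by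
  have hm : ∀ x, mfderiv 𝓘(ℝ, E4) 𝓘(ℝ, ℝ) f x = 0 := fun x ↦ ContinuousLinearMap.ext (h x)
  rw [IsLocallyConstant.iff_eventually_eq]
  intro x
  have hto : IsOpen (extChartAt 𝓘(ℝ, E4) x).target := isOpen_extChartAt_target x
  have hsymm : ∀ z ∈ (extChartAt 𝓘(ℝ, E4) x).target,
      MDifferentiableAt 𝓘(ℝ, E4) 𝓘(ℝ, E4) (extChartAt 𝓘(ℝ, E4) x).symm z := by
    intro z hz
    have := mdifferentiableWithinAt_extChartAt_symm (I := 𝓘(ℝ, E4)) hz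
    rwa [ModelWithCorners.Boundaryless.range_eq_univ, mdifferentiableWithinAt_univ] at this
  have hg : ∀ z ∈ (extChartAt 𝓘(ℝ, E4) x).target,
      MDifferentiableAt 𝓘(ℝ, E4) 𝓘(ℝ, ℝ) (f ∘ (extChartAt 𝓘(ℝ, E4) x).symm) z :=
    fun z hz ↦ (hf _).mdiff.comp z (hsymm z hz)
  have hopen := hto.isOpen_inter_preimage_of_fderiv_eq_zero (𝕜 := ℝ)
    (f := f ∘ (extChartAt 𝓘(ℝ, E4) x).symm)
    (fun z hz ↦ (hg z hz).differentiableAt.differentiableWithinAt)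
    (fun z hz ↦ by
      rw [← mfderiv_eq_fderiv, mfderiv_comp z (hf _).mdiff (hsymm z hz), hm]
      exact ContinuousLinearMap.zero_comp _) {f x}
  have hx : extChartAt 𝓘(ℝ, E4) x x ∈ (extChartAt 𝓘(ℝ, E4) x).target
      ∩ (f ∘ (extChartAt 𝓘(ℝ, E4) x).symm) ⁻¹' {f x} :=
    ⟨mem_extChartAt_target x, by simp⟩
  filter_upwards [extChartAt_source_mem_nhds (I := 𝓘(ℝ, E4)) x,
    (continuousAt_extChartAt x).preimage_mem_nhds (hopen.mem_nhds hx)] with y hy hy'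
  have h1 : f ((extChartAt 𝓘(ℝ, E4) x).symm (extChartAt 𝓘(ℝ, E4) x y)) = f x := hy'.2
  rwa [(extChartAt 𝓘(ℝ, E4) x).left_inv hy] at h1

variable [RiemannianBundle (fun x : M ↦ TangentSpace 𝓘(ℝ, E4) x)]
  [IsContMDiffRiemannianBundle 𝓘(ℝ, E4) ∞ E4 (fun x : M ↦ TangentSpace 𝓘(ℝ, E4) x)]
  {o : ∀ x : M, Orientation ℝ (TangentSpace 𝓘(ℝ, E4) x) (Fin 4)} {nab : Connection M} {x : M}
  {σ : Tensor2 M} {ξ : VField M} {Ω : M → ℝ}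

theorem OFrame.sum_diag_eq (e e' : OFrame o x)
    (B : TangentSpace 𝓘(ℝ, E4) x →ₗ[ℝ] TangentSpace 𝓘(ℝ, E4) x →ₗ[ℝ] ℝ) :
    ∑ i, B (e.basis i) (e.basis i) = ∑ k, B (e'.basis k) (e'.basis k) := by
  have h : ∀ i, B (e.basis i) (e.basis i) = ∑ k, ∑ l, (inner ℝ (e'.basis k) (e.basis i)
      * inner ℝ (e.basis i) (e'.basis l)) * B (e'.basis k) (e'.basis l) := by
    intro i
    conv_lhs => rw [← e'.sum_inner_smul (e.basis i)]
    simp only [map_sum, map_smul, LinearMap.sum_apply, LinearMap.smul_apply, smul_eq_mul,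
      Finset.mul_sum]
    rw [Finset.sum_comm]
    refine Finset.sum_congr rfl fun k _ ↦ Finset.sum_congr rfl fun l _ ↦ ?_
    rw [real_inner_comm (e.basis i) (e'.basis k)]
    ring
  simp only [h]
  rw [Finset.sum_comm]
  refine Finset.sum_congr rfl fun k _ ↦ ?_
  rw [Finset.sum_comm]
  simp only [← Finset.sum_mul, e.basis.sum_inner_mul_inner, e'.inner_basis, ite_mul, one_mul,
    zero_mul, Finset.sum_ite_eq, Finset.mem_univ, if_true]

/-- The full contraction of two tensors in a frame. -/
def OFrame.contr (e : OFrame o x) (S T : Tensor2 M) : ℝ :=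
  ∑ i, ∑ j, S x (e.basis i) (e.basis j) * T x (e.basis i) (e.basis j)

theorem OFrame.contr_eq (e e' : OFrame o x) (S T : Tensor2 M) : e.contr S T = e'.contr S T := by
  have h1 : ∀ u : TangentSpace 𝓘(ℝ, E4) x, ∑ j, S x u (e.basis j) * T x u (e.basis j)
      = ∑ j, S x u (e'.basis j) * T x u (e'.basis j) := fun u ↦
    e.sum_diag_eq e' ((LinearMap.mul ℝ ℝ).compl₁₂ (S x u) (T x u))
  have h2 : ∀ v : TangentSpace 𝓘(ℝ, E4) x, ∑ j, S x (e.basis j) v * T x (e.basis j) v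
      = ∑ j, S x (e'.basis j) v * T x (e'.basis j) v := fun v ↦
    e.sum_diag_eq e' ((LinearMap.mul ℝ ℝ).compl₁₂ ((S x).flip v) ((T x).flip v))
  rw [OFrame.contr, OFrame.contr]
  simp only [h1]
  rw [Finset.sum_comm]
  simp only [h2]
  rw [Finset.sum_comm]

/-- The full contraction of two tensor fields. -/
def contr (o : ∀ x : M, Orientation ℝ (TangentSpace 𝓘(ℝ, E4) x) (Fin 4)) (S T : Tensor2 M)
    (x : M) : ℝ := (Classical.choice (exists_oFrame o x)).contr S T

theorem OFrame.contr_apply (e : OFrame o x) (S T : Tensor2 M) :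
    HKSpinor.contr o S T x = ∑ i, ∑ j, S x (e.basis i) (e.basis j) * T x (e.basis i) (e.basis j) :=
  OFrame.contr_eq _ e S T

theorem IsLocalFrame.eventually_contr_eq {E : Fin 4 → VField M} (hE : IsLocalFrame o E x)
    (S T : Tensor2 M) : ∀ᶠ y in 𝓝 x, contr o S T y
      = ∑ i, ∑ j, S y (E i y) (E j y) * T y (E i y) (E j y) := by
  filter_upwards [hE] with y hy
  obtain ⟨-, e', he'⟩ := hy
  rw [e'.contr_apply]
  simp only [he']

theorem smoothFAt_contr (ho : IsOrientation o) {S T : Tensor2 M} (hS : SmoothT S)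
    (hT : SmoothT T) (x : M) : SmoothFAt (contr o S T) x := by
  obtain ⟨e⟩ := exists_oFrame o x
  obtain ⟨E, -, hE⟩ := exists_smooth_oFrame ho e
  have hE : IsLocalFrame o E x := hE
  exact SmoothFAt.congr (SmoothFAt.sum fun i _ ↦ SmoothFAt.sum fun j _ ↦
    (hS x _ _ (hE.smoothVAt i) (hE.smoothVAt j)).mul
      (hT x _ _ (hE.smoothVAt i) (hE.smoothVAt j))) (hE.eventually_contr_eq S T)

theorem OFrame.der_contr (ho : IsOrientation o) (hnab : IsLeviCivita nab) {S T : Tensor2 M}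
    (hS : SmoothT S) (hT : SmoothT T) (e : OFrame o x) (u : TangentSpace 𝓘(ℝ, E4) x) :
    der (HKSpinor.contr o S T) x u
      = ∑ i, ∑ j, (covT nab S x u (e.basis i) (e.basis j) * T x (e.basis i) (e.basis j)
        + S x (e.basis i) (e.basis j) * covT nab T x u (e.basis i) (e.basis j)) := by
  obtain ⟨E, hEx, hE⟩ := exists_smooth_oFrame ho e
  have hE : IsLocalFrame o E x := hE
  have hs : ∀ i j, SmoothFAt (fun y ↦ S y (E i y) (E j y)) x :=
    fun i j ↦ hS x _ _ (hE.smoothVAt i) (hE.smoothVAt j)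
  have ht : ∀ i j, SmoothFAt (fun y ↦ T y (E i y) (E j y)) x :=
    fun i j ↦ hT x _ _ (hE.smoothVAt i) (hE.smoothVAt j)
  rw [der_congr _ (hE.eventually_contr_eq S T),
    der_sum _ fun i _ ↦ SmoothFAt.sum fun j _ ↦ SmoothFAt.mul (hs i j) (ht i j)]
  simp only [fun i ↦ der_sum u fun j (_ : j ∈ Finset.univ) ↦ SmoothFAt.mul (hs i j) (ht i j),
    fun i j ↦ der_mul u (hs i j) (ht i j), hE.der_apply (nab := nab) hS,
    hE.der_apply (nab := nab) hT, hEx]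
  set θ := connForm nab E x u with hθ
  have hanti : ∀ i j, θ i j = - θ j i := hE.connForm_antisymm hnab u
  set s := fun i j ↦ S x (e.basis i) (e.basis j) with hs'
  set t := fun i j ↦ T x (e.basis i) (e.basis j) with ht'
  -- The connection terms cancel because the connection form of an orthonormal frame is
  -- antisymmetric.
  have key : ∑ i, ∑ j, ((∑ m, θ i m * s m j + ∑ m, θ j m * s i m) * t i j
      + s i j * (∑ m, θ i m * t m j + ∑ m, θ j m * t i m)) = 0 := by
    have k1 : ∑ i, ∑ j, (∑ m, θ i m * s m j) * t i j
        = - ∑ i, ∑ j, s i j * ∑ m, θ i m * t m j := by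
      simp only [Finset.sum_mul, Finset.mul_sum, ← Finset.sum_neg_distrib]
      rw [Finset.sum_comm]
      conv_rhs => rw [Finset.sum_comm]
      refine Finset.sum_congr rfl fun j _ ↦ ?_
      rw [Finset.sum_comm]
      refine Finset.sum_congr rfl fun m _ ↦ Finset.sum_congr rfl fun i _ ↦ ?_
      rw [hanti i m]
      ring
    have k2 : ∑ i, ∑ j, (∑ m, θ j m * s i m) * t i j
        = - ∑ i, ∑ j, s i j * ∑ m, θ j m * t i m := by
      simp only [Finset.sum_mul, Finset.mul_sum, ← Finset.sum_neg_distrib]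
      refine Finset.sum_congr rfl fun j _ ↦ ?_
      rw [Finset.sum_comm]
      refine Finset.sum_congr rfl fun m _ ↦ Finset.sum_congr rfl fun i _ ↦ ?_
      rw [hanti i m]
      ring
    simp only [add_mul, mul_add, Finset.sum_add_distrib]
    rw [k1, k2]
    ring
  rw [← sub_eq_zero, ← key, ← Finset.sum_sub_distrib]
  refine Finset.sum_congr rfl fun i _ ↦ ?_
  rw [← Finset.sum_sub_distrib]
  refine Finset.sum_congr rfl fun j _ ↦ ?_
  simp only [hs', ht']
  ring

theorem FrameData.contr_self {e : OFrame o x} {a b c α β γ h : ℝ}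
    (hd : FrameData nab σ ξ Ω e a b c α β γ h) :
    contr o σ σ x = 4 * (a ^ 2 + b ^ 2 + c ^ 2) := by
  have hz : ∀ i j, σ x (e.basis i) (e.basis j) = asdForm a b c i j :=
    fun i j ↦ congrFun (congrFun hd.sigma i) j
  rw [e.contr_apply]
  simp only [hz]
  simp [asdForm, Fin.sum_univ_four]
  ring

theorem FrameData.contr_gradT {e : OFrame o x} {a b c α β γ h : ℝ}
    (hd : FrameData nab σ ξ Ω e a b c α β γ h) :
    contr o (gradT nab ξ) σ x = 4 * h * (a ^ 2 + b ^ 2 + c ^ 2) := by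
  have hz : ∀ i j, σ x (e.basis i) (e.basis j) = asdForm a b c i j :=
    fun i j ↦ congrFun (congrFun hd.sigma i) j
  have hn : ∀ i j, gradT nab ξ x (e.basis i) (e.basis j)
      = h * asdForm a b c i j + sdForm α β γ i j := hd.grad
  rw [e.contr_apply]
  simp only [hz, hn]
  simp [asdForm, sdForm, Fin.sum_univ_four]
  ring

theorem sum_ksForm_mul_asdForm (a b c : ℝ) (v : Fin 4 → ℝ) (k : Fin 4) :
    ∑ i, ∑ j, ksForm v k i j * asdForm a b c i j = -4 * ∑ m, asdForm a b c k m * v m := by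
  fin_cases k <;> simp [ksForm, asdForm, Fin.sum_univ_four] <;> ring

theorem sum_ksForm_mul_sdForm (a b c : ℝ) (v : Fin 4 → ℝ) (k : Fin 4) :
    ∑ i, ∑ j, ksForm v k i j * sdForm a b c i j = 0 := by
  fin_cases k <;> simp [ksForm, asdForm, sdForm, Fin.sum_univ_four] <;> ring

theorem FrameData.der_contr_self (ho : IsOrientation o) (hnab : IsLeviCivita nab)
    (hσ : SmoothT σ) {e : OFrame o x} {a b c α β γ h : ℝ}
    (hd : FrameData nab σ ξ Ω e a b c α β γ h) (k : Fin 4) :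
    der (contr o σ σ) x (e.basis k) = -8 * ∑ m, asdForm a b c k m * e.comp1 (ξ x) m := by
  have hz : ∀ i j, σ x (e.basis i) (e.basis j) = asdForm a b c i j :=
    fun i j ↦ congrFun (congrFun hd.sigma i) j
  have ht : ∀ i j, covT nab σ x (e.basis k) (e.basis i) (e.basis j)
      = ksForm (e.comp1 (ξ x)) k i j :=
    fun i j ↦ congrFun (congrFun (congrFun hd.covSigma k) i) j
  rw [e.der_contr ho hnab hσ hσ]
  simp only [hz, ht]
  have h1 := sum_ksForm_mul_asdForm a b c (e.comp1 (ξ x)) k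
  simp only [Finset.sum_add_distrib, mul_comm (asdForm a b c _ _) (ksForm _ _ _ _)]
  rw [h1]
  ring

/-- The coefficient 4h is 8h - 4h: ∇∇ξ contracted with σ contributes 8h and hσ contracted with ∇σ
contributes -4h. The self-dual part of ∇ξ is orthogonal to ∇σ. -/
theorem FrameData.der_contr_gradT (ho : IsOrientation o) (hnab : IsLeviCivita nab)
    (hσ : SmoothT σ) (hξ : ∀ x, SmoothVAt ξ x) {e : OFrame o x} {a b c α β γ h : ℝ}
    (hd : FrameData nab σ ξ Ω e a b c α β γ h) (k : Fin 4) :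
    der (contr o (gradT nab ξ) σ) x (e.basis k)
      = 4 * h * ∑ m, asdForm a b c k m * e.comp1 (ξ x) m := by
  have hz : ∀ i j, σ x (e.basis i) (e.basis j) = asdForm a b c i j :=
    fun i j ↦ congrFun (congrFun hd.sigma i) j
  have ht : ∀ i j, covT nab σ x (e.basis k) (e.basis i) (e.basis j)
      = ksForm (e.comp1 (ξ x)) k i j :=
    fun i j ↦ congrFun (congrFun (congrFun hd.covSigma k) i) j
  have hn : ∀ i j, gradT nab ξ x (e.basis i) (e.basis j)
      = h * asdForm a b c i j + sdForm α β γ i j := hd.grad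
  have hM : ∑ i, ∑ j, covT nab (gradT nab ξ) x (e.basis k) (e.basis i) (e.basis j)
      * asdForm a b c i j = 8 * h * ∑ m, asdForm a b c k m * e.comp1 (ξ x) m := by
    have h1 : ∀ i, ∑ j, covT nab (gradT nab ξ) x (e.basis k) (e.basis i) (e.basis j)
        * asdForm a b c i j = 2 * h * ∑ m, asdForm a b c k m * e.comp1 (ξ x) m := by
      intro i
      have h2 := hd.covGrad k i i
      rw [if_pos rfl, Finset.sum_add_distrib] at h2
      simp only [OFrame.comp3] at h2
      simp only [mul_comm (covT _ _ _ _ _ _)]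
      linarith
    simp only [h1, Fin.sum_univ_four]
    ring
  have h1 := sum_ksForm_mul_asdForm a b c (e.comp1 (ξ x)) k
  have h2 := sum_ksForm_mul_sdForm α β γ (e.comp1 (ξ x)) k
  rw [e.der_contr ho hnab (smoothT_gradT hnab hξ) hσ]
  simp only [hz, ht, hn, Finset.sum_add_distrib, add_mul]
  rw [hM]
  simp only [mul_assoc h, ← Finset.mul_sum, mul_comm (asdForm a b c _ _) (ksForm _ _ _ _),
    mul_comm (sdForm α β γ _ _) (ksForm _ _ _ _)]
  rw [h1, h2]
  ring

/-- Differentiate Ω²⟨σ, σ⟩ = 4, where ⟨σ, σ⟩ is the full contraction over both indices, using the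
known derivative of ⟨σ, σ⟩. -/
theorem FrameData.der_conformalFactor (ho : IsOrientation o) (hnab : IsLeviCivita nab)
    (hHK : IsHyperKahler nab o) (hσ : IsSymSpinor o σ) (hξ : ∀ x, SmoothVAt ξ x)
    (hKS : IsKillingSpinor nab o σ ξ) (hΩ : IsConformalFactor o σ Ω) {e : OFrame o x}
    {a b c α β γ h : ℝ} (hd : FrameData nab σ ξ Ω e a b c α β γ h) (k : Fin 4) :
    der Ω x (e.basis k) = Ω x ^ 3 * ∑ m, asdForm a b c k m * e.comp1 (ξ x) m := by
  have h1 : ∀ y, Ω y * Ω y * contr o σ σ y = 4 := by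
    intro y
    obtain ⟨e'⟩ := exists_oFrame o y
    obtain ⟨a', b', c', α', β', γ', h', hd'⟩ := exists_frameData ho hnab hHK hσ hξ hKS hΩ e'
    rw [hd'.contr_self]
    linear_combination 4 * hd'.norm
  have hs : SmoothFAt Ω x := hΩ.smooth x
  have hc := smoothFAt_contr ho hσ.smooth hσ.smooth x
  have h2 := der_congr (e.basis k) (Eventually.of_forall h1 : ∀ᶠ y in 𝓝 x, _)
  rw [der_mul _ (hs.mul hs) hc, der_mul _ hs hs, der_const, hd.der_contr_self ho hnab hσ.smooth]
    at h2
  have h3 := h1 x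
  have h0 := hΩ.ne_zero x
  apply mul_left_cancel₀ (mul_ne_zero (show (8 : ℝ) ≠ 0 by norm_num) (inv_ne_zero h0))
  field_simp
  have h4 : 2 * Ω x * contr o σ σ x * der Ω x (e.basis k)
      = 8 * Ω x ^ 2 * ∑ m, asdForm a b c k m * e.comp1 (ξ x) m := by linear_combination h2
  have h5 : 8 * der Ω x (e.basis k)
      = 8 * Ω x ^ 3 * ∑ m, asdForm a b c k m * e.comp1 (ξ x) m := by
    linear_combination Ω x * h4 - 2 * der Ω x (e.basis k) * h3
  linarith

/-- The normalisation of the Weyl spinor at one point fixes it everywhere. -/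
theorem FrameData.anti_self_dual_part [ConnectedSpace M] (ho : IsOrientation o)
    (hnab : IsLeviCivita nab) (hHK : IsHyperKahler nab o) (hσ : IsSymSpinor o σ)
    (hξ : ∀ x, SmoothVAt ξ x) (hKS : IsKillingSpinor nab o σ ξ) (hΩ : IsConformalFactor o σ Ω)
    (hnorm : ∃ (x : M) (e : OFrame o x),
      ∑ A, ∑ B, ∑ C, ∑ D, e.Psi nab A B C D * raise2 (e.sigma σ) A B
        * raise2 (e.sigma σ) C D = -4 * (Ω x : ℂ)) {e : OFrame o x}
    {a b c α β γ h : ℝ} (hd : FrameData nab σ ξ Ω e a b c α β γ h) : h = - Ω x ^ 3 / 2 := by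
  -- The quotient ⟨∇ξ, σ⟩/Ω is constant, since numerator and denominator have the same logarithmic
  -- derivative Ω²σ(·, ξ). Writing the numerator as Ω times the quotient lets the product rule give
  -- the derivative.
  have hq : ∀ y, contr o (gradT nab ξ) σ y = Ω y * (contr o (gradT nab ξ) σ y * (Ω y)⁻¹) := by
    intro y
    have := hΩ.ne_zero y
    field_simp
  have hs : ∀ y, SmoothFAt Ω y := hΩ.smooth
  have hp := smoothFAt_contr ho (smoothT_gradT hnab hξ) hσ.smooth
  have hi : ∀ y, SmoothFAt (fun y ↦ (Ω y)⁻¹) y := fun y ↦ ContMDiffAt.inv₀ (hs y) (hΩ.ne_zero y)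
  have hf : ∀ y, SmoothFAt (fun y ↦ contr o (gradT nab ξ) σ y * (Ω y)⁻¹) y :=
    fun y ↦ (hp y).mul (hi y)
  have hder : ∀ (y : M) (u : TangentSpace 𝓘(ℝ, E4) y),
      der (fun y ↦ contr o (gradT nab ξ) σ y * (Ω y)⁻¹) y u = 0 := by
    intro y u
    obtain ⟨e'⟩ := exists_oFrame o y
    obtain ⟨a', b', c', α', β', γ', h', hd'⟩ := exists_frameData ho hnab hHK hσ hξ hKS hΩ e'
    have hk : ∀ k, der (fun y ↦ contr o (gradT nab ξ) σ y * (Ω y)⁻¹) y (e'.basis k) = 0 := by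
      intro k
      have h1 := der_congr (e'.basis k) (Eventually.of_forall hq : ∀ᶠ z in 𝓝 y, _)
      rw [der_mul _ (hs y) (hf y),
        hd'.der_conformalFactor ho hnab hHK hσ hξ hKS hΩ,
        show der (fun y ↦ contr o (gradT nab ξ) σ y) y (e'.basis k) = _ from
          hd'.der_contr_gradT ho hnab hσ.smooth hξ k, hd'.contr_gradT] at h1
      have h0 := hΩ.ne_zero y
      apply mul_left_cancel₀ h0
      have h2 := hd'.norm
      have h3 : Ω y ^ 3 * (∑ m, asdForm a' b' c' k m * e'.comp1 (ξ y) m)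
          * (4 * h' * (a' ^ 2 + b' ^ 2 + c' ^ 2) * (Ω y)⁻¹)
          = 4 * h' * ∑ m, asdForm a' b' c' k m * e'.comp1 (ξ y) m := by
        field_simp
        linear_combination h' * (∑ m, asdForm a' b' c' k m * e'.comp1 (ξ y) m) * h2
      rw [h3] at h1
      linarith
    rw [← e'.sum_inner_smul u]
    simp only [der] at hk ⊢
    rw [map_sum]
    refine Finset.sum_eq_zero fun k _ ↦ ?_
    rw [map_smul, hk, smul_zero]
  have hconst := fun y z ↦ (isLocallyConstant_of_der_eq_zero hf hder).apply_eq_of_preconnectedSpace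
    y z
  obtain ⟨y, e', hy⟩ := hnorm
  obtain ⟨a', b', c', α', β', γ', h', hd'⟩ := exists_frameData ho hnab hHK hσ hξ hKS hΩ e'
  have h1 : 8 * h' * (a' ^ 2 + b' ^ 2 + c' ^ 2) = -4 * Ω y := by
    have := hd'.weyl.symm.trans hy
    exact_mod_cast this
  have h2 := hconst x y
  simp only [hd.contr_gradT, hd'.contr_gradT] at h2
  -- At the normalisation point 8h|z|² = -4Ω, so the constant is -2. With Ω²|z|² = 1 this gives h =
  -- -Ω³/2 at every point.
  have h3 : 4 * h' * (a' ^ 2 + b' ^ 2 + c' ^ 2) * (Ω y)⁻¹ = -2 := by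
    have := hΩ.ne_zero y
    field_simp
    linarith
  rw [h3] at h2
  have h0 := hΩ.ne_zero x
  field_simp at h2
  have h4 := hd.norm
  linear_combination Ω x ^ 2 / 4 * h2 - h * h4

end Global

/-! ### Pointwise algebra of the Killing tensor -/

section KillingAlgebra

/-- The frame components of the covariant derivative of the Killing tensor. -/
def killingForm (v : Fin 4 → ℝ) (α β γ : ℝ) (k i j : Fin 4) : ℝ :=
  -(1 / 2) * ∑ m, (ksForm v k i m * sdForm α β γ j m + ksForm v k j m * sdForm α β γ i m)
    - (if i = j then ∑ m, sdForm α β γ k m * v m else 0)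

set_option maxHeartbeats 2000000 in
-- The algebraic core of the Killing tensor equation. The factor ε_A(B ξ_C)A' in ∇σ kills the
-- trace-free totally symmetric part, and the remaining trace cancels against the gradient term χ(·,
-- ξ).
theorem killingForm_cyclic (v : Fin 4 → ℝ) (α β γ : ℝ) (k i j : Fin 4) :
    killingForm v α β γ k i j + killingForm v α β γ i j k + killingForm v α β γ j k i = 0 := by
  fin_cases k <;> fin_cases i <;> fin_cases j <;>
    simp [killingForm, ksForm, asdForm, sdForm, Fin.sum_univ_four] <;> ring

/-- Only the self-dual part matters: in ∇t it cancels the self-dual part of H·∇ξ, found in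
`FrameData.sum_killingTensor_mul_grad`. -/
theorem exists_killingForm_vec (v : Fin 4 → ℝ) (α β γ : ℝ) :
    ∃ p q r, ∀ k j, ∑ m, killingForm v α β γ k j m * v m
      = (∑ m, v m * v m) / 2 * sdForm α β γ k j + asdForm p q r k j := by
  have h := eq_asdForm (f := fun k j ↦ ∑ m, killingForm v α β γ k j m * v m
    - (∑ m, v m * v m) / 2 * sdForm α β γ k j) ?_ ?_ ?_ ?_
  · exact ⟨_, _, _, fun k j ↦ sub_eq_iff_eq_add'.1 (congrFun (congrFun h k) j)⟩
  · intro i j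
    fin_cases i <;> fin_cases j <;>
      simp [killingForm, ksForm, asdForm, sdForm, Fin.sum_univ_four] <;> ring
  all_goals
    simp [killingForm, ksForm, asdForm, sdForm, Fin.sum_univ_four]
    ring

theorem killingForm_vec_vec (v : Fin 4 → ℝ) (α β γ : ℝ) (j : Fin 4) :
    ∑ k, v k * ∑ m, killingForm v α β γ k j m * v m = 0 := by
  fin_cases j <;> simp [killingForm, ksForm, asdForm, sdForm, Fin.sum_univ_four] <;> ring

/-- The part hσ of ∇ξ drops out: its symmetrised product with the anti-self-dual form ∇_kσ is a pure
trace, equal and opposite to its contribution to the last term. -/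
theorem killingForm_eq (v : Fin 4 → ℝ) (a b c α β γ h : ℝ) (k i j : Fin 4) :
    -(1 / 2) * ∑ m, (ksForm v k i m * (h * asdForm a b c j m + sdForm α β γ j m)
        + ksForm v k j m * (h * asdForm a b c i m + sdForm α β γ i m))
      - (if i = j then ∑ m, (h * asdForm a b c k m + sdForm α β γ k m) * v m else 0)
      = killingForm v α β γ k i j := by
  have h1 := asdForm_mul_symm (![-v 1, v 0, v 3, -v 2] k) (![-v 2, -v 3, v 0, v 1] k)
    (![-v 3, v 2, -v 1, v 0] k) a b c i j
  have h2 : a * ![-v 1, v 0, v 3, -v 2] k + b * ![-v 2, -v 3, v 0, v 1] k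
      + c * ![-v 3, v 2, -v 1, v 0] k = - ∑ m, asdForm a b c k m * v m := by
    fin_cases k <;> simp [asdForm, Fin.sum_univ_four] <;> ring
  change ∑ m, (ksForm v k i m * asdForm a b c j m + ksForm v k j m * asdForm a b c i m) = _ at h1
  have h3 : ∑ m, (ksForm v k i m * (h * asdForm a b c j m + sdForm α β γ j m)
        + ksForm v k j m * (h * asdForm a b c i m + sdForm α β γ i m))
      = h * ∑ m, (ksForm v k i m * asdForm a b c j m + ksForm v k j m * asdForm a b c i m)
        + ∑ m, (ksForm v k i m * sdForm α β γ j m + ksForm v k j m * sdForm α β γ i m) := by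
    rw [Finset.mul_sum, ← Finset.sum_add_distrib]
    exact Finset.sum_congr rfl fun m _ ↦ by ring
  have h4 : ∑ m, (h * asdForm a b c k m + sdForm α β γ k m) * v m
      = h * ∑ m, asdForm a b c k m * v m + ∑ m, sdForm α β γ k m * v m := by
    rw [Finset.mul_sum, ← Finset.sum_add_distrib]
    exact Finset.sum_congr rfl fun m _ ↦ by ring
  rw [h3, h1, h4, killingForm]
  split_ifs
  · linear_combination (-h) * h2
  · ring

/-- Self-dual and anti-self-dual forms commute and square to negative multiples of the identity, so
multiplying σχ by hσ + χ returns a combination of χ and σ. -/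
theorem sum_asdForm_mul_sdForm_mul (a b c α β γ h E : ℝ) (k j : Fin 4) :
    ∑ m, (-(∑ l, asdForm a b c j l * sdForm α β γ m l) - E / 2 * (if j = m then 1 else 0))
        * (h * asdForm a b c k m + sdForm α β γ k m)
      = -(h * (a ^ 2 + b ^ 2 + c ^ 2) + E / 2) * sdForm α β γ k j
        - (α ^ 2 + β ^ 2 + γ ^ 2 + E / 2 * h) * asdForm a b c k j := by
  fin_cases k <;> fin_cases j <;> simp [asdForm, sdForm, Fin.sum_univ_four] <;> ring

/-- The two quaternion algebras commute; this is the symmetry of H. -/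
theorem asdForm_mul_sdForm_comm (a b c α β γ : ℝ) (i j : Fin 4) :
    ∑ m, asdForm a b c i m * sdForm α β γ j m = ∑ m, asdForm a b c j m * sdForm α β γ i m := by
  fin_cases i <;> fin_cases j <;> simp [asdForm, sdForm, Fin.sum_univ_four] <;> ring

theorem asdForm_mul_self (a b c : ℝ) (i j : Fin 4) :
    ∑ m, asdForm a b c i m * asdForm a b c j m
      = (a ^ 2 + b ^ 2 + c ^ 2) * if i = j then 1 else 0 := by
  fin_cases i <;> fin_cases j <;> simp [asdForm, Fin.sum_univ_four] <;> ring

theorem asdForm_antisymm (a b c : ℝ) (i j : Fin 4) : asdForm a b c i j = - asdForm a b c j i := by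
  fin_cases i <;> fin_cases j <;> simp [asdForm]

theorem sdForm_antisymm (a b c : ℝ) (i j : Fin 4) : sdForm a b c i j = - sdForm a b c j i := by
  fin_cases i <;> fin_cases j <;> simp [sdForm]

theorem mul_asdForm (h a b c : ℝ) (i j : Fin 4) :
    h * asdForm a b c i j = asdForm (h * a) (h * b) (h * c) i j := by
  fin_cases i <;> fin_cases j <;> simp [asdForm]

end KillingAlgebra

/-! ### The Killing tensor H and the vector field t -/

section KillingTensor

variable {M : Type*} [TopologicalSpace M] [ChartedSpace E4 M] [IsManifold 𝓘(ℝ, E4) ∞ M]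
  [RiemannianBundle (fun x : M ↦ TangentSpace 𝓘(ℝ, E4) x)]
  [IsContMDiffRiemannianBundle 𝓘(ℝ, E4) ∞ E4 (fun x : M ↦ TangentSpace 𝓘(ℝ, E4) x)]
  {o : ∀ x : M, Orientation ℝ (TangentSpace 𝓘(ℝ, E4) x) (Fin 4)} {nab : Connection M} {x : M}
  {σ H : Tensor2 M} {ξ t : VField M} {Ω : M → ℝ}

theorem OFrame.induction_on (e : OFrame o x) {p : TangentSpace 𝓘(ℝ, E4) x → Prop}
    (v : TangentSpace 𝓘(ℝ, E4) x) (hb : ∀ i, p (e.basis i))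
    (hadd : ∀ v w, p v → p w → p (v + w)) (hsmul : ∀ (c : ℝ) v, p v → p (c • v)) : p v := by
  rw [← e.sum_inner_smul v]
  refine Finset.sum_induction _ p hadd ?_ fun i _ ↦ hsmul _ _ (hb i)
  simpa using hsmul 0 _ (hb 0)

/-- The scalar function in the trace part of the Killing tensor. -/
def killingScalar (Ω : M → ℝ) (ξ : VField M) (x : M) : ℝ := Ω x + 1 / 2 * inner ℝ (ξ x) (ξ x)

/-- The tensor field `-Z(u, ∇_v ξ) - (Ω + ½ |ξ|²) ⟨u, v⟩`, which is `σ_AB χ_A'B' - ½ E₊ g_ab`. -/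
def killingTensor (nab : Connection M) (σ : Tensor2 M) (ξ : VField M) (Ω : M → ℝ) : Tensor2 M :=
  fun x ↦ LinearMap.mk₂ ℝ (fun u v ↦ - σ x u (nab ξ x v) - killingScalar Ω ξ x * inner ℝ u v)
    (fun u u' v ↦ by
      simp only [map_add, LinearMap.add_apply, inner_add_left]
      ring)
    (fun c u v ↦ by
      simp only [map_smul, LinearMap.smul_apply, real_inner_smul_left, smul_eq_mul]
      ring)
    (fun u v v' ↦ by
      simp only [map_add, inner_add_right]
      ring)
    (fun c u v ↦ by
      simp only [map_smul, real_inner_smul_right, smul_eq_mul]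
      ring)

theorem killingTensor_apply (u v : TangentSpace 𝓘(ℝ, E4) x) :
    killingTensor nab σ ξ Ω x u v
      = - σ x u (nab ξ x v) - killingScalar Ω ξ x * inner ℝ u v := rfl

theorem smoothFAt_killingScalar (hξ : ∀ x, SmoothVAt ξ x) (hΩ : IsConformalFactor o σ Ω) (x : M) :
    SmoothFAt (killingScalar Ω ξ) x := by
  have h1 : SmoothFAt Ω x := hΩ.smooth x
  have h2 : SmoothFAt (fun _ : M ↦ (1 / 2 : ℝ)) x := contMDiffAt_const
  exact h1.add (h2.mul ((hξ x).inner (hξ x)))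

theorem smoothT_killingTensor (hnab : IsLeviCivita nab) (hσ : IsSymSpinor o σ)
    (hξ : ∀ x, SmoothVAt ξ x) (hΩ : IsConformalFactor o σ Ω) :
    SmoothT (killingTensor nab σ ξ Ω) := by
  intro x X Y hX hY
  have h0 : SmoothFAt (fun _ : M ↦ (0 : ℝ)) x := contMDiffAt_const
  have h1 : SmoothFAt (fun y ↦ σ y (X y) (nab ξ y (Y y))) x :=
    hσ.smooth x _ _ hX (hnab.smooth x Y ξ hY (hξ x))
  have h2 := (h0.sub h1).sub ((smoothFAt_killingScalar hξ hΩ x).mul (hX.inner hY))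
  refine h2.congr (Eventually.of_forall fun y ↦ ?_)
  rw [killingTensor_apply, zero_sub]

/-- The Leibniz rule applied to the frame-free expression for H; the frame serves only to expand ∇∇ξ
in the second slot of σ. -/
theorem covT_killingTensor (hnab : IsLeviCivita nab) (hσ : IsSymSpinor o σ)
    (hξ : ∀ x, SmoothVAt ξ x) (hΩ : IsConformalFactor o σ Ω) (e : OFrame o x)
    (u v w : TangentSpace 𝓘(ℝ, E4) x) :
    covT nab (killingTensor nab σ ξ Ω) x u v w = - covT nab σ x u v (nab ξ x w)
      - ∑ m, σ x v (e.basis m) * covT nab (gradT nab ξ) x u w (e.basis m)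
      - der (killingScalar Ω ξ) x u * inner ℝ v w := by
  have hv := smoothVAt_ext v
  have hw := smoothVAt_ext w
  have hnw := hnab.smooth x _ ξ hw (hξ x)
  have h0 : SmoothFAt (fun _ : M ↦ (0 : ℝ)) x := contMDiffAt_const
  have h1 : SmoothFAt (fun y ↦ σ y (ext v y) (nab ξ y (ext w y))) x := hσ.smooth x _ _ hv hnw
  have h2 := smoothFAt_killingScalar hξ hΩ x
  have h3 : SmoothFAt (fun y ↦ (inner ℝ (ext v y) (ext w y) : ℝ)) x := hv.inner hw
  have h4 : ∀ᶠ y in 𝓝 x, killingTensor nab σ ξ Ω y (ext v y) (ext w y)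
      = (0 - σ y (ext v y) (nab ξ y (ext w y)))
        - killingScalar Ω ξ y * inner ℝ (ext v y) (ext w y) :=
    Eventually.of_forall fun y ↦ by rw [killingTensor_apply, zero_sub]
  have h5 := der_apply_eq_covT u nab hσ.smooth hv hnw
  have h6 := der_inner hnab hv hw u
  have h7 := fun z ↦ covT_gradT hnab hξ hw u z
  simp only [ext_self] at h5 h6 h7
  have h8 : ∑ m, σ x v (e.basis m) * covT nab (gradT nab ξ) x u w (e.basis m)
      = σ x v (nab (fun y ↦ nab ξ y (ext w y)) x u) - σ x v (nab ξ x (nab (ext w) x u)) := by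
    rw [← map_sub, ← e.sum_inner_smul (nab (fun y ↦ nab ξ y (ext w y)) x u
      - nab ξ x (nab (ext w) x u)), map_sum]
    refine Finset.sum_congr rfl fun m _ ↦ ?_
    rw [map_smul, smul_eq_mul, h7, mul_comm]
  have h9 : covT nab (killingTensor nab σ ξ Ω) x u v w
      = der (fun y ↦ killingTensor nab σ ξ Ω y (ext v y) (ext w y)) x u
        - killingTensor nab σ ξ Ω x (nab (ext v) x u) w
        - killingTensor nab σ ξ Ω x v (nab (ext w) x u) := rfl
  rw [h9, der_congr u h4, der_sub u (h0.sub h1) (h2.mul h3), der_sub u h0 h1, der_const,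
    der_mul u h2 h3, h5, h6, h8, killingTensor_apply, killingTensor_apply]
  simp only [ext_self]
  ring

theorem der_killingScalar (hnab : IsLeviCivita nab) (hξ : ∀ x, SmoothVAt ξ x)
    (hΩ : IsConformalFactor o σ Ω) (u : TangentSpace 𝓘(ℝ, E4) x) :
    der (killingScalar Ω ξ) x u = der Ω x u + inner ℝ (nab ξ x u) (ξ x) := by
  have h1 : SmoothFAt Ω x := hΩ.smooth x
  have h2 : SmoothFAt (fun _ : M ↦ (1 / 2 : ℝ)) x := contMDiffAt_const
  have h3 : SmoothFAt (fun y ↦ (inner ℝ (ξ y) (ξ y) : ℝ)) x := (hξ x).inner (hξ x)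
  have h4 := der_add u h1 (h2.mul h3)
  rw [der_const_mul u _ h3, der_inner hnab (hξ x) (hξ x), real_inner_comm (nab ξ x u)] at h4
  have h5 : der (killingScalar Ω ξ) x u
      = der (fun y ↦ Ω y + 1 / 2 * inner ℝ (ξ y) (ξ y)) x u := rfl
  rw [h5, h4]
  ring

theorem covT_symm (hH : ∀ (y : M) (v w : TangentSpace 𝓘(ℝ, E4) y), H y v w = H y w v)
    (u v w : TangentSpace 𝓘(ℝ, E4) x) : covT nab H x u v w = covT nab H x u w v := by
  rw [covT, covT, hH x _ w, hH x v]
  simp only [hH _ (ext v _) (ext w _)]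
  ring

theorem covV_of_inner_eq (hnab : IsLeviCivita nab) (hH : SmoothT H) (hξ : SmoothVAt ξ x)
    (ht : SmoothVAt t x)
    (h : ∀ (y : M) (v : TangentSpace 𝓘(ℝ, E4) y), inner ℝ (t y) v = H y v (ξ y))
    (u w : TangentSpace 𝓘(ℝ, E4) x) :
    covV nab t x u w = covT nab H x u w (ξ x) + H x w (nab ξ x u) := by
  have hw := smoothVAt_ext w
  have h1 := der_inner hnab ht hw u
  have h2 := der_apply_eq_covT u nab hH hw hξ
  simp only [h, ext_self] at h1 h2
  rw [h2] at h1
  rw [covV]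
  linarith

/-- The vector field with `t_a = H_ab ξ^b`. -/
def contractVec (o : ∀ x : M, Orientation ℝ (TangentSpace 𝓘(ℝ, E4) x) (Fin 4)) (H : Tensor2 M)
    (ξ : VField M) : VField M := fun x ↦
  ∑ i, H x ((Classical.choice (exists_oFrame o x)).basis i) (ξ x)
    • (Classical.choice (exists_oFrame o x)).basis i

theorem inner_contractVec (v : TangentSpace 𝓘(ℝ, E4) x) :
    inner ℝ (contractVec o H ξ x) v = H x v (ξ x) := by
  set e := Classical.choice (exists_oFrame o x) with he
  have h1 : H x v (ξ x) = ∑ i, inner ℝ v (e.basis i) * H x (e.basis i) (ξ x) := by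
    conv_lhs => rw [← e.sum_inner_smul v]
    simp only [map_sum, map_smul, LinearMap.sum_apply, LinearMap.smul_apply, smul_eq_mul]
  rw [h1, contractVec, ← he, sum_inner]
  refine Finset.sum_congr rfl fun i _ ↦ ?_
  rw [real_inner_smul_left, real_inner_comm, mul_comm]

/-- The frame chosen in `contractVec` varies arbitrarily from point to point, but the vector is
independent of it, so it can be expanded in a smooth local frame. -/
theorem smoothVAt_contractVec (ho : IsOrientation o) (hH : SmoothT H) (hξ : ∀ x, SmoothVAt ξ x)
    (x : M) : SmoothVAt (contractVec o H ξ) x := by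
  obtain ⟨e⟩ := exists_oFrame o x
  obtain ⟨E, -, hE⟩ := exists_smooth_oFrame ho e
  have hE : IsLocalFrame o E x := hE
  have h1 : ∀ i, SmoothVAt (fun y ↦ H y (E i y) (ξ y) • E i y) x := fun i ↦
    SmoothVAt.smul (hH x _ _ (hE.smoothVAt i) (hξ x)) (hE.smoothVAt i)
  have h2 : SmoothVAt (fun y ↦ ∑ i, H y (E i y) (ξ y) • E i y) x := by
    simpa using SmoothVAt.sum (s := Finset.univ) fun i _ ↦ h1 i
  refine h2.congr ?_
  filter_upwards [hE] with y hy
  obtain ⟨-, e', he'⟩ := hy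
  rw [← e'.sum_inner_smul (contractVec o H ξ y)]
  refine Finset.sum_congr rfl fun i _ ↦ ?_
  rw [inner_contractVec, he']

/-- The part hσ of ∇ξ contributes -h|z|² g = ½Ω g. Together with -(Ω + ½|ξ|²) g this is -½E₊ g,
leaving the product of σ and χ. -/
theorem FrameData.killingTensor_eq {e : OFrame o x} {a b c α β γ h : ℝ}
    (hd : FrameData nab σ ξ Ω e a b c α β γ h) (hh : h = - Ω x ^ 3 / 2) (i j : Fin 4) :
    killingTensor nab σ ξ Ω x (e.basis i) (e.basis j)
      = -(∑ m, asdForm a b c i m * sdForm α β γ j m)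
        - ernstPlus Ω ξ x / 2 * (if i = j then 1 else 0) := by
  have hz : ∀ i j, σ x (e.basis i) (e.basis j) = asdForm a b c i j :=
    fun i j ↦ congrFun (congrFun hd.sigma i) j
  have hn : ∀ i j, (inner ℝ (nab ξ x (e.basis i)) (e.basis j) : ℝ)
      = h * asdForm a b c i j + sdForm α β γ i j := hd.grad
  have h1 : σ x (e.basis i) (nab ξ x (e.basis j))
      = h * ∑ m, asdForm a b c i m * asdForm a b c j m
        + ∑ m, asdForm a b c i m * sdForm α β γ j m := by
    rw [← e.sum_inner_smul (nab ξ x (e.basis j)), map_sum, Finset.mul_sum,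
      ← Finset.sum_add_distrib]
    refine Finset.sum_congr rfl fun m _ ↦ ?_
    rw [map_smul, smul_eq_mul, hz, hn]
    ring
  have h2 : h * (a ^ 2 + b ^ 2 + c ^ 2) = - Ω x / 2 := by
    rw [hh]
    linear_combination -Ω x / 2 * hd.norm
  rw [killingTensor_apply, h1, asdForm_mul_self, e.inner_basis, killingScalar, ernstPlus]
  linear_combination -(if i = j then 1 else 0) * h2

theorem FrameData.covT_killingTensor_eq (ho : IsOrientation o) (hnab : IsLeviCivita nab)
    (hHK : IsHyperKahler nab o) (hσ : IsSymSpinor o σ) (hξ : ∀ x, SmoothVAt ξ x)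
    (hKS : IsKillingSpinor nab o σ ξ) (hΩ : IsConformalFactor o σ Ω)
    (hH : ∀ (y : M) (v w : TangentSpace 𝓘(ℝ, E4) y),
      killingTensor nab σ ξ Ω y v w = killingTensor nab σ ξ Ω y w v)
    {e : OFrame o x} {a b c α β γ h : ℝ}
    (hd : FrameData nab σ ξ Ω e a b c α β γ h) (hh : h = - Ω x ^ 3 / 2) (k i j : Fin 4) :
    covT nab (killingTensor nab σ ξ Ω) x (e.basis k) (e.basis i) (e.basis j)
      = killingForm (e.comp1 (ξ x)) α β γ k i j := by
  have hz : ∀ i j, σ x (e.basis i) (e.basis j) = asdForm a b c i j :=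
    fun i j ↦ congrFun (congrFun hd.sigma i) j
  have hn : ∀ i j, (inner ℝ (nab ξ x (e.basis i)) (e.basis j) : ℝ)
      = h * asdForm a b c i j + sdForm α β γ i j := hd.grad
  have ht : ∀ k i j, covT nab σ x (e.basis k) (e.basis i) (e.basis j)
      = ksForm (e.comp1 (ξ x)) k i j :=
    fun k i j ↦ congrFun (congrFun (congrFun hd.covSigma k) i) j
  have hnab_eq : ∀ j, nab ξ x (e.basis j)
      = ∑ m, (h * asdForm a b c j m + sdForm α β γ j m) • e.basis m := by
    intro j
    simp only [← hn]
    exact (e.sum_inner_smul _).symm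
  have hT : ∀ i j, covT nab σ x (e.basis k) (e.basis i) (nab ξ x (e.basis j))
      = ∑ m, ksForm (e.comp1 (ξ x)) k i m * (h * asdForm a b c j m + sdForm α β γ j m) := by
    intro i j
    rw [hnab_eq, ← covL_apply _ nab hσ.smooth, map_sum]
    refine Finset.sum_congr rfl fun m _ ↦ ?_
    rw [map_smul, smul_eq_mul, covL_apply, ht, mul_comm]
  -- The coefficient -2h is Ω³, by h = -Ω³/2.
  have hφ : der (killingScalar Ω ξ) x (e.basis k)
      = -2 * h * ∑ m, asdForm a b c k m * e.comp1 (ξ x) m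
        + ∑ m, (h * asdForm a b c k m + sdForm α β γ k m) * e.comp1 (ξ x) m := by
    rw [der_killingScalar hnab hξ hΩ, hd.der_conformalFactor ho hnab hHK hσ hξ hKS hΩ, hnab_eq,
      sum_inner, hh]
    congr 1
    · ring
    · refine Finset.sum_congr rfl fun m _ ↦ ?_
      rw [real_inner_smul_left, real_inner_comm, OFrame.comp1]
  -- By symmetry of H the formula is averaged over the exchange of `i` and `j`. Only the symmetrised
  -- product of σ and ∇∇ξ is known, and its trace cancels the -2h term in the gradient of
  -- `killingScalar`.
  have h1 := covT_killingTensor hnab hσ hξ hΩ e (e.basis k) (e.basis i) (e.basis j)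
  have h2 := covT_killingTensor hnab hσ hξ hΩ e (e.basis k) (e.basis j) (e.basis i)
  rw [covT_symm hH (e.basis k) (e.basis j)] at h2
  have h3 := hd.covGrad k i j
  have h4 := killingForm_eq (e.comp1 (ξ x)) a b c α β γ h k i j
  simp only [hT, hz, hφ, e.inner_basis, eq_comm (a := j) (b := i)] at h1 h2
  rw [Finset.sum_add_distrib] at h3 h4
  simp only [OFrame.comp3] at h3
  rw [← h4]
  split_ifs at h1 h2 h3 ⊢ <;> linarith

theorem isKillingTensor_killingTensor (hnab : IsLeviCivita nab) (ho : IsOrientation o)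
    (hHK : IsHyperKahler nab o) (hσ : IsSymSpinor o σ) (hξ : ∀ x, SmoothVAt ξ x)
    (hKS : IsKillingSpinor nab o σ ξ) (hΩ : IsConformalFactor o σ Ω)
    (hdata : ∀ (x : M) (e : OFrame o x), ∃ a b c α β γ h,
      FrameData nab σ ξ Ω e a b c α β γ h ∧ h = - Ω x ^ 3 / 2) :
    IsKillingTensor nab (killingTensor nab σ ξ Ω) := by
  have hs := smoothT_killingTensor hnab hσ hξ hΩ
  have hH : ∀ (y : M) (v w : TangentSpace 𝓘(ℝ, E4) y),
      killingTensor nab σ ξ Ω y v w = killingTensor nab σ ξ Ω y w v := by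
    intro y v w
    obtain ⟨e⟩ := exists_oFrame o y
    obtain ⟨a, b, c, α, β, γ, h, hd, hh⟩ := hdata y e
    have h1 : killingTensor nab σ ξ Ω y = (killingTensor nab σ ξ Ω y).flip := by
      refine e.eq_of_basis fun i j ↦ ?_
      rw [LinearMap.flip_apply, hd.killingTensor_eq hh, hd.killingTensor_eq hh,
        asdForm_mul_sdForm_comm]
      simp only [eq_comm]
    exact congrArg (fun B ↦ B v w) h1
  refine ⟨hs, hH, fun x u v w ↦ ?_⟩
  obtain ⟨e⟩ := exists_oFrame o x
  obtain ⟨a, b, c, α, β, γ, h, hd, hh⟩ := hdata x e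
  simp only [← covL_apply _ nab hs]
  set L := covL nab hs x with hL
  -- The cyclic identity holds on basis vectors and is extended by linearity, one argument at a
  -- time.
  have h1 : ∀ k i j, L (e.basis k) (e.basis i) (e.basis j) + L (e.basis i) (e.basis j) (e.basis k)
      + L (e.basis j) (e.basis k) (e.basis i) = 0 := by
    intro k i j
    simp only [hL, covL_apply, hd.covT_killingTensor_eq ho hnab hHK hσ hξ hKS hΩ hH hh]
    exact killingForm_cyclic _ _ _ _ _ _ _
  have h2 : ∀ k i w, L (e.basis k) (e.basis i) w + L (e.basis i) w (e.basis k)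
      + L w (e.basis k) (e.basis i) = 0 := by
    intro k i w
    refine e.induction_on (p := fun w ↦ L (e.basis k) (e.basis i) w + L (e.basis i) w (e.basis k)
      + L w (e.basis k) (e.basis i) = 0) w (h1 k i) (fun v w hv hw ↦ ?_) fun c v hv ↦ ?_
    · simp only [map_add, LinearMap.add_apply]
      linear_combination hv + hw
    · simp only [map_smul, LinearMap.smul_apply, smul_eq_mul]
      linear_combination c * hv
  have h3 : ∀ k v, L (e.basis k) v w + L v w (e.basis k) + L w (e.basis k) v = 0 := by
    intro k v
    refine e.induction_on (p := fun v ↦ L (e.basis k) v w + L v w (e.basis k)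
      + L w (e.basis k) v = 0) v (fun i ↦ h2 k i w) (fun v w hv hw ↦ ?_) fun c v hv ↦ ?_
    · simp only [map_add, LinearMap.add_apply]
      linear_combination hv + hw
    · simp only [map_smul, LinearMap.smul_apply, smul_eq_mul]
      linear_combination c * hv
  refine e.induction_on (p := fun u ↦ L u v w + L v w u + L w u v = 0) u (fun k ↦ h3 k v)
    (fun v w hv hw ↦ ?_) fun c v hv ↦ ?_
  · simp only [map_add, LinearMap.add_apply]
    linear_combination hv + hw
  · simp only [map_smul, LinearMap.smul_apply, smul_eq_mul]
    linear_combination c * hv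

theorem FrameData.covV_contractVec (ho : IsOrientation o) (hnab : IsLeviCivita nab)
    (hHK : IsHyperKahler nab o) (hσ : IsSymSpinor o σ) (hξ : ∀ x, SmoothVAt ξ x)
    (hKS : IsKillingSpinor nab o σ ξ) (hΩ : IsConformalFactor o σ Ω)
    (hH : IsKillingTensor nab (killingTensor nab σ ξ Ω))
    {e : OFrame o x} {a b c α β γ h : ℝ}
    (hd : FrameData nab σ ξ Ω e a b c α β γ h) (hh : h = - Ω x ^ 3 / 2) (k j : Fin 4) :
    covV nab (contractVec o (killingTensor nab σ ξ Ω) ξ) x (e.basis k) (e.basis j)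
      = ∑ m, killingForm (e.comp1 (ξ x)) α β γ k j m * e.comp1 (ξ x) m
        + ∑ m, killingTensor nab σ ξ Ω x (e.basis j) (e.basis m)
          * (h * asdForm a b c k m + sdForm α β γ k m) := by
  have hn : ∀ i j, (inner ℝ (nab ξ x (e.basis i)) (e.basis j) : ℝ)
      = h * asdForm a b c i j + sdForm α β γ i j := hd.grad
  rw [covV_of_inner_eq hnab hH.smooth (hξ x) (smoothVAt_contractVec ho hH.smooth hξ x)
    (fun y v ↦ inner_contractVec v)]
  congr 1
  · conv_lhs => rw [← e.sum_inner_smul (ξ x)]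
    rw [← covL_apply _ nab hH.smooth, map_sum]
    refine Finset.sum_congr rfl fun m _ ↦ ?_
    rw [map_smul, smul_eq_mul, covL_apply,
      hd.covT_killingTensor_eq ho hnab hHK hσ hξ hKS hΩ hH.symm hh, OFrame.comp1, mul_comm]
  · conv_lhs => rw [← e.sum_inner_smul (nab ξ x (e.basis k))]
    rw [map_sum]
    refine Finset.sum_congr rfl fun m _ ↦ ?_
    rw [map_smul, smul_eq_mul, hn, mul_comm]

/-- Since h|z|² = -Ω/2, the coefficient of χ is -(½E₊ - ½Ω) = -½|ξ|², exactly opposite to the one in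
`exists_killingForm_vec`. -/
theorem FrameData.sum_killingTensor_mul_grad {e : OFrame o x} {a b c α β γ h : ℝ}
    (hd : FrameData nab σ ξ Ω e a b c α β γ h) (hh : h = - Ω x ^ 3 / 2) (k j : Fin 4) :
    ∑ m, killingTensor nab σ ξ Ω x (e.basis j) (e.basis m)
        * (h * asdForm a b c k m + sdForm α β γ k m)
      = -((∑ m, e.comp1 (ξ x) m * e.comp1 (ξ x) m) / 2) * sdForm α β γ k j
        - (α ^ 2 + β ^ 2 + γ ^ 2 + ernstPlus Ω ξ x / 2 * h) * asdForm a b c k j := by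
  simp only [hd.killingTensor_eq hh]
  rw [sum_asdForm_mul_sdForm_mul]
  have h2 : h * (a ^ 2 + b ^ 2 + c ^ 2) = - Ω x / 2 := by
    rw [hh]
    linear_combination -Ω x / 2 * hd.norm
  have h3 : ∑ m, e.comp1 (ξ x) m * e.comp1 (ξ x) m = inner ℝ (ξ x) (ξ x) := by
    conv_rhs => rw [← e.sum_inner_smul (ξ x)]
    rw [sum_inner]
    refine Finset.sum_congr rfl fun m _ ↦ ?_
    rw [real_inner_smul_left, e.sum_inner_smul, OFrame.comp1, real_inner_comm (ξ x)]
  rw [h2, h3, ernstPlus]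
  ring

end KillingTensor

/-! ### Anti-self-duality of ∇t and the bracket [t, ξ] -/

section KillingField

variable {M : Type*} [TopologicalSpace M] [ChartedSpace E4 M] [IsManifold 𝓘(ℝ, E4) ∞ M]
  [RiemannianBundle (fun x : M ↦ TangentSpace 𝓘(ℝ, E4) x)]
  [IsContMDiffRiemannianBundle 𝓘(ℝ, E4) ∞ E4 (fun x : M ↦ TangentSpace 𝓘(ℝ, E4) x)]
  {o : ∀ x : M, Orientation ℝ (TangentSpace 𝓘(ℝ, E4) x) (Fin 4)} {nab : Connection M} {x : M}
  {σ : Tensor2 M} {ξ : VField M} {Ω : M → ℝ}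

/-- The self-dual parts ±½|ξ|²χ of the two terms of ∇t cancel. Being an anti-self-dual form, ∇t
gives both the Killing equation and the vanishing of its primed part. -/
theorem FrameData.exists_covV_contractVec (ho : IsOrientation o) (hnab : IsLeviCivita nab)
    (hHK : IsHyperKahler nab o) (hσ : IsSymSpinor o σ) (hξ : ∀ x, SmoothVAt ξ x)
    (hKS : IsKillingSpinor nab o σ ξ) (hΩ : IsConformalFactor o σ Ω)
    (hH : IsKillingTensor nab (killingTensor nab σ ξ Ω))
    {e : OFrame o x} {a b c α β γ h : ℝ}
    (hd : FrameData nab σ ξ Ω e a b c α β γ h) (hh : h = - Ω x ^ 3 / 2) :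
    ∃ p q r, e.comp2 (covV nab (contractVec o (killingTensor nab σ ξ Ω) ξ) x)
      = asdForm p q r := by
  obtain ⟨p, q, r, h1⟩ := exists_killingForm_vec (e.comp1 (ξ x)) α β γ
  refine ⟨p - (α ^ 2 + β ^ 2 + γ ^ 2 + ernstPlus Ω ξ x / 2 * h) * a,
    q - (α ^ 2 + β ^ 2 + γ ^ 2 + ernstPlus Ω ξ x / 2 * h) * b,
    r - (α ^ 2 + β ^ 2 + γ ^ 2 + ernstPlus Ω ξ x / 2 * h) * c, ?_⟩
  funext k j
  rw [OFrame.comp2, hd.covV_contractVec ho hnab hHK hσ hξ hKS hΩ hH hh,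
    hd.sum_killingTensor_mul_grad hh, h1, asdForm_eq p, asdForm_eq (p - _), asdForm_eq a]
  ring

theorem FrameData.chi_eq {e : OFrame o x} {a b c α β γ h : ℝ}
    (hd : FrameData nab σ ξ Ω e a b c α β γ h) (A' B' : Fin 2) :
    e.chi nab ξ A' B' = sdSpinor α β γ A' B' := by
  have h1 : e.comp2 (covV nab ξ x)
      = fun i j ↦ asdForm (h * a) (h * b) (h * c) i j + sdForm α β γ i j := by
    funext i j
    rw [hd.grad, mul_asdForm]
  rw [OFrame.chi, h1, primedPart_add, primedPart_asdForm, primedPart_sdForm, zero_add]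

/-- Let B be the product of ∇ξ with H, so that ∇t = (∇H)(·, ξ) + B. The bracket is ∇_t ξ - ∇_ξ t.
The first term is -B(·, ξ); the second is B(ξ, ·), because (∇_ξ H)(·, ξ) = 0. These agree, since B
is a combination of σ and χ and hence antisymmetric. -/
theorem FrameData.mlieBracket_contractVec (ho : IsOrientation o) (hnab : IsLeviCivita nab)
    (hHK : IsHyperKahler nab o) (hσ : IsSymSpinor o σ) (hξ : ∀ x, SmoothVAt ξ x)
    (hKS : IsKillingSpinor nab o σ ξ) (hΩ : IsConformalFactor o σ Ω)
    (hH : IsKillingTensor nab (killingTensor nab σ ξ Ω))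
    {e : OFrame o x} {a b c α β γ h : ℝ}
    (hd : FrameData nab σ ξ Ω e a b c α β γ h) (hh : h = - Ω x ^ 3 / 2) :
    mlieBracket 𝓘(ℝ, E4) (contractVec o (killingTensor nab σ ξ Ω) ξ) ξ x = 0 := by
  set t := contractVec o (killingTensor nab σ ξ Ω) ξ with ht
  have htx : t x = ∑ k, killingTensor nab σ ξ Ω x (e.basis k) (ξ x) • e.basis k := by
    rw [← e.sum_inner_smul (t x)]
    simp only [ht, inner_contractVec]
  have hv : ξ x = ∑ m, e.comp1 (ξ x) m • e.basis m := (e.sum_inner_smul (ξ x)).symm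
  have hgrad : ∀ i j, (inner ℝ (nab ξ x (e.basis i)) (e.basis j) : ℝ)
      = h * asdForm a b c i j + sdForm α β γ i j := hd.grad
  rw [mlieBracket_eq_nab hnab (smoothVAt_contractVec ho hH.smooth hξ x) (hξ x),
    ← e.sum_inner_smul (nab ξ x (t x) - nab t x (ξ x))]
  refine Finset.sum_eq_zero fun j _ ↦ ?_
  have h1 : (inner ℝ (nab ξ x (t x)) (e.basis j) : ℝ)
      = ∑ m, e.comp1 (ξ x) m * (-∑ k, killingTensor nab σ ξ Ω x (e.basis m) (e.basis k)
        * (h * asdForm a b c j k + sdForm α β γ j k)) := by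
    have h2 : ∀ k, killingTensor nab σ ξ Ω x (e.basis k) (ξ x)
        = ∑ m, e.comp1 (ξ x) m * killingTensor nab σ ξ Ω x (e.basis m) (e.basis k) := by
      intro k
      conv_lhs => rw [hv]
      rw [map_sum]
      refine Finset.sum_congr rfl fun m _ ↦ ?_
      rw [map_smul, smul_eq_mul, hH.symm]
    rw [htx, map_sum, sum_inner]
    simp only [map_smul, real_inner_smul_left, hgrad, h2, Finset.sum_mul, ← Finset.sum_neg_distrib,
      Finset.mul_sum]
    rw [Finset.sum_comm]
    refine Finset.sum_congr rfl fun m _ ↦ Finset.sum_congr rfl fun k _ ↦ ?_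
    rw [asdForm_antisymm a b c k j, sdForm_antisymm α β γ k j]
    ring
  have h3 : (inner ℝ (nab t x (ξ x)) (e.basis j) : ℝ)
      = ∑ k, e.comp1 (ξ x) k * covV nab t x (e.basis k) (e.basis j) := by
    conv_lhs => rw [hv]
    rw [map_sum, sum_inner]
    refine Finset.sum_congr rfl fun k _ ↦ ?_
    rw [map_smul, real_inner_smul_left, covV]
  have h4 := killingForm_vec_vec (e.comp1 (ξ x)) α β γ j
  have h5 : (inner ℝ (nab ξ x (t x) - nab t x (ξ x)) (e.basis j) : ℝ) = 0 := by
    rw [inner_sub_left, h1, h3]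
    simp only [ht, hd.covV_contractVec ho hnab hHK hσ hξ hKS hΩ hH hh,
      hd.sum_killingTensor_mul_grad hh]
    simp only [mul_add (e.comp1 (ξ x) _), Finset.sum_add_distrib]
    rw [h4, zero_add, ← Finset.sum_sub_distrib]
    refine Finset.sum_eq_zero fun m _ ↦ ?_
    rw [asdForm_antisymm a b c j m, sdForm_antisymm α β γ j m]
    ring
  rw [h5, zero_smul]

end KillingField

end HKSpinor

end

/-! ### The main theorem -/

theorem proposition6
    {M : Type*} [TopologicalSpace M] [T2Space M] [ConnectedSpace M]
    [ChartedSpace HKSpinor.E4 M] [IsManifold 𝓘(ℝ, HKSpinor.E4) ∞ M]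
    [RiemannianBundle (fun x : M ↦ TangentSpace 𝓘(ℝ, HKSpinor.E4) x)]
    [IsContMDiffRiemannianBundle 𝓘(ℝ, HKSpinor.E4) ∞ HKSpinor.E4
      (fun x : M ↦ TangentSpace 𝓘(ℝ, HKSpinor.E4) x)]
    -- the orientation and the Levi-Civita connection
    (o : ∀ x : M, Orientation ℝ (TangentSpace 𝓘(ℝ, HKSpinor.E4) x) (Fin 4))
    (ho : HKSpinor.IsOrientation o)
    (nab : HKSpinor.Connection M) (hnab : HKSpinor.IsLeviCivita nab)
    (hHK : HKSpinor.IsHyperKahler nab o)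
    -- the Killing spinor `σ_AB`, stored as the 2-form `σ_AB ε_A'B'`, its vector field `ξ` and `Ω₋`
    (σ : HKSpinor.Tensor2 M) (hσ : HKSpinor.IsSymSpinor o σ)
    (ξ : HKSpinor.VField M) (hξ : ∀ x, HKSpinor.SmoothVAt ξ x)
    (hKS : HKSpinor.IsKillingSpinor nab o σ ξ)
    (Ω : M → ℝ) (hΩ : HKSpinor.IsConformalFactor o σ Ω)
    -- normalisation of `σ`: `Ψ_ABCD σ^AB σ^CD = -4 Ω₋` at some point
    (hnorm : ∃ (x : M) (e : HKSpinor.OFrame o x),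
      ∑ A, ∑ B, ∑ C, ∑ D, e.Psi nab A B C D * HKSpinor.raise2 (e.sigma σ) A B
        * HKSpinor.raise2 (e.sigma σ) C D = -4 * (Ω x : ℂ))
    -- `ξ` is not anti-self-dual
    (hχ : ∃ (x : M) (e : HKSpinor.OFrame o x) (A' B' : Fin 2), e.chi nab ξ A' B' ≠ 0) :
    ∃ (H : HKSpinor.Tensor2 M) (t : HKSpinor.VField M),
      -- `H_ab = σ_AB χ_A'B' - ½ E₊ g_ab`
      (∀ (x : M) (e : HKSpinor.OFrame o x) (A A' B B' : Fin 2),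
        HKSpinor.spin2 (e.comp2 (fun u v ↦ H x u v)) A A' B B'
          = e.sigma σ A B * e.chi nab ξ A' B'
            - (1 / 2) * (HKSpinor.ernstPlus Ω ξ x : ℂ)
              * (HKSpinor.eps A B * HKSpinor.eps A' B')) ∧
      -- `t_a = H_ab ξ^b`
      (∀ (x : M) (v : TangentSpace 𝓘(ℝ, HKSpinor.E4) x), inner ℝ (t x) v = H x v (ξ x)) ∧
      HKSpinor.IsKillingTensor nab H ∧
      (∀ x, HKSpinor.SmoothVAt t x) ∧
      HKSpinor.IsKillingVector nab t ∧
      -- `∇_AA' t^A_B' = 0`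
      (∀ (x : M) (e : HKSpinor.OFrame o x) (A' B' : Fin 2), e.chi nab t A' B' = 0) ∧
      -- `[t, ξ] = 0`
      (∀ x : M, VectorField.mlieBracket 𝓘(ℝ, HKSpinor.E4) t ξ x = 0) := by
  have hdata : ∀ (x : M) (e : HKSpinor.OFrame o x), ∃ a b c α β γ h,
      HKSpinor.FrameData nab σ ξ Ω e a b c α β γ h ∧ h = - Ω x ^ 3 / 2 := by
    intro x e
    obtain ⟨a, b, c, α, β, γ, h, hd⟩ :=
      HKSpinor.exists_frameData ho hnab hHK hσ hξ hKS hΩ e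
    exact ⟨a, b, c, α, β, γ, h, hd,
      hd.anti_self_dual_part ho hnab hHK hσ hξ hKS hΩ hnorm⟩
  have hH := HKSpinor.isKillingTensor_killingTensor hnab ho hHK hσ hξ hKS hΩ hdata
  refine ⟨HKSpinor.killingTensor nab σ ξ Ω,
    HKSpinor.contractVec o (HKSpinor.killingTensor nab σ ξ Ω) ξ, fun x e A A' B B' ↦ ?_,
    fun x v ↦ HKSpinor.inner_contractVec v, hH,
    HKSpinor.smoothVAt_contractVec ho hH.smooth hξ, fun x u v ↦ ?_, fun x e A' B' ↦ ?_,
    fun x ↦ ?_⟩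
  · obtain ⟨a, b, c, α, β, γ, h, hd, hh⟩ := hdata x e
    rw [hd.chi_eq, HKSpinor.OFrame.sigma, hd.sigma, HKSpinor.unprimedPart_asdForm]
    exact HKSpinor.spin2_eq_of_scalar_product a b c α β γ _ (hd.killingTensor_eq hh) A A' B B'
  · obtain ⟨e⟩ := HKSpinor.exists_oFrame o x
    obtain ⟨a, b, c, α, β, γ, h, hd, hh⟩ := hdata x e
    obtain ⟨p, q, r, h1⟩ := hd.exists_covV_contractVec ho hnab hHK hσ hξ hKS hΩ hH hh
    set t := HKSpinor.contractVec o (HKSpinor.killingTensor nab σ ξ Ω) ξ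
    -- Antisymmetry of the frame components of ∇t extends to all tangent vectors by bilinearity.
    have h2 : HKSpinor.gradT nab t x = - (HKSpinor.gradT nab t x).flip := by
      refine e.eq_of_basis fun i j ↦ ?_
      have h3 := congrFun (congrFun h1 i) j
      rw [HKSpinor.asdForm_antisymm, ← h1] at h3
      exact h3
    have h3 := congrArg (fun B ↦ B u v) h2
    have h4 : HKSpinor.covV nab t x u v = - HKSpinor.covV nab t x v u := h3
    rw [h4, neg_add_cancel]
  · obtain ⟨a, b, c, α, β, γ, h, hd, hh⟩ := hdata x e
    obtain ⟨p, q, r, h1⟩ := hd.exists_covV_contractVec ho hnab hHK hσ hξ hKS hΩ hH hh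
    rw [HKSpinor.OFrame.chi, h1, HKSpinor.primedPart_asdForm]
  · obtain ⟨e⟩ := HKSpinor.exists_oFrame o x
    obtain ⟨a, b, c, α, β, γ, h, hd, hh⟩ := hdata x e
    exact hd.mlieBracket_contractVec ho hnab hHK hσ hξ hKS hΩ hH hh
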